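/- **Setting.** Let $\mathcal X\subseteq\mathbb R^{d_x}$, $\mathcal Y\subseteq\mathbb R^{d_y}$ be closed and convex, $\|y\|\le D_{\mathcal Y}$ on $\mathcal Y$ ($D_{\mathcal Y}>0$). Let $f,g$ be real functions of $(x,y)$, twice continuously differentiable at the points of $\mathcal X\times\mathcal Y$, with $\|\nabla^2 f\|\le l_{f,1}$, $\|\nabla^2 g\|\le l_{g,1}$ ($l_{f,1},l_{g,1}>0$), $\|\nabla_y f\|\le l_{f,0}$ and $|f|\le C_f$ on $\mathcal X\times\mathcal Y$. For $\rho>0$, $\sigma\ge 0$ put $$h_\sigma(x,y)=\sigma f(x,y)+g(x,y),\quad T(x,\sigma)=\arg\min_{y\in\mathcal Y}h_\sigma(x,y),\quad \mathbf{prox}_{\rho\varphi}(\theta)=\arg\min_{z\in\mathcal Y}\{\rho\varphi(z)+\tfrac12\|z-\theta\|^2\},$$ $$h_\sigma(x,y,w)=h_\sigma(x,w)+\tfrac1{2\rho}\|w-y\|^2,\qquad g(x,z,w)=g(x,w)+\tfrac1{2\rho}\|w-z\|^2,$$ $$h^*_{\sigma,\rho}(x,y)=\min_{w\in\mathcal Y}h_\sigma(x,y,w),\quad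 g^*_\rho(x,z)=\min_{w\in\mathcal Y}g(x,z,w),\quad g^*(x)=\min_{y\in\mathcal Y}g(x,y).$$ *Proximal error bound.* There are $\mu,\delta,\bar\sigma>0$ such that for all $x\in\mathcal X$, $\sigma\in[0,\bar\sigma]$, $y\in\mathcal Y$ and $w=\mathbf{prox}_{\rho h_\sigma(x,\cdot)}(y)$: if $\rho^{-1}\|y-w\|\le\delta$, then $\rho^{-1}\|y-w\|\ge\mu\inf_{t\in T(x,\sigma)}\|y-t\|$. *Oracles.* There are random seeds $\zeta,\xi$ and measurable estimators $\nabla f(x,y;\zeta)$, $\nabla g(x,y;\xi)$ that can be queried at two points with the same seed; on $\mathcal X\times\mathcal Y$ they are unbiased for $\nabla f,\nabla g$, have variance at most $\sigma_f^2,\sigma_g^2$, and are mean-squared smooth: $\mathbb E\|\nabla f(x_1,y_1;\zeta)-\nabla f(x_2,y_2;\zeta)\|^2\le l_{f,1}^2(\|x_1-x_2\|^2+\|y_1-y_2\|^2)$, and likewise for $g$ with $l_{g,1}$. *Bounded proximal gradients.* $\|\nabla_w h_\sigma(x,y,w)\|\le M_w$ at $w=\mathbf{prox}_{\rho h_\sigma(x,\cdot)}(y)$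 and $\|\nabla_w g(x,z,w)\|\le M_w$ at $w=\mathbf{prox}_{\rho g(x,\cdot)}(z)$, for all $x\in\mathcal X$, $y,z\in\mathcal Y$, $\sigma\in[0,\bar\sigma]$. **Algorithm.** Inputs: $\rho>0$ with $\rho\mu\le 3$ (automatic for small $\rho l_{g,1}$ unless neither $f$ nor $g$ depends on $y\in\mathcal Y$), $\alpha_k,\gamma_k>0$, $\beta_k\in(0,1]$, $\sigma_k\in(0,\bar\sigma]$ non-increasing, $\eta_k\in(0,1]$ with $\eta_0=1$, $x_0\in\mathcal X$, $y_0,z_0\in\mathcal Y$; $w_{y,0}=y_0$, $w_{z,0}=z_0$. For $k=0,1,\dots$, with fresh independent seeds for all six estimators, $$w_{y,k+1}=\Pi_{\mathcal Y}\{w_{y,k}-\gamma_k(\sigma_k\tilde f_{wy}^k+\tilde g_{wy}^k+\rho^{-1}(w_{y,k}-y_k))\},\quad w_{z,k+1}=\Pi_{\mathcal Y}\{w_{z,k}-\gamma_k(\tilde g_{wz}^k+\rho^{-1}(w_{z,k}-z_k))\},$$ $$y_{k+1}=(1-\beta_k)y_k+\beta_kw_{y,k+1},\quad z_{k+1}=(1-\beta_k)z_k+\beta_kw_{z,k+1},\quad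 x_{k+1}=\Pi_{\mathcal X}\{x_k-\alpha_k(\sigma_k\tilde f_x^k+\tilde g_{xy}^k-\tilde g_{xz}^k)\},$$ where $\tilde f_{wy}^k=\nabla_yf(x_k,w_{y,k};\zeta_{wy}^k)+(1-\eta_k)(\tilde f_{wy}^{k-1}-\nabla_yf(x_{k-1},w_{y,k-1};\zeta_{wy}^k))$; $\tilde g_{wy}^k$, $\tilde g_{wz}^k$ are formed in the same way from $\nabla_yg$ at $(x_k,w_{y,k})$, $(x_k,w_{z,k})$; and $\tilde f_x^k=\nabla_xf(x_k,w_{y,k+1};\zeta_x^k)+(1-\eta_k)(\tilde f_x^{k-1}-\nabla_xf(x_{k-1},w_{y,k};\zeta_x^k))$; $\tilde g_{xy}^k$, $\tilde g_{xz}^k$ are formed in the same way from $\nabla_xg$ at $(x_k,w_{y,k+1})$, $(x_k,w_{z,k+1})$. Let $w_{y,k}^*=\mathbf{prox}_{\rho h_{\sigma_k}(x_k,\cdot)}(y_k)$, $w_{z,k}^*=\mathbf{prox}_{\rho g(x_k,\cdot)}(z_k)$, $\hat x_k=\Pi_{\mathcal X}\{x_k-\alpha_k(\nabla_xh_{\sigma_k}(x_k,w_{y,k}^*)-\nabla_xg(x_k,w_{z,k}^*))\}$,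 $\Delta_k^x=\alpha_k^{-1}(x_k-\hat x_k)$. Let $e_{wy}^k=\sigma_k\tilde f_{wy}^k+\tilde g_{wy}^k-\nabla_yh_{\sigma_k}(x_k,w_{y,k})$, $e_{wz}^k=\tilde g_{wz}^k-\nabla_yg(x_k,w_{z,k})$, $e_x^k=\sigma_k\tilde f_x^k+\tilde g_{xy}^k-\tilde g_{xz}^k-(\nabla_xh_{\sigma_k}(x_k,w_{y,k+1})-\nabla_xg(x_k,w_{z,k+1}))$ for $k\ge0$, $e_x^{-1}:=0$, and let $\gamma_{-1}>0$. For constants $C,C_w,C_\eta$ put $$\mathbb V_k=\frac{h^*_{\sigma_k,\rho}(x_k,y_k)-g^*_\rho(x_k,z_k)}{\sigma_k}+\frac C{\sigma_k}(g_\rho^*(x_k,z_k)-g^*(x_k))+\frac{C_w}{\sigma_k\rho}\big(\|w_{y,k}-w_{y,k}^*\|^2+\|w_{z,k}-w_{z,k}^*\|^2\big)+\frac{C_\eta\rho^2}{\sigma_k\gamma_{k-1}}\big(\|e_x^{k-1}\|^2+\|e_{wy}^k\|^2+\|e_{wz}^k\|^2\big).$$ **Theorem.** There are universal constants $c_1,\dots,c_{10}>0$,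 $C\ge4$, $C_w,C_\eta,A>0$ such that the following holds for all problems and inputs as above. Suppose that for all $k\ge0$ $$\rho<\tfrac{c_2}{l_{g,1}},\quad \sigma_k<c_1\tfrac{l_{g,1}}{l_{f,1}},\quad \gamma_k<c_3\rho,\quad \beta_k\le c_4,\quad \alpha_k\le c_5\rho(1+l_{g,1}/\mu)^{-1},$$ $$\alpha_k\le c_6\rho^3\min(\mu^2,\delta^2/D_{\mathcal Y}^2)\beta_k,\qquad \frac{\sigma_k-\sigma_{k+1}}{\sigma_{k+1}}\le c_7\rho^2\min(\mu^2,\delta^2/D_{\mathcal Y}^2)\beta_k,$$ $$\rho\beta_k+\alpha_k\le c_8\gamma_k,\qquad \eta_{k+1}\ge c_9\rho^{-2}\max\big((l_{g,1}/\mu)\alpha_k\gamma_k,\gamma_k^2\big),\qquad \frac{\sigma_k\gamma_{k-1}}{\sigma_{k+1}\gamma_k}-1\le c_{10}\min(\eta_k,\eta_{k+1}).$$ Then for every $K\ge0$ the expectations below exist (the random variables are integrable) and $$\mathbb E\Big[\sum_{k=0}^{K-1}\frac{\alpha_k}{16\sigma_k}\|\Delta_k^x\|^2+\frac{\beta_k}{16\sigma_k\rho}\big(\|y_k-w_{y,k}^*\|^2+\|z_k-w_{z,k}^*\|^2\big)\Big]\le\mathbb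 E[\mathbb V_0-\mathbb V_K]$$ $$+\sum_{k=0}^{K-1}\Big(\frac{\sigma_k-\sigma_{k+1}}{\sigma_k}AC_f+\frac{AM_w^2\rho^2}{C_w\sigma_k\gamma_k}\Big(\frac{\sigma_k-\sigma_{k+1}}{\sigma_{k+1}}\Big)^2+C_\eta\rho^2\frac{A\eta_{k+1}^2}{\sigma_k\gamma_k}(\sigma_k^2\sigma_f^2+\sigma_g^2)\Big)+C_\eta\rho^2\frac{A\eta_0^2}{\sigma_0\gamma_0}(\sigma_0^2\sigma_f^2+\sigma_g^2)$$ $$+C_\eta A\rho^2l_{g,1}^2\Big(\frac{h_{\sigma_0}(x_0,y_0,w_{y,0})-h^*_{\sigma_0,\rho}(x_0,y_0)}{\sigma_0}+\frac{g(x_0,z_0,w_{z,0})-g^*_\rho(x_0,z_0)}{\sigma_0}\Big).$$ -/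

import Mathlib

open MeasureTheory ProbabilityTheory

noncomputable section

/-- Euclidean space of dimension `d`. -/
abbrev Vec (d : ℕ) : Type := EuclideanSpace ℝ (Fin d)

/-- The joint space of pairs `(x, y)`, with its Euclidean norm. -/
abbrev Joint (dx dy : ℕ) : Type := WithLp 2 (Vec dx × Vec dy)

/-- The pair `(x, y)` as a point of the joint space. -/
def pt {dx dy : ℕ} (x : Vec dx) (y : Vec dy) : Joint dx dy := WithLp.toLp 2 (x, y)

/-- `w` is a point of `argmin_{z ∈ S} { ρ φ(z) + ½ ‖z - θ‖² }`. -/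
def IsProx {d : ℕ} (S : Set (Vec d)) (ρ : ℝ) (φ : Vec d → ℝ) (θ w : Vec d) : Prop :=
  w ∈ S ∧ ∀ z ∈ S, ρ * φ w + 1 / 2 * ‖w - θ‖ ^ 2 ≤ ρ * φ z + 1 / 2 * ‖z - θ‖ ^ 2

/-- The proximal operator `prox_{ρφ}(θ)` over `S`. -/
def prox {d : ℕ} (S : Set (Vec d)) (ρ : ℝ) (φ : Vec d → ℝ) (θ : Vec d) : Vec d :=
  Classical.epsilon (IsProx S ρ φ θ)

/-- The Euclidean projection `Π_S(θ)`. -/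
def proj {d : ℕ} (S : Set (Vec d)) (θ : Vec d) : Vec d :=
  Classical.epsilon fun p => p ∈ S ∧ ∀ z ∈ S, ‖θ - p‖ ≤ ‖θ - z‖

/-- A stochastic bilevel problem: objectives `f`, `g`, domains `X`, `Y`, the laws of the random
seeds `ζ`, `ξ`, and the stochastic first-order oracles
`Gf (x, y) ζ = ∇f(x, y; ζ)`, `Gg (x, y) ξ = ∇g(x, y; ξ)`. -/
structure Bilevel (dx dy : ℕ) (Z Ξ : Type*) [MeasurableSpace Z] [MeasurableSpace Ξ] where
  f : Joint dx dy → ℝ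
  g : Joint dx dy → ℝ
  X : Set (Vec dx)
  Y : Set (Vec dy)
  lawζ : Measure Z
  lawξ : Measure Ξ
  Gf : Joint dx dy → Z → Joint dx dy
  Gg : Joint dx dy → Ξ → Joint dx dy

/-- The problem-dependent constants. -/
structure ProblemConsts where
  lf0 : ℝ
  lf1 : ℝ
  lg1 : ℝ
  Cf : ℝ
  DY : ℝ
  μ : ℝ
  δ : ℝ
  σbar : ℝ
  σf : ℝ
  σg : ℝ
  Mw : ℝ

/-- The inputs of the algorithm, apart from the number `K` of iterations. `γinit` is `γ_{-1}`, which
occurs only in the weight of the noise terms of the potential at time `0`. -/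
structure AlgInput (dx dy : ℕ) where
  ρ : ℝ
  α : ℕ → ℝ
  β : ℕ → ℝ
  γ : ℕ → ℝ
  σ : ℕ → ℝ
  η : ℕ → ℝ
  γinit : ℝ
  x₀ : Vec dx
  y₀ : Vec dy
  z₀ : Vec dy

namespace Bilevel

variable {dx dy : ℕ} {Z Ξ : Type*} [MeasurableSpace Z] [MeasurableSpace Ξ]

/-- `h_σ(x, y) = σ f(x, y) + g(x, y)`. -/
def h (B : Bilevel dx dy Z Ξ) (σ : ℝ) (x : Vec dx) (y : Vec dy) : ℝ :=
  σ * B.f (pt x y) + B.g (pt x y)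

/-- `g(x, y)` in curried form. -/
def gc (B : Bilevel dx dy Z Ξ) (x : Vec dx) (y : Vec dy) : ℝ := B.g (pt x y)

/-- The solution set `T(x, σ) = argmin_{y ∈ Y} h_σ(x, y)`. -/
def T (B : Bilevel dx dy Z Ξ) (x : Vec dx) (σ : ℝ) : Set (Vec dy) :=
  {y | y ∈ B.Y ∧ ∀ z ∈ B.Y, B.h σ x y ≤ B.h σ x z}

/-- `h_σ(x, y, w) = h_σ(x, w) + ‖w - y‖² / (2ρ)`. -/
def h3 (B : Bilevel dx dy Z Ξ) (ρ σ : ℝ) (x : Vec dx) (y w : Vec dy) : ℝ :=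
  B.h σ x w + 1 / (2 * ρ) * ‖w - y‖ ^ 2

/-- `g(x, z, w) = g(x, w) + ‖w - z‖² / (2ρ)`. -/
def g3 (B : Bilevel dx dy Z Ξ) (ρ : ℝ) (x : Vec dx) (z w : Vec dy) : ℝ :=
  B.gc x w + 1 / (2 * ρ) * ‖w - z‖ ^ 2

/-- The proximal envelope `h*_{σ,ρ}(x, y) = min_{w ∈ Y} h_σ(x, y, w)`. -/
def hEnv (B : Bilevel dx dy Z Ξ) (ρ σ : ℝ) (x : Vec dx) (y : Vec dy) : ℝ :=
  sInf ((fun w => B.h3 ρ σ x y w) '' B.Y)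

/-- The proximal envelope `g*_ρ(x, z) = min_{w ∈ Y} g(x, z, w)`. -/
def gEnv (B : Bilevel dx dy Z Ξ) (ρ : ℝ) (x : Vec dx) (z : Vec dy) : ℝ :=
  sInf ((fun w => B.g3 ρ x z w) '' B.Y)

/-- The lower-level value function `g*(x) = min_{y ∈ Y} g(x, y)`. -/
def gMin (B : Bilevel dx dy Z Ξ) (x : Vec dx) : ℝ :=
  sInf ((fun y => B.gc x y) '' B.Y)

/-- `prox_{ρ h_σ(x, ·)}(y)`. -/
def proxH (B : Bilevel dx dy Z Ξ) (ρ σ : ℝ) (x : Vec dx) (y : Vec dy) : Vec dy :=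
  prox B.Y ρ (B.h σ x) y

/-- `prox_{ρ g(x, ·)}(z)`. -/
def proxG (B : Bilevel dx dy Z Ξ) (ρ : ℝ) (x : Vec dx) (z : Vec dy) : Vec dy :=
  prox B.Y ρ (B.gc x) z

/-- `Φ_{σ,ρ}(x, y, z)` with constant `C`. -/
def Phi (B : Bilevel dx dy Z Ξ) (C ρ σ : ℝ) (x : Vec dx) (y z : Vec dy) : ℝ :=
  (B.hEnv ρ σ x y - B.gEnv ρ x z) / σ + C / σ * (B.gEnv ρ x z - B.gMin x)

/-! ### Partial gradients -/

/-- `∇_x f(x, y)`. -/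
def fx (B : Bilevel dx dy Z Ξ) (x : Vec dx) (y : Vec dy) : Vec dx := (gradient B.f (pt x y)).fst

/-- `∇_y f(x, y)`. -/
def fy (B : Bilevel dx dy Z Ξ) (x : Vec dx) (y : Vec dy) : Vec dy := (gradient B.f (pt x y)).snd

/-- `∇_x g(x, y)`. -/
def gx (B : Bilevel dx dy Z Ξ) (x : Vec dx) (y : Vec dy) : Vec dx := (gradient B.g (pt x y)).fst

/-- `∇_y g(x, y)`. -/
def gy (B : Bilevel dx dy Z Ξ) (x : Vec dx) (y : Vec dy) : Vec dy := (gradient B.g (pt x y)).snd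

/-- `∇_x f(x, y; ζ)`. -/
def sfx (B : Bilevel dx dy Z Ξ) (x : Vec dx) (y : Vec dy) (ζ : Z) : Vec dx := (B.Gf (pt x y) ζ).fst

/-- `∇_y f(x, y; ζ)`. -/
def sfy (B : Bilevel dx dy Z Ξ) (x : Vec dx) (y : Vec dy) (ζ : Z) : Vec dy := (B.Gf (pt x y) ζ).snd

/-- `∇_x g(x, y; ξ)`. -/
def sgx (B : Bilevel dx dy Z Ξ) (x : Vec dx) (y : Vec dy) (ξ : Ξ) : Vec dx := (B.Gg (pt x y) ξ).fst

/-- `∇_y g(x, y; ξ)`. -/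
def sgy (B : Bilevel dx dy Z Ξ) (x : Vec dx) (y : Vec dy) (ξ : Ξ) : Vec dy := (B.Gg (pt x y) ξ).snd

/-! ### Assumptions on the problem -/

/-- `φ` is twice continuously differentiable and `l`-smooth on `X × Y`. -/
def SmoothOn (B : Bilevel dx dy Z Ξ) (φ : Joint dx dy → ℝ) (l : ℝ) : Prop :=
  ∀ x ∈ B.X, ∀ y ∈ B.Y,
    ContDiffAt ℝ 2 φ (pt x y) ∧ ‖fderiv ℝ (gradient φ) (pt x y)‖ ≤ l

/-- The `(μ, δ)`-proximal error bound for all `x ∈ X` and `σ ∈ [0, σbar]`. -/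
def ProximalEB (B : Bilevel dx dy Z Ξ) (ρ μ δ σbar : ℝ) : Prop :=
  ∀ x ∈ B.X, ∀ σ ∈ Set.Icc 0 σbar, ∀ y ∈ B.Y, ∀ w, IsProx B.Y ρ (B.h σ x) y w →
    ρ⁻¹ * ‖y - w‖ ≤ δ → μ * Metric.infDist y (B.T x σ) ≤ ρ⁻¹ * ‖y - w‖

/-- `G` is a (jointly measurable) unbiased oracle for `∇φ` on `X × Y`, of variance at most `s²`. -/
def UnbiasedOracle (B : Bilevel dx dy Z Ξ) {S : Type*} [MeasurableSpace S] (law : Measure S)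
    (φ : Joint dx dy → ℝ) (G : Joint dx dy → S → Joint dx dy) (s : ℝ) : Prop :=
  (Measurable fun q : Joint dx dy × S => G q.1 q.2) ∧
  ∀ x ∈ B.X, ∀ y ∈ B.Y,
    Integrable (G (pt x y)) law ∧
    ∫ t, G (pt x y) t ∂law = gradient φ (pt x y) ∧
    Integrable (fun t => ‖G (pt x y) t - gradient φ (pt x y)‖ ^ 2) law ∧
    ∫ t, ‖G (pt x y) t - gradient φ (pt x y)‖ ^ 2 ∂law ≤ s ^ 2

/-- Mean-squared smoothness of the oracle `G`, both points being queried with the same seed. -/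
def MeanSquaredSmooth (B : Bilevel dx dy Z Ξ) {S : Type*} [MeasurableSpace S] (law : Measure S)
    (G : Joint dx dy → S → Joint dx dy) (l : ℝ) : Prop :=
  ∀ x₁ ∈ B.X, ∀ y₁ ∈ B.Y, ∀ x₂ ∈ B.X, ∀ y₂ ∈ B.Y,
    ∫ t, ‖G (pt x₁ y₁) t - G (pt x₂ y₂) t‖ ^ 2 ∂law
      ≤ l ^ 2 * (‖x₁ - x₂‖ ^ 2 + ‖y₁ - y₂‖ ^ 2)

/-- Boundedness of the gradients of the proximal subproblems at their solutions. -/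
def BoundedProxGradients (B : Bilevel dx dy Z Ξ) (ρ σbar Mw : ℝ) : Prop :=
  (∀ x ∈ B.X, ∀ σ ∈ Set.Icc 0 σbar, ∀ y ∈ B.Y, ∀ w, IsProx B.Y ρ (B.h σ x) y w →
    ‖gradient (fun w' => B.h3 ρ σ x y w') w‖ ≤ Mw) ∧
  (∀ x ∈ B.X, ∀ z ∈ B.Y, ∀ w, IsProx B.Y ρ (B.gc x) z w →
    ‖gradient (fun w' => B.g3 ρ x z w') w‖ ≤ Mw)

/-- All the assumptions on the problem and its oracles. -/
structure Assumptions (B : Bilevel dx dy Z Ξ) (c : ProblemConsts) (ρ : ℝ) : Prop where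
  lf1_pos : 0 < c.lf1
  lg1_pos : 0 < c.lg1
  DY_pos : 0 < c.DY
  μ_pos : 0 < c.μ
  δ_pos : 0 < c.δ
  σbar_pos : 0 < c.σbar
  σf_nonneg : 0 ≤ c.σf
  σg_nonneg : 0 ≤ c.σg
  proximalEB : B.ProximalEB ρ c.μ c.δ c.σbar
  smooth_f : B.SmoothOn B.f c.lf1
  smooth_g : B.SmoothOn B.g c.lg1
  grad_f : ∀ x ∈ B.X, ∀ y ∈ B.Y, ‖B.fy x y‖ ≤ c.lf0
  convex_X : Convex ℝ B.X
  closed_X : IsClosed B.X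
  convex_Y : Convex ℝ B.Y
  closed_Y : IsClosed B.Y
  bounded_Y : ∀ y ∈ B.Y, ‖y‖ ≤ c.DY
  bounded_f : ∀ x ∈ B.X, ∀ y ∈ B.Y, |B.f (pt x y)| ≤ c.Cf
  prob_ζ : IsProbabilityMeasure B.lawζ
  prob_ξ : IsProbabilityMeasure B.lawξ
  oracle_f : B.UnbiasedOracle B.lawζ B.f B.Gf c.σf
  oracle_g : B.UnbiasedOracle B.lawξ B.g B.Gg c.σg
  mss_f : B.MeanSquaredSmooth B.lawζ B.Gf c.lf1
  mss_g : B.MeanSquaredSmooth B.lawξ B.Gg c.lg1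
  proxGrad : B.BoundedProxGradients ρ c.σbar c.Mw

end Bilevel

/-! ### The momentum-assisted single-loop algorithm -/

/-- The seeds used in one iteration: `(ζ_wy, ζ_x, ξ_wy, ξ_wz, ξ_xy, ξ_xz)`. -/
abbrev Seeds (Z Ξ : Type*) : Type _ := Z × Z × Ξ × Ξ × Ξ × Ξ

namespace Seeds

variable {Z Ξ : Type*}

def ζwy (s : Seeds Z Ξ) : Z := s.1
def ζx (s : Seeds Z Ξ) : Z := s.2.1
def ξwy (s : Seeds Z Ξ) : Ξ := s.2.2.1
def ξwz (s : Seeds Z Ξ) : Ξ := s.2.2.2.1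
def ξxy (s : Seeds Z Ξ) : Ξ := s.2.2.2.2.1
def ξxz (s : Seeds Z Ξ) : Ξ := s.2.2.2.2.2

end Seeds

/-- The joint law of the six independent seeds used in one iteration. -/
def Bilevel.seedLaw {dx dy : ℕ} {Z Ξ : Type*} [MeasurableSpace Z] [MeasurableSpace Ξ]
    (B : Bilevel dx dy Z Ξ) : Measure (Seeds Z Ξ) :=
  B.lawζ.prod (B.lawζ.prod (B.lawξ.prod (B.lawξ.prod (B.lawξ.prod B.lawξ))))

/-- The state at the start of iteration `k`: the current iterates `x_k, y_k, z_k, w_{y,k}, w_{z,k}`,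
the previous points `x_{k-1}, w_{y,k-1}, w_{z,k-1}`, and the six gradient estimators of
iteration `k - 1`. -/
structure AlgState (dx dy : ℕ) where
  x : Vec dx
  y : Vec dy
  z : Vec dy
  wy : Vec dy
  wz : Vec dy
  xp : Vec dx
  wyp : Vec dy
  wzp : Vec dy
  fwyp : Vec dy
  gwyp : Vec dy
  gwzp : Vec dy
  fxp : Vec dx
  gxyp : Vec dx
  gxzp : Vec dx

/-- The momentum-assisted estimator `new + (1 - η) (prev - old)`. -/
def momentum {d : ℕ} (η : ℝ) (new prev old : Vec d) : Vec d := new + (1 - η) • (prev - old)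

namespace Alg

variable {dx dy : ℕ} {Z Ξ : Type*} [MeasurableSpace Z] [MeasurableSpace Ξ]

/-- The estimator `f̃_wy^k`. -/
def estFwy (B : Bilevel dx dy Z Ξ) (I : AlgInput dx dy) (k : ℕ) (st : AlgState dx dy)
    (s : Seeds Z Ξ) : Vec dy :=
  momentum (I.η k) (B.sfy st.x st.wy s.ζwy) st.fwyp (B.sfy st.xp st.wyp s.ζwy)

/-- The estimator `g̃_wy^k`. -/
def estGwy (B : Bilevel dx dy Z Ξ) (I : AlgInput dx dy) (k : ℕ) (st : AlgState dx dy)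
    (s : Seeds Z Ξ) : Vec dy :=
  momentum (I.η k) (B.sgy st.x st.wy s.ξwy) st.gwyp (B.sgy st.xp st.wyp s.ξwy)

/-- The estimator `g̃_wz^k`. -/
def estGwz (B : Bilevel dx dy Z Ξ) (I : AlgInput dx dy) (k : ℕ) (st : AlgState dx dy)
    (s : Seeds Z Ξ) : Vec dy :=
  momentum (I.η k) (B.sgy st.x st.wz s.ξwz) st.gwzp (B.sgy st.xp st.wzp s.ξwz)

/-- `w_{y,k+1}`. -/
def nextWy (B : Bilevel dx dy Z Ξ) (I : AlgInput dx dy) (k : ℕ) (st : AlgState dx dy)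
    (s : Seeds Z Ξ) : Vec dy :=
  proj B.Y (st.wy - I.γ k •
    (I.σ k • estFwy B I k st s + estGwy B I k st s + I.ρ⁻¹ • (st.wy - st.y)))

/-- `w_{z,k+1}`. -/
def nextWz (B : Bilevel dx dy Z Ξ) (I : AlgInput dx dy) (k : ℕ) (st : AlgState dx dy)
    (s : Seeds Z Ξ) : Vec dy :=
  proj B.Y (st.wz - I.γ k • (estGwz B I k st s + I.ρ⁻¹ • (st.wz - st.z)))

/-- The estimator `f̃_x^k`, at `(x_k, w_{y,k+1})` with previous point `(x_{k-1}, w_{y,k})`. -/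
def estFx (B : Bilevel dx dy Z Ξ) (I : AlgInput dx dy) (k : ℕ) (st : AlgState dx dy)
    (s : Seeds Z Ξ) : Vec dx :=
  momentum (I.η k) (B.sfx st.x (nextWy B I k st s) s.ζx) st.fxp (B.sfx st.xp st.wy s.ζx)

/-- The estimator `g̃_xy^k`. -/
def estGxy (B : Bilevel dx dy Z Ξ) (I : AlgInput dx dy) (k : ℕ) (st : AlgState dx dy)
    (s : Seeds Z Ξ) : Vec dx :=
  momentum (I.η k) (B.sgx st.x (nextWy B I k st s) s.ξxy) st.gxyp (B.sgx st.xp st.wy s.ξxy)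

/-- The estimator `g̃_xz^k`. -/
def estGxz (B : Bilevel dx dy Z Ξ) (I : AlgInput dx dy) (k : ℕ) (st : AlgState dx dy)
    (s : Seeds Z Ξ) : Vec dx :=
  momentum (I.η k) (B.sgx st.x (nextWz B I k st s) s.ξxz) st.gxzp (B.sgx st.xp st.wz s.ξxz)

/-- One iteration of the algorithm. -/
def step (B : Bilevel dx dy Z Ξ) (I : AlgInput dx dy) (k : ℕ) (st : AlgState dx dy)
    (s : Seeds Z Ξ) : AlgState dx dy where
  wy := nextWy B I k st s
  wz := nextWz B I k st s
  y := (1 - I.β k) • st.y + I.β k • nextWy B I k st s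
  z := (1 - I.β k) • st.z + I.β k • nextWz B I k st s
  x := proj B.X (st.x - I.α k •
    (I.σ k • estFx B I k st s + estGxy B I k st s - estGxz B I k st s))
  xp := st.x
  wyp := st.wy
  wzp := st.wz
  fwyp := estFwy B I k st s
  gwyp := estGwy B I k st s
  gwzp := estGwz B I k st s
  fxp := estFx B I k st s
  gxyp := estGxy B I k st s
  gxzp := estGxz B I k st s

/-- The initial state. The previous points and estimators are placeholders: they are multiplied by
`1 - η_0 = 0`. -/
def init (I : AlgInput dx dy) : AlgState dx dy where
  x := I.x₀
  y := I.y₀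
  z := I.z₀
  wy := I.y₀
  wz := I.z₀
  xp := I.x₀
  wyp := I.y₀
  wzp := I.z₀
  fwyp := 0
  gwyp := 0
  gwzp := 0
  fxp := 0
  gxyp := 0
  gxzp := 0

/-- The state at the start of iteration `k`, for the sequence `s` of seeds. -/
def state (B : Bilevel dx dy Z Ξ) (I : AlgInput dx dy) (s : ℕ → Seeds Z Ξ) : ℕ → AlgState dx dy
  | 0 => init I
  | k + 1 => step B I k (state B I s k) (s k)

/-- `w*_{y,k} = prox_{ρ h_{σ_k}(x_k, ·)}(y_k)`. -/
def wyStar (B : Bilevel dx dy Z Ξ) (I : AlgInput dx dy) (s : ℕ → Seeds Z Ξ) (k : ℕ) : Vec dy :=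
  B.proxH I.ρ (I.σ k) (state B I s k).x (state B I s k).y

/-- `w*_{z,k} = prox_{ρ g(x_k, ·)}(z_k)`. -/
def wzStar (B : Bilevel dx dy Z Ξ) (I : AlgInput dx dy) (s : ℕ → Seeds Z Ξ) (k : ℕ) : Vec dy :=
  B.proxG I.ρ (state B I s k).x (state B I s k).z

/-- `x̂_k`, the exact projected gradient step from `x_k`. -/
def xHat (B : Bilevel dx dy Z Ξ) (I : AlgInput dx dy) (s : ℕ → Seeds Z Ξ) (k : ℕ) : Vec dx :=
  proj B.X ((state B I s k).x - I.α k •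
    (I.σ k • B.fx (state B I s k).x (wyStar B I s k) + B.gx (state B I s k).x (wyStar B I s k)
      - B.gx (state B I s k).x (wzStar B I s k)))

/-- `Δ_k^x = α_k⁻¹ (x_k - x̂_k)`. -/
def deltaX (B : Bilevel dx dy Z Ξ) (I : AlgInput dx dy) (s : ℕ → Seeds Z Ξ) (k : ℕ) : Vec dx :=
  (I.α k)⁻¹ • ((state B I s k).x - xHat B I s k)

/-- The estimator error `e_wy^k`. -/
def errWy (B : Bilevel dx dy Z Ξ) (I : AlgInput dx dy) (s : ℕ → Seeds Z Ξ) (k : ℕ) : Vec dy :=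
  (I.σ k • estFwy B I k (state B I s k) (s k) + estGwy B I k (state B I s k) (s k))
    - (I.σ k • B.fy (state B I s k).x (state B I s k).wy
        + B.gy (state B I s k).x (state B I s k).wy)

/-- The estimator error `e_wz^k`. -/
def errWz (B : Bilevel dx dy Z Ξ) (I : AlgInput dx dy) (s : ℕ → Seeds Z Ξ) (k : ℕ) : Vec dy :=
  estGwz B I k (state B I s k) (s k) - B.gy (state B I s k).x (state B I s k).wz

/-- The estimator error `e_x^k`. -/
def errX (B : Bilevel dx dy Z Ξ) (I : AlgInput dx dy) (s : ℕ → Seeds Z Ξ) (k : ℕ) : Vec dx :=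
  (I.σ k • estFx B I k (state B I s k) (s k)
      + (estGxy B I k (state B I s k) (s k) - estGxz B I k (state B I s k) (s k)))
    - (I.σ k • B.fx (state B I s k).x (state B I s (k + 1)).wy
        + B.gx (state B I s k).x (state B I s (k + 1)).wy
        - B.gx (state B I s k).x (state B I s (k + 1)).wz)

/-- `‖e_x^{k-1}‖²`, with `e_x^{-1} = 0` (there is no estimator before the first iteration). -/
def errXPrevSq (B : Bilevel dx dy Z Ξ) (I : AlgInput dx dy) (s : ℕ → Seeds Z Ξ) : ℕ → ℝ
  | 0 => 0
  | k + 1 => ‖errX B I s k‖ ^ 2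

/-- `γ_{k-1}`. -/
def gammaPrev (I : AlgInput dx dy) : ℕ → ℝ
  | 0 => I.γinit
  | k + 1 => I.γ k

/-- The potential `V_k`. -/
def potential (B : Bilevel dx dy Z Ξ) (I : AlgInput dx dy) (C Cw Cη : ℝ) (s : ℕ → Seeds Z Ξ)
    (k : ℕ) : ℝ :=
  B.Phi C I.ρ (I.σ k) (state B I s k).x (state B I s k).y (state B I s k).z
  + Cw / (I.σ k * I.ρ) *
      (‖(state B I s k).wy - wyStar B I s k‖ ^ 2 + ‖(state B I s k).wz - wzStar B I s k‖ ^ 2)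
  + Cη * I.ρ ^ 2 / (I.σ k * gammaPrev I k) *
      (errXPrevSq B I s k + ‖errWy B I s k‖ ^ 2 + ‖errWz B I s k‖ ^ 2)

/-- The weighted sum of squared stationarity residuals over the first `K` iterations. -/
def residual (B : Bilevel dx dy Z Ξ) (I : AlgInput dx dy) (K : ℕ) (s : ℕ → Seeds Z Ξ) : ℝ :=
  ∑ k ∈ Finset.range K,
    (I.α k / (16 * I.σ k) * ‖deltaX B I s k‖ ^ 2
      + I.β k / (16 * I.σ k * I.ρ) *
        (‖(state B I s k).y - wyStar B I s k‖ ^ 2 + ‖(state B I s k).z - wzStar B I s k‖ ^ 2))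

/-- The admissible inputs: ranges of the parameters and initial points. -/
structure Admissible (B : Bilevel dx dy Z Ξ) (p : ProblemConsts) (I : AlgInput dx dy) : Prop where
  ρ_pos : 0 < I.ρ
  ρμ_le : I.ρ * p.μ ≤ 3
  α_pos : ∀ k, 0 < I.α k
  β_pos : ∀ k, 0 < I.β k
  β_le : ∀ k, I.β k ≤ 1
  γ_pos : ∀ k, 0 < I.γ k
  γinit_pos : 0 < I.γinit
  σ_pos : ∀ k, 0 < I.σ k
  σ_le : ∀ k, I.σ k ≤ p.σbar
  σ_anti : Antitone I.σ
  η_pos : ∀ k, 0 < I.η k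
  η_le : ∀ k, I.η k ≤ 1
  η_zero : I.η 0 = 1
  x₀_mem : I.x₀ ∈ B.X
  y₀_mem : I.y₀ ∈ B.Y
  z₀_mem : I.z₀ ∈ B.Y

/-- The step-size and momentum conditions, with universal constants `c₁, …, c₁₀`. -/
structure StepConditions (p : ProblemConsts) (I : AlgInput dx dy)
    (c₁ c₂ c₃ c₄ c₅ c₆ c₇ c₈ c₉ c₁₀ : ℝ) : Prop where
  cond_ρ : I.ρ < c₂ / p.lg1
  cond_σ : ∀ k, I.σ k < c₁ * p.lg1 / p.lf1
  cond_γ : ∀ k, I.γ k < c₃ * I.ρ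
  cond_β : ∀ k, I.β k ≤ c₄
  cond_α : ∀ k, I.α k ≤ c₅ * I.ρ * (1 + p.lg1 / p.μ)⁻¹
  cond_αβ : ∀ k, I.α k ≤ c₆ * I.ρ ^ 3 * min (p.μ ^ 2) (p.δ ^ 2 / p.DY ^ 2) * I.β k
  cond_σβ : ∀ k, (I.σ k - I.σ (k + 1)) / I.σ (k + 1)
    ≤ c₇ * I.ρ ^ 2 * min (p.μ ^ 2) (p.δ ^ 2 / p.DY ^ 2) * I.β k
  cond_βαγ : ∀ k, I.ρ * I.β k + I.α k ≤ c₈ * I.γ k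
  cond_η : ∀ k, c₉ * (I.ρ ^ 2)⁻¹ * max (p.lg1 / p.μ * I.α k * I.γ k) (I.γ k ^ 2) ≤ I.η (k + 1)
  cond_decay : ∀ k, I.σ k * gammaPrev I k / (I.σ (k + 1) * I.γ k) - 1
    ≤ c₁₀ * min (I.η k) (I.η (k + 1))

end Alg

end

/-! The proof is a Lyapunov descent in which three mechanisms pay for each other.

Envelopes. Using the old proximal point as a trial point at the new data bounds the new Moreau
envelope by a linear model with x-gradient ∇_x h(x, w*) and y-gradient ρ⁻¹(y - w*)
(`SmoothPair.prox_value_move`). Hence averaging y and z towards w_y and w_z gains β/ρ times the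
squared proximal residuals, and the projected x-step gains α‖Δ‖² and ‖x_{k+1} - x_k‖²/α. The
dangerous term is -g*(x): its slope is ∇_x g at a lower-level solution t, not at w_z*. The proximal
error bound controls ‖w_z* - t‖ by the residual of z (`value_move`), and α ≲ ρ³μ²β lets the residual
gain absorb the mismatch. The same bound pays for the change of the factor 1/σ (`outer_rescale`).
Everything is collected in `outer_step_estimate`.

Tracking. One inexact projected gradient step contracts ‖w - w*‖² by 1 - γ/(2ρ), because the
subproblem is strongly convex for small ρ l_{g,1}. Since ρβ + α is much smaller than γ, w* moves
slowly compared with this contraction. A term not visible in the potential is carried along: the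
optimality gap of the subproblems, with weight 1000 ρ² l_{g,1}². Its decrease supplies -‖w_{k+1} -
w_k‖²/γ, which the noise estimate needs. The gap is nonnegative, so it is dropped at time K, and its
value at time 0 is the last term of the theorem. This is `inner_step_estimate`; together with the
outer estimate it gives the pathwise inequality `potential_step`.

Noise. The error of a momentum estimator satisfies d_{k+1} = (1 - η) d_k + N, where N has mean zero
given everything except one fresh seed, and E‖N‖² is at most a variance term of order η² plus l²
times the squared displacement of the query point. Conditional expectations are replaced by Fubini:
erasing one seed (`mask`) gives a map T, and N is orthogonal to all T-invariant square integrable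
functions (`NoiseStep`). The six errors are followed separately, so that the changing σ enters only
as a weight; those added in the same e_k are orthogonal, so the second moments of the e_k are exact
weighted sums. The weights ρ²/(σγ) lose enough per step through (1 - η)² to pay for the errors in
the pathwise inequality (`noiseWeight_decay`, `errXWeight_decay`), and the displacements are paid
for by the gains in ‖x_{k+1} - x_k‖² and ‖w_{k+1} - w_k‖² (`noisePotential_step`). Adding both
inequalities telescopes (`expected_descent`). -/

/-! ### Projections -/

section Projection

variable {d : ℕ} {S : Set (Vec d)}

/-- The projection is an epsilon choice of a nearest point. Completeness and convexity make one
exist, and minimality of the distance is equivalent to the obtuse-angle inequality. -/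
theorem proj_spec (hc : Convex ℝ S) (hcl : IsClosed S) (hne : S.Nonempty) (θ : Vec d) :
    proj S θ ∈ S ∧ ∀ z ∈ S, inner ℝ (θ - proj S θ) (z - proj S θ) ≤ 0 := by
  obtain ⟨v, hv, hmin⟩ := exists_norm_eq_iInf_of_complete_convex hne hcl.isComplete hc θ
  have hex : ∃ p, p ∈ S ∧ ∀ z ∈ S, ‖θ - p‖ ≤ ‖θ - z‖ := by
    refine ⟨v, hv, fun z hz => ?_⟩
    rw [hmin]
    exact ciInf_le ⟨0, by rintro _ ⟨w, rfl⟩; positivity⟩ (⟨z, hz⟩ : S)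
  have hp : proj S θ ∈ S ∧ ∀ z ∈ S, ‖θ - proj S θ‖ ≤ ‖θ - z‖ := Classical.epsilon_spec hex
  refine ⟨hp.1, ?_⟩
  rw [← norm_eq_iInf_iff_real_inner_le_zero hc hp.1]
  have : Nonempty S := ⟨⟨_, hp.1⟩⟩
  exact le_antisymm (le_ciInf fun z => hp.2 z z.2)
    (ciInf_le ⟨0, by rintro _ ⟨w, rfl⟩; positivity⟩ (⟨_, hp.1⟩ : S))

theorem proj_mem (hc : Convex ℝ S) (hcl : IsClosed S) (hne : S.Nonempty) (θ : Vec d) :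
    proj S θ ∈ S := (proj_spec hc hcl hne θ).1

/-- Nonexpansiveness, with `p` known only through its variational inequality. This covers proximal
points, where `a` is an exact gradient step from `p`, and arbitrary feasible points, where `a = p`.
-/
theorem norm_proj_sub_le_of_vi (hc : Convex ℝ S) (hcl : IsClosed S) {a p : Vec d} (hp : p ∈ S)
    (hvi : ∀ z ∈ S, inner ℝ (a - p) (z - p) ≤ 0) (b : Vec d) : ‖proj S b - p‖ ≤ ‖b - a‖ := by
  obtain ⟨hm, hv⟩ := proj_spec hc hcl ⟨p, hp⟩ b
  have h1 := hv p hp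
  have h2 := hvi _ hm
  set q := proj S b
  have h3 : ‖q - p‖ ^ 2 ≤ inner ℝ (b - a) (q - p) := by
    have e1 : inner ℝ (b - q) (p - q) = - inner ℝ (b - q) (q - p) := by
      rw [← inner_neg_right, neg_sub]
    have e2 : inner ℝ (b - a) (q - p)
        = inner ℝ (b - q) (q - p) + inner ℝ (q - p) (q - p) - inner ℝ (a - p) (q - p) := by
      rw [← inner_add_left, ← inner_sub_left]; congr 1; abel
    rw [e2, real_inner_self_eq_norm_sq]; linarith
  have h4 := real_inner_le_norm (b - a) (q - p)
  by_contra! h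
  nlinarith [norm_nonneg (q - p), norm_nonneg (b - a)]

theorem norm_proj_sub_proj_le (hc : Convex ℝ S) (hcl : IsClosed S) (hne : S.Nonempty)
    (a b : Vec d) : ‖proj S b - proj S a‖ ≤ ‖b - a‖ :=
  norm_proj_sub_le_of_vi hc hcl (proj_mem hc hcl hne a) (proj_spec hc hcl hne a).2 b

theorem continuous_proj (hc : Convex ℝ S) (hcl : IsClosed S) (hne : S.Nonempty) :
    Continuous (proj S) := by
  refine LipschitzWith.continuous (K := 1) (LipschitzWith.of_dist_le_mul fun a b => ?_)
  simpa [dist_eq_norm] using norm_proj_sub_proj_le hc hcl hne b a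

/-- A projected step `p = Π_S(x - t v)` from `x ∈ S` is a descent direction. -/
theorem inner_proj_step_le (hc : Convex ℝ S) (hcl : IsClosed S) {x : Vec d} (hx : x ∈ S)
    {t : ℝ} (ht : 0 < t) (v : Vec d) :
    inner ℝ v (proj S (x - t • v) - x) ≤ - (‖proj S (x - t • v) - x‖ ^ 2 / t) := by
  have h := (proj_spec hc hcl ⟨x, hx⟩ (x - t • v)).2 x hx
  set p := proj S (x - t • v)
  have e : inner ℝ (x - t • v - p) (x - p) = ‖p - x‖ ^ 2 + t * inner ℝ v (p - x) := by
    have e1 : x - t • v - p = -((p - x) + t • v) := by abel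
    have e2 : x - p = -(p - x) := by abel
    rw [e1, e2, inner_neg_neg, inner_add_left, real_inner_self_eq_norm_sq, real_inner_smul_left]
  rw [e] at h
  rw [← neg_div, le_div_iff₀ ht]; linarith

end Projection

/-! ### Smooth functions of two variables -/

/-- `φ`, with partial gradients `φx` and `φy`, is smooth on `X × Y` with constant `Λ`. -/
structure SmoothPair {dx dy : ℕ} (X : Set (Vec dx)) (Y : Set (Vec dy)) (φ : Vec dx → Vec dy → ℝ)
    (φx : Vec dx → Vec dy → Vec dx) (φy : Vec dx → Vec dy → Vec dy) (Λ : ℝ) : Prop where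
  taylor : ∀ x ∈ X, ∀ w ∈ Y, ∀ x' ∈ X, ∀ w' ∈ Y,
    |φ x' w' - φ x w - inner ℝ (φx x w) (x' - x) - inner ℝ (φy x w) (w' - w)|
      ≤ Λ * (‖x' - x‖ ^ 2 + ‖w' - w‖ ^ 2)
  lip_x : ∀ x ∈ X, ∀ w ∈ Y, ∀ x' ∈ X, ∀ w' ∈ Y,
    ‖φx x' w' - φx x w‖ ≤ Λ * (‖x' - x‖ + ‖w' - w‖)
  lip_y : ∀ x ∈ X, ∀ w ∈ Y, ∀ x' ∈ X, ∀ w' ∈ Y,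
    ‖φy x' w' - φy x w‖ ≤ Λ * (‖x' - x‖ + ‖w' - w‖)

namespace SmoothPair

variable {dx dy : ℕ} {X : Set (Vec dx)} {Y : Set (Vec dy)} {φ ψ : Vec dx → Vec dy → ℝ}
  {φx ψx : Vec dx → Vec dy → Vec dx} {φy ψy : Vec dx → Vec dy → Vec dy} {Λ M : ℝ}

theorem mono (h : SmoothPair X Y φ φx φy Λ) (hM : Λ ≤ M) : SmoothPair X Y φ φx φy M where
  taylor x hx w hw x' hx' w' hw' := (h.taylor x hx w hw x' hx' w' hw').trans (by gcongr)
  lip_x x hx w hw x' hx' w' hw' := (h.lip_x x hx w hw x' hx' w' hw').trans (by gcongr)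
  lip_y x hx w hw x' hx' w' hw' := (h.lip_y x hx w hw x' hx' w' hw').trans (by gcongr)

theorem smul_add (h : SmoothPair X Y φ φx φy Λ) (h' : SmoothPair X Y ψ ψx ψy M) {σ : ℝ}
    (hσ : 0 ≤ σ) : SmoothPair X Y (fun x w => σ * φ x w + ψ x w)
      (fun x w => σ • φx x w + ψx x w) (fun x w => σ • φy x w + ψy x w) (σ * Λ + M) where
  taylor x hx w hw x' hx' w' hw' := by
    have h1 := abs_le.1 (h.taylor x hx w hw x' hx' w' hw')
    have h2 := abs_le.1 (h'.taylor x hx w hw x' hx' w' hw')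
    simp only [inner_add_left, real_inner_smul_left]
    rw [abs_le]
    have h3 := mul_le_mul_of_nonneg_left h1.1 hσ
    have h4 := mul_le_mul_of_nonneg_left h1.2 hσ
    constructor <;> linarith [h2.1, h2.2]
  lip_x x hx w hw x' hx' w' hw' := by
    have h1 := h.lip_x x hx w hw x' hx' w' hw'
    have h2 := h'.lip_x x hx w hw x' hx' w' hw'
    calc _ = ‖σ • (φx x' w' - φx x w) + (ψx x' w' - ψx x w)‖ := by congr 1; module
      _ ≤ σ * ‖φx x' w' - φx x w‖ + ‖ψx x' w' - ψx x w‖ := by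
        refine (norm_add_le _ _).trans (le_of_eq ?_)
        rw [norm_smul, Real.norm_of_nonneg hσ]
      _ ≤ σ * (Λ * (‖x' - x‖ + ‖w' - w‖)) + M * (‖x' - x‖ + ‖w' - w‖) := by gcongr
      _ = _ := by ring
  lip_y x hx w hw x' hx' w' hw' := by
    have h1 := h.lip_y x hx w hw x' hx' w' hw'
    have h2 := h'.lip_y x hx w hw x' hx' w' hw'
    calc _ = ‖σ • (φy x' w' - φy x w) + (ψy x' w' - ψy x w)‖ := by congr 1; module
      _ ≤ σ * ‖φy x' w' - φy x w‖ + ‖ψy x' w' - ψy x w‖ := by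
        refine (norm_add_le _ _).trans (le_of_eq ?_)
        rw [norm_smul, Real.norm_of_nonneg hσ]
      _ ≤ σ * (Λ * (‖x' - x‖ + ‖w' - w‖)) + M * (‖x' - x‖ + ‖w' - w‖) := by gcongr
      _ = _ := by ring

/-- With f = 0 the estimates for σ f + g become estimates for the lower-level iteration. -/
theorem zero : SmoothPair X Y (fun _ _ => 0) (fun _ _ => 0) (fun _ _ => 0) 0 where
  taylor := by simp
  lip_x := by simp
  lip_y := by simp

theorem taylor_snd (h : SmoothPair X Y φ φx φy Λ) {x : Vec dx} (hx : x ∈ X) {w w' : Vec dy}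
    (hw : w ∈ Y) (hw' : w' ∈ Y) :
    |φ x w' - φ x w - inner ℝ (φy x w) (w' - w)| ≤ Λ * ‖w' - w‖ ^ 2 := by
  simpa using h.taylor x hx w hw x hx w' hw'

theorem taylor_fst (h : SmoothPair X Y φ φx φy Λ) {x x' : Vec dx} (hx : x ∈ X) (hx' : x' ∈ X)
    {w : Vec dy} (hw : w ∈ Y) :
    |φ x' w - φ x w - inner ℝ (φx x w) (x' - x)| ≤ Λ * ‖x' - x‖ ^ 2 := by
  simpa using h.taylor x hx w hw x' hx' w hw

theorem lip_y_snd (h : SmoothPair X Y φ φx φy Λ) {x : Vec dx} (hx : x ∈ X) {w w' : Vec dy}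
    (hw : w ∈ Y) (hw' : w' ∈ Y) : ‖φy x w' - φy x w‖ ≤ Λ * ‖w' - w‖ := by
  simpa using h.lip_y x hx w hw x hx w' hw'

theorem lip_x_snd (h : SmoothPair X Y φ φx φy Λ) {x : Vec dx} (hx : x ∈ X) {w w' : Vec dy}
    (hw : w ∈ Y) (hw' : w' ∈ Y) : ‖φx x w' - φx x w‖ ≤ Λ * ‖w' - w‖ := by
  simpa using h.lip_x x hx w hw x hx w' hw'

end SmoothPair

/-! ### Norm, inner product and product sets in the joint space. -/

section Joint

variable {dx dy : ℕ}

theorem pt_fst (x : Vec dx) (y : Vec dy) : (pt x y).fst = x := rfl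

theorem pt_snd (x : Vec dx) (y : Vec dy) : (pt x y).snd = y := rfl

theorem joint_norm_sq (p : Joint dx dy) : ‖p‖ ^ 2 = ‖p.fst‖ ^ 2 + ‖p.snd‖ ^ 2 :=
  WithLp.prod_norm_sq_eq_of_L2 p

theorem norm_fst_le_joint (p : Joint dx dy) : ‖p.fst‖ ≤ ‖p‖ := by
  refine abs_le_of_sq_le_sq' ?_ (norm_nonneg _) |>.2
  rw [joint_norm_sq]; nlinarith [sq_nonneg ‖p.snd‖]

theorem norm_snd_le_joint (p : Joint dx dy) : ‖p.snd‖ ≤ ‖p‖ := by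
  refine abs_le_of_sq_le_sq' ?_ (norm_nonneg _) |>.2
  rw [joint_norm_sq]; nlinarith [sq_nonneg ‖p.fst‖]

theorem norm_joint_le (p : Joint dx dy) : ‖p‖ ≤ ‖p.fst‖ + ‖p.snd‖ := by
  refine abs_le_of_sq_le_sq' ?_ (by positivity) |>.2
  rw [joint_norm_sq]; nlinarith [norm_nonneg p.fst, norm_nonneg p.snd]

theorem joint_inner (p q : Joint dx dy) :
    inner ℝ p q = inner ℝ p.fst q.fst + inner ℝ p.snd q.snd := by
  rw [WithLp.prod_inner_apply]; rfl

theorem pt_sub (x x' : Vec dx) (y y' : Vec dy) : pt x' y' - pt x y = pt (x' - x) (y' - y) := rfl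

/-- The product set `X × Y` in the joint space. -/
def jointSet (X : Set (Vec dx)) (Y : Set (Vec dy)) : Set (Joint dx dy) :=
  {p | p.fst ∈ X ∧ p.snd ∈ Y}

theorem pt_mem_jointSet {X : Set (Vec dx)} {Y : Set (Vec dy)} {x : Vec dx} {y : Vec dy}
    (hx : x ∈ X) (hy : y ∈ Y) : pt x y ∈ jointSet X Y := ⟨hx, hy⟩

theorem convex_jointSet {X : Set (Vec dx)} {Y : Set (Vec dy)} (hX : Convex ℝ X)
    (hY : Convex ℝ Y) : Convex ℝ (jointSet X Y) := fun _ hp _ hq _ _ ha hb hab =>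
  ⟨hX hp.1 hq.1 ha hb hab, hY hp.2 hq.2 ha hb hab⟩

theorem isClosed_jointSet {X : Set (Vec dx)} {Y : Set (Vec dy)} (hX : IsClosed X)
    (hY : IsClosed Y) : IsClosed (jointSet X Y) :=
  (hX.preimage (WithLp.continuous_fst 2 _ _)).inter (hY.preimage (WithLp.continuous_snd 2 _ _))

end Joint

namespace Bilevel

variable {dx dy : ℕ} {Z Ξ : Type*} [MeasurableSpace Z] [MeasurableSpace Ξ]
  {B : Bilevel dx dy Z Ξ} {φ : Joint dx dy → ℝ} {l : ℝ}

theorem SmoothOn.contDiffAt (h : B.SmoothOn φ l) {p : Joint dx dy} (hp : p ∈ jointSet B.X B.Y) :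
    ContDiffAt ℝ 2 φ p := (h p.fst hp.1 p.snd hp.2).1

theorem SmoothOn.hasGradientAt (h : B.SmoothOn φ l) {p : Joint dx dy}
    (hp : p ∈ jointSet B.X B.Y) : HasGradientAt φ (gradient φ p) p :=
  ((h.contDiffAt hp).differentiableAt (by norm_num)).hasGradientAt

/-- Mean value inequality for the gradient on the convex set X × Y, where the Hessian is bounded at
every point. -/
theorem SmoothOn.norm_gradient_sub_le (h : B.SmoothOn φ l) (hX : Convex ℝ B.X)
    (hY : Convex ℝ B.Y) {p q : Joint dx dy} (hp : p ∈ jointSet B.X B.Y)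
    (hq : q ∈ jointSet B.X B.Y) : ‖gradient φ q - gradient φ p‖ ≤ l * ‖q - p‖ := by
  refine Convex.norm_image_sub_le_of_norm_fderiv_le (𝕜 := ℝ) (s := jointSet B.X B.Y)
    (fun r hr => ?_) (fun r hr => (h r.fst hr.1 r.snd hr.2).2) (convex_jointSet hX hY) hp hq
  have h1 : ContDiffAt ℝ 1 (fderiv ℝ φ) r :=
    (h.contDiffAt hr).fderiv_right (m := 1) (by norm_num)
  have h2 : DifferentiableAt ℝ (fderiv ℝ φ) r := h1.differentiableAt (by norm_num)
  exact (InnerProductSpace.toDual ℝ (Joint dx dy)).symm.toContinuousLinearEquiv.differentiableAt.comp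
    r h2

/-- Mean value inequality on the segment for φ minus its linear part at p, whose derivative is at
most l‖q - p‖ there. The constant l in place of l/2 only affects numerical constants later. -/
theorem SmoothOn.taylor (h : B.SmoothOn φ l) (hl : 0 ≤ l) (hX : Convex ℝ B.X)
    (hY : Convex ℝ B.Y) {p q : Joint dx dy} (hp : p ∈ jointSet B.X B.Y)
    (hq : q ∈ jointSet B.X B.Y) :
    |φ q - φ p - inner ℝ (gradient φ p) (q - p)| ≤ l * ‖q - p‖ ^ 2 := by
  have hseg : segment ℝ p q ⊆ jointSet B.X B.Y := (convex_jointSet hX hY).segment_subset hp hq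
  have hd : ∀ r ∈ segment ℝ p q, HasFDerivWithinAt (fun r => φ r - inner ℝ (gradient φ p) r)
      (InnerProductSpace.toDual ℝ _ (gradient φ r - gradient φ p)) (segment ℝ p q) r := by
    intro r hr
    have h1 := (h.hasGradientAt (hseg hr)).hasFDerivAt
    have h2 : HasFDerivAt (fun r => inner ℝ (gradient φ p) r)
        (InnerProductSpace.toDual ℝ _ (gradient φ p)) r :=
      (InnerProductSpace.toDual ℝ _ (gradient φ p)).hasFDerivAt
    rw [map_sub]
    exact (h1.sub h2).hasFDerivWithinAt
  have hb : ∀ r ∈ segment ℝ p q,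
      ‖InnerProductSpace.toDual ℝ _ (gradient φ r - gradient φ p)‖ ≤ l * ‖q - p‖ := by
    intro r hr
    rw [LinearIsometryEquiv.norm_map]
    refine (h.norm_gradient_sub_le hX hY hp (hseg hr)).trans ?_
    gcongr
    have := norm_sub_le_of_mem_segment hr
    simpa [norm_sub_rev] using this
  have := Convex.norm_image_sub_le_of_norm_hasFDerivWithin_le hd hb (convex_segment p q)
    (left_mem_segment ℝ p q) (right_mem_segment ℝ p q)
  rw [Real.norm_eq_abs] at this
  calc _ = |φ q - inner ℝ (gradient φ p) q - (φ p - inner ℝ (gradient φ p) p)| := by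
        rw [inner_sub_right]; congr 1; ring
    _ ≤ _ := this.trans (le_of_eq (by ring))

theorem SmoothOn.smoothPair (h : B.SmoothOn φ l) (hl : 0 ≤ l) (hX : Convex ℝ B.X)
    (hY : Convex ℝ B.Y) : SmoothPair B.X B.Y (fun x w => φ (pt x w))
      (fun x w => (gradient φ (pt x w)).fst) (fun x w => (gradient φ (pt x w)).snd) l where
  taylor x hx w hw x' hx' w' hw' := by
    have := h.taylor hl hX hY (pt_mem_jointSet hx hw) (pt_mem_jointSet hx' hw')
    rw [joint_norm_sq, joint_inner, pt_sub, pt_fst, pt_snd] at this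
    rwa [sub_sub (φ (pt x' w') - φ (pt x w))]
  lip_x x hx w hw x' hx' w' hw' := by
    have := h.norm_gradient_sub_le hX hY (pt_mem_jointSet hx hw) (pt_mem_jointSet hx' hw')
    refine (norm_fst_le_joint (gradient φ (pt x' w') - gradient φ (pt x w))).trans
      (this.trans ?_)
    gcongr
    exact norm_joint_le (pt x' w' - pt x w)
  lip_y x hx w hw x' hx' w' hw' := by
    have := h.norm_gradient_sub_le hX hY (pt_mem_jointSet hx hw) (pt_mem_jointSet hx' hw')
    refine (norm_snd_le_joint (gradient φ (pt x' w') - gradient φ (pt x w))).trans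
      (this.trans ?_)
    gcongr
    exact norm_joint_le (pt x' w' - pt x w)

end Bilevel

/-! ### Proximal points and Moreau envelopes -/

/-- The objective `φ(w) + ‖w - y‖² / (2ρ)` of the proximal subproblem. -/
noncomputable def proxObj {d : ℕ} (φ : Vec d → ℝ) (ρ : ℝ) (y w : Vec d) : ℝ :=
  φ w + 1 / (2 * ρ) * ‖w - y‖ ^ 2

section Prox

variable {d : ℕ} {S : Set (Vec d)} {ρ : ℝ} {φ : Vec d → ℝ} {y w : Vec d}

theorem IsProx.obj_le (h : IsProx S ρ φ y w) (hρ : 0 < ρ) {z : Vec d} (hz : z ∈ S) :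
    proxObj φ ρ y w ≤ proxObj φ ρ y z := by
  have h1 := h.2 z hz
  have e : ∀ u, proxObj φ ρ y u = ρ⁻¹ * (ρ * φ u + 1 / 2 * ‖u - y‖ ^ 2) := by
    intro u; unfold proxObj; field_simp
  rw [e, e]; gcongr

theorem IsProx.sInf_eq (h : IsProx S ρ φ y w) (hρ : 0 < ρ) :
    sInf ((fun w => proxObj φ ρ y w) '' S) = proxObj φ ρ y w := by
  refine IsLeast.csInf_eq ⟨⟨w, h.1, rfl⟩, ?_⟩
  rintro _ ⟨z, hz, rfl⟩
  exact h.obj_le hρ hz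

theorem exists_isProx (hS : IsCompact S) (hne : S.Nonempty) (hφ : ContinuousOn φ S) (ρ : ℝ)
    (y : Vec d) : ∃ w, IsProx S ρ φ y w := by
  obtain ⟨w, hw, hmin⟩ := hS.exists_isMinOn hne
    (f := fun z => ρ * φ z + 1 / 2 * ‖z - y‖ ^ 2) (by fun_prop)
  exact ⟨w, hw, fun z hz => hmin hz⟩

theorem isProx_prox (h : ∃ w, IsProx S ρ φ y w) : IsProx S ρ φ y (prox S ρ φ y) :=
  Classical.epsilon_spec h

end Prox

/-- The limit t → 0, used to pass from minimality along a segment to a first-order condition. -/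
theorem nonneg_of_forall_add_mul {a b : ℝ} (h : ∀ t, 0 < t → t ≤ 1 → 0 ≤ a + t * b) : 0 ≤ a := by
  by_contra! ha
  have hb : 0 < |b| + 1 := by positivity
  obtain ⟨t, ht0, ht1, ht2⟩ : ∃ t, 0 < t ∧ t ≤ 1 ∧ t * (|b| + 1) ≤ -a / 2 := by
    refine ⟨min 1 (-a / 2 / (|b| + 1)), lt_min one_pos (by apply div_pos <;> linarith),
      min_le_left _ _, ?_⟩
    calc _ ≤ -a / 2 / (|b| + 1) * (|b| + 1) := by gcongr; exact min_le_right _ _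
      _ = _ := by field_simp
  have := h t ht0 ht1
  nlinarith [le_abs_self b]

/-- Solutions of two proximal variational inequalities differ by at most the perturbation of the
data. -/
theorem norm_sub_le_of_prox_vi {d : ℕ} {ρ : ℝ} (hρ : 0 < ρ) {w₁ w₂ y₁ y₂ v₁ v₂ : Vec d}
    (h₁ : 0 ≤ inner ℝ (v₁ + ρ⁻¹ • (w₁ - y₁)) (w₂ - w₁))
    (h₂ : 0 ≤ inner ℝ (v₂ + ρ⁻¹ • (w₂ - y₂)) (w₁ - w₂)) :
    ‖w₂ - w₁‖ ≤ ‖y₂ - y₁‖ + ρ * ‖v₂ - v₁‖ := by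
  -- Adding the two inequalities leaves -ρ⁻¹‖w₂ - w₁‖² from the quadratic terms. No monotonicity of
  -- v is needed: its change counts as a perturbation.
  have e : inner ℝ (v₁ + ρ⁻¹ • (w₁ - y₁)) (w₂ - w₁) + inner ℝ (v₂ + ρ⁻¹ • (w₂ - y₂)) (w₁ - w₂)
      = ρ⁻¹ * inner ℝ (y₂ - y₁) (w₂ - w₁) - inner ℝ (v₂ - v₁) (w₂ - w₁)
        - ρ⁻¹ * ‖w₂ - w₁‖ ^ 2 := by
    rw [← real_inner_self_eq_norm_sq, ← neg_sub w₂ w₁, inner_neg_right, ← real_inner_smul_left,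
      ← real_inner_smul_left, ← inner_neg_left, ← inner_add_left, ← inner_sub_left,
      ← inner_sub_left]
    congr 1
    module
  have h3 := real_inner_le_norm (y₂ - y₁) (w₂ - w₁)
  have h4 := abs_le.1 (abs_real_inner_le_norm (v₂ - v₁) (w₂ - w₁))
  have h5 : ‖w₂ - w₁‖ * ‖w₂ - w₁‖ ≤ (‖y₂ - y₁‖ + ρ * ‖v₂ - v₁‖) * ‖w₂ - w₁‖ := by
    have h6 : 0 ≤ ρ⁻¹ * inner ℝ (y₂ - y₁) (w₂ - w₁) - inner ℝ (v₂ - v₁) (w₂ - w₁)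
        - ρ⁻¹ * ‖w₂ - w₁‖ ^ 2 := by rw [← e]; positivity
    have h7 := mul_nonneg hρ.le h6
    have h8 : ρ * (ρ⁻¹ * inner ℝ (y₂ - y₁) (w₂ - w₁) - inner ℝ (v₂ - v₁) (w₂ - w₁)
        - ρ⁻¹ * ‖w₂ - w₁‖ ^ 2) = inner ℝ (y₂ - y₁) (w₂ - w₁)
          - ρ * inner ℝ (v₂ - v₁) (w₂ - w₁) - ‖w₂ - w₁‖ ^ 2 := by field_simp
    rw [h8] at h7
    nlinarith [mul_le_mul_of_nonneg_left h4.1 hρ.le]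
  rcases (norm_nonneg (w₂ - w₁)).eq_or_lt with h0 | h0
  · rw [← h0]; positivity
  · exact le_of_mul_le_mul_right h5 h0

namespace SmoothPair

variable {dx dy : ℕ} {X : Set (Vec dx)} {Y : Set (Vec dy)} {φ : Vec dx → Vec dy → ℝ}
  {φx : Vec dx → Vec dy → Vec dx} {φy : Vec dx → Vec dy → Vec dy} {Λ ρ γ : ℝ}

/-- No convexity of φ is needed: compare ws with ws + t(z - ws), expand to first order by the Taylor
bound, divide by t and let t tend to 0. -/
theorem prox_vi (h : SmoothPair X Y φ φx φy Λ) (hY : Convex ℝ Y) (hρ : 0 < ρ) {x : Vec dx}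
    (hx : x ∈ X) {y ws : Vec dy} (hws : IsProx Y ρ (φ x) y ws) {z : Vec dy} (hz : z ∈ Y) :
    0 ≤ inner ℝ (φy x ws + ρ⁻¹ • (ws - y)) (z - ws) := by
  have key : 0 ≤ ρ * inner ℝ (φy x ws) (z - ws) + inner ℝ (ws - y) (z - ws) := by
    refine nonneg_of_forall_add_mul (b := (ρ * Λ + 1 / 2) * ‖z - ws‖ ^ 2) fun t ht ht1 => ?_
    have hmem : ws + t • (z - ws) ∈ Y := by
      have := hY.add_smul_sub_mem hws.1 hz ⟨ht.le, ht1⟩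
      exact this
    have h1 := hws.2 _ hmem
    have h2 := (abs_le.1 (h.taylor_snd hx hws.1 hmem)).2
    have e1 : ws + t • (z - ws) - ws = t • (z - ws) := by abel
    have e2 : ws + t • (z - ws) - y = (ws - y) + t • (z - ws) := by abel
    rw [e1, inner_smul_right, norm_smul, Real.norm_of_nonneg ht.le] at h2
    rw [e2, norm_add_sq_real, inner_smul_right, norm_smul, Real.norm_of_nonneg ht.le] at h1
    have h3 := mul_le_mul_of_nonneg_left h2 hρ.le
    have h4 : 0 ≤ t * (ρ * inner ℝ (φy x ws) (z - ws) + inner ℝ (ws - y) (z - ws)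
        + t * ((ρ * Λ + 1 / 2) * ‖z - ws‖ ^ 2)) := by linarith
    exact nonneg_of_mul_nonneg_right h4 ht
  have : inner ℝ (φy x ws + ρ⁻¹ • (ws - y)) (z - ws)
      = ρ⁻¹ * (ρ * inner ℝ (φy x ws) (z - ws) + inner ℝ (ws - y) (z - ws)) := by
    rw [inner_add_left, real_inner_smul_left]; field_simp
  rw [this]; positivity

/-- The perturbation bound contains ρΛ‖ws' - ws‖ itself; as ρΛ ≤ 1/2 this is absorbed on the left,
at the price of a factor 2. -/
theorem prox_lipschitz (h : SmoothPair X Y φ φx φy Λ) (hY : Convex ℝ Y) (hρ : 0 < ρ)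
    (hΛ : ρ * Λ ≤ 1 / 2) {x x' : Vec dx} (hx : x ∈ X) (hx' : x' ∈ X)
    {y y' ws ws' : Vec dy} (hws : IsProx Y ρ (φ x) y ws) (hws' : IsProx Y ρ (φ x') y' ws') :
    ‖ws' - ws‖ ≤ 2 * ‖y' - y‖ + 2 * (ρ * Λ) * ‖x' - x‖ := by
  have h1 := norm_sub_le_of_prox_vi hρ (h.prox_vi hY hρ hx hws hws'.1)
    (h.prox_vi hY hρ hx' hws' hws.1)
  have h2 := mul_le_mul_of_nonneg_left (h.lip_y x hx ws hws.1 x' hx' ws' hws'.1) hρ.le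
  nlinarith [norm_nonneg (ws' - ws)]

theorem prox_obj_taylor (h : SmoothPair X Y φ φx φy Λ) {x : Vec dx} (hx : x ∈ X)
    {y w w' : Vec dy} (hw : w ∈ Y) (hw' : w' ∈ Y) :
    proxObj (φ x) ρ y w' ≤ proxObj (φ x) ρ y w
      + inner ℝ (φy x w + ρ⁻¹ • (w - y)) (w' - w) + (Λ + 1 / (2 * ρ)) * ‖w' - w‖ ^ 2 := by
  have h1 := (abs_le.1 (h.taylor_snd hx hw hw')).2
  have e : w' - y = (w - y) + (w' - w) := by abel
  unfold proxObj
  rw [e, norm_add_sq_real, inner_add_left, real_inner_smul_left]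
  have : 1 / (2 * ρ) = ρ⁻¹ / 2 := by rw [one_div, mul_inv]; ring
  rw [this]
  linarith

/-- Contraction of an inexact projected gradient step on the proximal subproblem. -/
theorem prox_step_contract (h : SmoothPair X Y φ φx φy Λ) (hY : Convex ℝ Y) (hYc : IsClosed Y)
    (hρ : 0 < ρ) (hΛ : ρ * Λ ≤ 1 / 2) (hγ : 0 < γ) (hγρ : γ ≤ ρ) {x : Vec dx} (hx : x ∈ X)
    {y w ws : Vec dy} (hw : w ∈ Y) (hws : IsProx Y ρ (φ x) y ws) (v : Vec dy) :
    ‖proj Y (w - γ • (v + ρ⁻¹ • (w - y))) - ws‖ ^ 2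
      ≤ (1 - γ / (2 * ρ)) * ‖w - ws‖ ^ 2 + 2 * ρ * γ * ‖v - φy x w‖ ^ 2 := by
  -- The proximal point is a fixed point of the exact projected gradient step, so it can be compared
  -- with the inexact step from w.
  have h1 := norm_proj_sub_le_of_vi hY hYc (a := ws - γ • (φy x ws + ρ⁻¹ • (ws - y))) hws.1
    (fun z hz => by
      have := h.prox_vi hY hρ hx hws hz
      have e : ws - γ • (φy x ws + ρ⁻¹ • (ws - y)) - ws
        = -(γ • (φy x ws + ρ⁻¹ • (ws - y))) := by abel
      rw [e, inner_neg_left, real_inner_smul_left]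
      nlinarith) (w - γ • (v + ρ⁻¹ • (w - y)))
  set t := γ / ρ with ht
  have ht0 : 0 < t := by positivity
  have ht1 : t ≤ 1 := by rw [ht, div_le_one hρ]; exact hγρ
  -- The quadratic term contributes the factor 1 - t; the gradient of φ gives back at most γΛ ≤ t/2.
  have h2 : w - γ • (v + ρ⁻¹ • (w - y)) - (ws - γ • (φy x ws + ρ⁻¹ • (ws - y)))
      = (1 - t) • (w - ws) - γ • (φy x w - φy x ws) - γ • (v - φy x w) := by
    rw [ht, div_eq_mul_inv]; module
  rw [h2] at h1
  have h3 : ‖(1 - t) • (w - ws) - γ • (φy x w - φy x ws) - γ • (v - φy x w)‖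
      ≤ (1 - t / 2) * ‖w - ws‖ + γ * ‖v - φy x w‖ := by
    have h4 := h.lip_y_snd hx hws.1 hw
    calc _ ≤ ‖(1 - t) • (w - ws)‖ + ‖γ • (φy x w - φy x ws)‖ + ‖γ • (v - φy x w)‖ :=
          (norm_sub_le _ _).trans (add_le_add_left (norm_sub_le _ _) _)
      _ = (1 - t) * ‖w - ws‖ + γ * ‖φy x w - φy x ws‖ + γ * ‖v - φy x w‖ := by
          rw [norm_smul, norm_smul, norm_smul, Real.norm_of_nonneg hγ.le,
            Real.norm_of_nonneg (by linarith)]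
      _ ≤ (1 - t) * ‖w - ws‖ + γ * (Λ * ‖w - ws‖) + γ * ‖v - φy x w‖ := by gcongr
      _ ≤ _ := by
          have : γ * Λ ≤ t / 2 := by
            rw [ht, div_div, le_div_iff₀ (by positivity)]; nlinarith
          nlinarith [norm_nonneg (w - ws)]
  have e : γ / (2 * ρ) = t / 2 := by rw [ht]; field_simp
  have e2 : 2 * ρ * γ * ‖v - φy x w‖ ^ 2 = (γ * ‖v - φy x w‖) ^ 2 / (t / 2) := by
    rw [ht]; field_simp
  rw [e, e2]
  set b := γ * ‖v - φy x w‖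
  set a := ‖w - ws‖
  have h5 : ‖proj Y (w - γ • (v + ρ⁻¹ • (w - y))) - ws‖ ^ 2 ≤ ((1 - t / 2) * a + b) ^ 2 :=
    pow_le_pow_left₀ (norm_nonneg _) (h1.trans h3) 2
  refine h5.trans ?_
  -- A completed square: Young's inequality with the weight for which the contraction factor stays 1
  -- - t/2.
  have h6 : (1 - t / 2) * a ^ 2 + b ^ 2 / (t / 2) - ((1 - t / 2) * a + b) ^ 2
      = (1 - t / 2) * (t / 2) * (a - b / (t / 2)) ^ 2 := by field_simp; ring
  have : 0 ≤ (1 - t / 2) * (t / 2) * (a - b / (t / 2)) ^ 2 := by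
    have : 0 ≤ 1 - t / 2 := by linarith
    positivity
  linarith

/-- Decrease of the proximal objective along an inexact projected gradient step. -/
theorem prox_step_descent (h : SmoothPair X Y φ φx φy Λ) (hY : Convex ℝ Y) (hYc : IsClosed Y)
    (hρ : 0 < ρ) (hΛ : ρ * Λ ≤ 1 / 2) (hγ : 0 < γ) (hγρ : γ ≤ ρ / 16) {x : Vec dx} (hx : x ∈ X)
    {y w : Vec dy} (hw : w ∈ Y) (v : Vec dy) {wp : Vec dy}
    (hwp : wp = proj Y (w - γ • (v + ρ⁻¹ • (w - y)))) :
    proxObj (φ x) ρ y wp ≤ proxObj (φ x) ρ y w - ‖wp - w‖ ^ 2 / (2 * γ)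
      + γ * ‖v - φy x w‖ ^ 2 := by
  have hm : wp ∈ Y := hwp ▸ proj_mem hY hYc ⟨w, hw⟩ _
  have h1 := h.prox_obj_taylor (ρ := ρ) (y := y) hx hw hm
  have h2 := inner_proj_step_le hY hYc hw hγ (v + ρ⁻¹ • (w - y))
  rw [← hwp] at h2
  have e : φy x w + ρ⁻¹ • (w - y) = (v + ρ⁻¹ • (w - y)) - (v - φy x w) := by abel
  rw [e, inner_sub_left] at h1
  have h3 := (abs_le.1 (abs_real_inner_le_norm (v - φy x w) (wp - w))).1
  set W := ‖wp - w‖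
  set e := ‖v - φy x w‖
  have h4 : e * W ≤ γ * e ^ 2 + W ^ 2 / (4 * γ) := by
    have : γ * e ^ 2 + W ^ 2 / (4 * γ) - e * W = γ * (e - W / (2 * γ)) ^ 2 := by
      field_simp; ring
    have : 0 ≤ γ * (e - W / (2 * γ)) ^ 2 := by positivity
    linarith
  -- Of the gain W²/γ from the projection, Young's inequality for the error uses a quarter and the
  -- second-order terms another quarter; the latter needs γ ≤ ρ/16.
  have h5 : (Λ + 1 / (2 * ρ)) ≤ 1 / (4 * γ) := by
    have : Λ ≤ 1 / (2 * ρ) := by rw [le_div_iff₀ (by positivity)]; linarith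
    have h6 : 1 / (2 * ρ) + 1 / (2 * ρ) ≤ 1 / (4 * γ) := by
      rw [show 1 / (2 * ρ) + 1 / (2 * ρ) = 1 / ρ by field_simp; norm_num]
      exact one_div_le_one_div_of_le (by positivity) (by linarith)
    linarith
  have h6 := mul_le_mul_of_nonneg_right h5 (sq_nonneg W)
  have h7 : W ^ 2 / γ = 1 / γ * W ^ 2 := by ring
  have h8 : W ^ 2 / (4 * γ) = 1 / γ * W ^ 2 / 4 := by field_simp
  have h9 : W ^ 2 / (2 * γ) = 1 / γ * W ^ 2 / 2 := by field_simp
  have h10 : 1 / (4 * γ) * W ^ 2 = 1 / γ * W ^ 2 / 4 := by field_simp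
  rw [h7] at h2; rw [h8] at h4; rw [h9]; rw [h10] at h6
  linarith

/-- Change of the optimality gap of the proximal subproblem when its data move. -/
theorem prox_gap_move (h : SmoothPair X Y φ φx φy Λ) (hρ : 0 < ρ) {x x' : Vec dx}
    (hx : x ∈ X) (hx' : x' ∈ X) {y y' ws ws' : Vec dy} (hws : IsProx Y ρ (φ x) y ws)
    (hws' : IsProx Y ρ (φ x') y' ws') {w : Vec dy} (hw : w ∈ Y) :
    proxObj (φ x') ρ y' w - proxObj (φ x') ρ y' ws'
      ≤ proxObj (φ x) ρ y w - proxObj (φ x) ρ y ws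
        + Λ * ‖w - ws'‖ * ‖x' - x‖ + 2 * Λ * ‖x' - x‖ ^ 2 + ρ⁻¹ * (‖w - ws'‖ * ‖y' - y‖) := by
  -- The old minimum is compared with the new proximal point, so that both differences in x are
  -- taken over the pair w, ws' and nearly cancel.
  have h1 := hws.obj_le hρ hws'.1
  have h2 := (abs_le.1 (h.taylor_fst hx hx' hw)).2
  have h3 := (abs_le.1 (h.taylor_fst hx hx' hws'.1)).1
  have h4 : inner ℝ (φx x w) (x' - x) - inner ℝ (φx x ws') (x' - x)
      ≤ Λ * ‖w - ws'‖ * ‖x' - x‖ := by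
    rw [← inner_sub_left]
    refine (real_inner_le_norm _ _).trans ?_
    gcongr
    exact h.lip_x_snd hx hws'.1 hw
  -- The squares cancel and a bilinear expression in ws' - w and y' - y remains.
  have h5 : ‖w - y'‖ ^ 2 - ‖w - y‖ ^ 2 - ‖ws' - y'‖ ^ 2 + ‖ws' - y‖ ^ 2
      ≤ 2 * (‖w - ws'‖ * ‖y' - y‖) := by
    have e : ‖w - y'‖ ^ 2 - ‖w - y‖ ^ 2 - ‖ws' - y'‖ ^ 2 + ‖ws' - y‖ ^ 2
        = 2 * inner ℝ (ws' - w) (y' - y) := by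
      simp only [← real_inner_self_eq_norm_sq, inner_sub_left, inner_sub_right]
      rw [real_inner_comm y' w, real_inner_comm y w, real_inner_comm y' ws',
        real_inner_comm y ws']
      ring
    rw [e, norm_sub_rev w]
    gcongr
    exact real_inner_le_norm _ _
  have e : 1 / (2 * ρ) = ρ⁻¹ / 2 := by rw [one_div, mul_inv]; ring
  have h6 := mul_le_mul_of_nonneg_left h5 (inv_pos.2 hρ).le
  unfold proxObj at *
  rw [e] at h1 ⊢
  linarith

end SmoothPair

/-! ### One step of the inner iteration -/

section Drift

variable {dx dy : ℕ} {X : Set (Vec dx)} {Y : Set (Vec dy)} {f g : Vec dx → Vec dy → ℝ}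
  {fx gx : Vec dx → Vec dy → Vec dx} {fy gy : Vec dx → Vec dy → Vec dy} {lf L ρ σ σ' Cf M : ℝ}

/-- Distance between the proximal points of `σ f + g` and of `g`. -/
theorem norm_sq_prox_sub_prox_base_le (hf : SmoothPair X Y f fx fy lf)
    (hg : SmoothPair X Y g gx gy L) (hY : Convex ℝ Y) (hρ : 0 < ρ) (hL : ρ * L ≤ 1 / 8)
    (hσ : 0 < σ) (hσl : σ * lf ≤ L) {x : Vec dx} (hx : x ∈ X)
    (hCf : ∀ w ∈ Y, |f x w| ≤ Cf) {y w w₀ : Vec dy}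
    (hw : IsProx Y ρ (fun w => σ * f x w + g x w) y w) (hw₀ : IsProx Y ρ (g x) y w₀) :
    ‖w₀ - w‖ ^ 2 ≤ 4 * (ρ * (σ * Cf)) := by
  have h1 := (hf.smul_add hg hσ.le).prox_vi hY hρ hx hw hw₀.1
  have h2 := hg.prox_vi hY hρ hx hw₀ hw.1
  have h3 := (abs_le.1 (hf.taylor_snd hx hw.1 hw₀.1)).1
  have h4 := abs_le.1 (hCf w hw.1)
  have h5 := abs_le.1 (hCf w₀ hw₀.1)
  have h6 : inner ℝ (gy x w - gy x w₀) (w₀ - w) ≤ L * ‖w₀ - w‖ ^ 2 := by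
    rw [sq, ← mul_assoc]
    refine (real_inner_le_norm _ _).trans ?_
    gcongr
    rw [norm_sub_rev w₀]
    exact hg.lip_y_snd hx hw₀.1 hw.1
  have e : inner ℝ ((fun x w => σ • fy x w + gy x w) x w + ρ⁻¹ • (w - y)) (w₀ - w)
      + inner ℝ (gy x w₀ + ρ⁻¹ • (w₀ - y)) (w - w₀)
      = σ * inner ℝ (fy x w) (w₀ - w) + inner ℝ (gy x w - gy x w₀) (w₀ - w)
        - ρ⁻¹ * ‖w₀ - w‖ ^ 2 := by
    rw [← real_inner_self_eq_norm_sq, ← neg_sub w₀ w, inner_neg_right, ← real_inner_smul_left,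
      ← real_inner_smul_left, ← inner_neg_left, ← inner_add_left, ← inner_add_left,
      ← inner_sub_left]
    congr 1
    module
  set D := ‖w₀ - w‖ ^ 2
  have h7 : 0 ≤ σ * inner ℝ (fy x w) (w₀ - w) + inner ℝ (gy x w - gy x w₀) (w₀ - w)
      - ρ⁻¹ * D := by rw [← e]; exact add_nonneg h1 h2
  -- The slope of f is bounded through its oscillation, so that the estimate involves Cf and no
  -- bound on the gradient of f.
  have h8 : inner ℝ (fy x w) (w₀ - w) ≤ 2 * Cf + lf * D := by linarith [h4.1, h4.2, h5.1, h5.2]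
  have h9 := mul_le_mul_of_nonneg_left h8 hσ.le
  have hD : 0 ≤ D := sq_nonneg _
  have h10 : 0 ≤ σ * (2 * Cf) + 2 * (L * D) - ρ⁻¹ * D := by
    have : σ * lf * D ≤ L * D := by gcongr
    linarith only [this, h9, h7, h6]
  have h11 := mul_nonneg hρ.le h10
  have h12 : ρ * (σ * (2 * Cf) + 2 * (L * D) - ρ⁻¹ * D)
      = 2 * (ρ * (σ * Cf)) + 2 * (ρ * L) * D - D := by field_simp
  rw [h12] at h11
  have h13 := mul_le_mul_of_nonneg_right hL hD
  linarith only [h11, h13, hD]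

/-- Drift of the proximal point of `σ f + g` when the penalty weight changes from `σ` to `σ'`. -/
theorem norm_sq_prox_drift_le (hf : SmoothPair X Y f fx fy lf)
    (hg : SmoothPair X Y g gx gy L) (hY : Convex ℝ Y) (hρ : 0 < ρ) (hL : ρ * L ≤ 1 / 8)
    (hlf : 0 ≤ lf) (hσ' : 0 < σ') (hσσ' : σ' ≤ σ) (hσl : σ * lf ≤ L) {x : Vec dx} (hx : x ∈ X)
    (hCf : ∀ w ∈ Y, |f x w| ≤ Cf) {y w w' w₀ : Vec dy}
    (hw : IsProx Y ρ (fun w => σ * f x w + g x w) y w)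
    (hw' : IsProx Y ρ (fun w => σ' * f x w + g x w) y w') (hw₀ : IsProx Y ρ (g x) y w₀)
    (hM : ‖gy x w₀ + ρ⁻¹ • (w₀ - y)‖ ≤ M) :
    ‖w' - w‖ ^ 2 ≤ 4 * ρ ^ 2 * ((σ - σ') / σ) ^ 2 * (2 * M ^ 2 + 32 * (σ * Cf) / ρ) := by
  have hσ : 0 < σ := hσ'.trans_le hσσ'
  have hM0 : 0 ≤ M := (norm_nonneg _).trans hM
  have hL0 : 0 ≤ L := le_trans (by positivity) hσl
  have hd0 := norm_sq_prox_sub_prox_base_le hf hg hY hρ hL hσ hσl hx hCf hw hw₀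
  -- The subproblem gradient of g alone, at the proximal point of σ f + g. It is close to its value
  -- at w₀, which is bounded by M.
  set G := gy x w + ρ⁻¹ • (w - y) with hG
  have hGn : ‖G‖ ≤ M + 2 / ρ * ‖w₀ - w‖ := by
    have e : G = (gy x w₀ + ρ⁻¹ • (w₀ - y)) + ((gy x w - gy x w₀) + ρ⁻¹ • (w - w₀)) := by
      rw [hG]; module
    have h1 := hg.lip_y_snd hx hw₀.1 hw.1
    have h2 : ‖ρ⁻¹ • (w - w₀)‖ = ρ⁻¹ * ‖w - w₀‖ := by
      rw [norm_smul, Real.norm_of_nonneg (inv_pos.2 hρ).le]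
    have h3 : L ≤ ρ⁻¹ := by
      rw [← one_div, le_div_iff₀ hρ]; linarith
    rw [e]
    refine (norm_add_le _ _).trans (add_le_add hM ((norm_add_le _ _).trans ?_))
    rw [h2, norm_sub_rev w₀]
    have := mul_le_mul_of_nonneg_right h3 (norm_nonneg (w - w₀))
    have e3 : 2 / ρ * ‖w - w₀‖ = 2 * (ρ⁻¹ * ‖w - w₀‖) := by rw [div_eq_mul_inv]; ring
    rw [e3]; linarith
  have hG2 : ‖G‖ ^ 2 ≤ 2 * M ^ 2 + 32 * (σ * Cf) / ρ := by
    have h1 : ‖G‖ ^ 2 ≤ (M + 2 / ρ * ‖w₀ - w‖) ^ 2 := pow_le_pow_left₀ (norm_nonneg _) hGn 2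
    have h2 : (2 / ρ * ‖w₀ - w‖) ^ 2 ≤ 16 * (σ * Cf) / ρ := by
      rw [mul_pow, div_pow]
      calc _ ≤ 2 ^ 2 / ρ ^ 2 * (4 * (ρ * (σ * Cf))) := by gcongr
        _ = _ := by field_simp; ring
    have e3 : 32 * (σ * Cf) / ρ = 2 * (16 * (σ * Cf) / ρ) := by ring
    rw [e3]
    linarith only [h1, h2, sq_nonneg (M - 2 / ρ * ‖w₀ - w‖)]
  have h1 := (hf.smul_add hg hσ.le).prox_vi hY hρ hx hw hw'.1
  have h2 := (hf.smul_add hg hσ'.le).prox_vi hY hρ hx hw' hw.1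
  set d := ‖w' - w‖ with hd
  -- The weights σ' and σ match the coefficients of the two f-gradients, leaving only their
  -- difference. What remains of the change of σ is (σ - σ') times G.
  have e : σ' * inner ℝ ((fun x w => σ • fy x w + gy x w) x w + ρ⁻¹ • (w - y)) (w' - w)
      + σ * inner ℝ ((fun x w => σ' • fy x w + gy x w) x w' + ρ⁻¹ • (w' - y)) (w - w')
      = σ * σ' * inner ℝ (fy x w - fy x w') (w' - w) + σ * inner ℝ (gy x w - gy x w') (w' - w)
        - σ * ρ⁻¹ * d ^ 2 - (σ - σ') * inner ℝ G (w' - w) := by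
    rw [hd, ← real_inner_self_eq_norm_sq, ← neg_sub w' w, inner_neg_right]
    simp only [← real_inner_smul_left, ← inner_neg_left, ← inner_add_left, ← inner_sub_left, smul_neg]
    congr 1
    rw [hG]
    module
  have h3 : inner ℝ (fy x w - fy x w') (w' - w) ≤ lf * d * d := by
    refine (real_inner_le_norm _ _).trans ?_
    have := hf.lip_y_snd hx hw'.1 hw.1
    rw [norm_sub_rev w w'] at this
    gcongr
  have h4 : inner ℝ (gy x w - gy x w') (w' - w) ≤ L * d * d := by
    refine (real_inner_le_norm _ _).trans ?_
    have := hg.lip_y_snd hx hw'.1 hw.1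
    rw [norm_sub_rev w w'] at this
    gcongr
  have h5 := (abs_le.1 (abs_real_inner_le_norm G (w' - w))).1
  have h6 : 0 ≤ σ * σ' * inner ℝ (fy x w - fy x w') (w' - w)
      + σ * inner ℝ (gy x w - gy x w') (w' - w) - σ * ρ⁻¹ * d ^ 2
      - (σ - σ') * inner ℝ G (w' - w) := by
    rw [← e]; exact add_nonneg (mul_nonneg hσ'.le h1) (mul_nonneg hσ.le h2)
  have hd0' : 0 ≤ d := norm_nonneg _
  have h7 : σ * σ' * inner ℝ (fy x w - fy x w') (w' - w) ≤ σ * (L * d * d) := by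
    calc _ ≤ σ * σ' * (lf * d * d) := by gcongr
      _ = σ * ((σ' * lf) * d * d) := by ring
      _ ≤ _ := by
        have : σ' * lf ≤ L := le_trans (by gcongr) hσl
        gcongr
  have h8 : σ * inner ℝ (gy x w - gy x w') (w' - w) ≤ σ * (L * d * d) := by gcongr
  have h9 : -((σ - σ') * inner ℝ G (w' - w)) ≤ (σ - σ') * (‖G‖ * d) := by
    have h10 : 0 ≤ σ - σ' := by linarith
    linarith only [mul_le_mul_of_nonneg_left h5 h10]
  have h10 : σ * ρ⁻¹ * d ^ 2 ≤ 2 * (σ * (L * d * d)) + (σ - σ') * (‖G‖ * d) := by linarith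
  have h11 : d * d ≤ (2 * ρ * ((σ - σ') / σ) * ‖G‖) * d := by
    have h12 := mul_le_mul_of_nonneg_left h10 (div_nonneg hρ.le hσ.le)
    have e1 : ρ / σ * (σ * ρ⁻¹ * d ^ 2) = d ^ 2 := by field_simp
    have e2 : ρ / σ * (2 * (σ * (L * d * d)) + (σ - σ') * (‖G‖ * d))
        = 2 * (ρ * L) * d ^ 2 + ρ * ((σ - σ') / σ) * ‖G‖ * d := by field_simp
    rw [e1, e2] at h12
    have h13 := mul_le_mul_of_nonneg_right hL (sq_nonneg d)
    linarith only [h12, h13, sq_nonneg d]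
  have h13 : d ≤ 2 * ρ * ((σ - σ') / σ) * ‖G‖ := by
    rcases hd0'.eq_or_lt with h0 | h0
    · rw [← h0]
      have : 0 ≤ (σ - σ') / σ := div_nonneg (by linarith) hσ.le
      positivity
    · exact le_of_mul_le_mul_right h11 h0
  calc d ^ 2 ≤ (2 * ρ * ((σ - σ') / σ) * ‖G‖) ^ 2 := pow_le_pow_left₀ hd0' h13 2
    _ = 4 * ρ ^ 2 * ((σ - σ') / σ) ^ 2 * ‖G‖ ^ 2 := by ring
    _ ≤ _ := by gcongr

/-- Change of the rescaled optimality gap when the penalty weight changes from `σ` to `σ'`. -/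
theorem prox_gap_rescale (hf : SmoothPair X Y f fx fy lf) (hg : SmoothPair X Y g gx gy L)
    (hρ : 0 < ρ) (hL : ρ * L ≤ 1 / 8) (hlf : 0 ≤ lf)
    (hσ' : 0 < σ') (hσσ' : σ' ≤ σ) (hσl : σ * lf ≤ L) {x : Vec dx} (hx : x ∈ X)
    (hCf : ∀ w ∈ Y, |f x w| ≤ Cf) {y w w' v : Vec dy}
    (hw : IsProx Y ρ (fun w => σ * f x w + g x w) y w)
    (hw' : IsProx Y ρ (fun w => σ' * f x w + g x w) y w') (hv : v ∈ Y)
    (hM : ‖σ' • fy x w' + gy x w' + ρ⁻¹ • (w' - y)‖ ≤ M) :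
    σ / σ' * (proxObj (fun w => σ' * f x w + g x w) ρ y v
        - proxObj (fun w => σ' * f x w + g x w) ρ y w')
      ≤ proxObj (fun w => σ * f x w + g x w) ρ y v - proxObj (fun w => σ * f x w + g x w) ρ y w
        + (σ - σ') / σ' * (M * ‖v - w'‖ + ‖v - w'‖ ^ 2 / ρ) + 2 * ((σ - σ') * Cf) := by
  have hσ : 0 < σ := hσ'.trans_le hσσ'
  have h1 := hw.obj_le hρ hw'.1
  have h2 := (hf.smul_add hg hσ'.le).prox_obj_taylor (ρ := ρ) (y := y) hx hw'.1 hv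
  have h3 := real_inner_le_norm (σ' • fy x w' + gy x w' + ρ⁻¹ • (w' - y)) (v - w')
  have h4 := abs_le.1 (hCf v hv)
  have h5 := abs_le.1 (hCf w' hw'.1)
  have h6 : ‖σ' • fy x w' + gy x w' + ρ⁻¹ • (w' - y)‖ * ‖v - w'‖ ≤ M * ‖v - w'‖ := by gcongr
  have h7 : (σ' * lf + L + 1 / (2 * ρ)) * ‖v - w'‖ ^ 2 ≤ ‖v - w'‖ ^ 2 / ρ := by
    have : σ' * lf + L + 1 / (2 * ρ) ≤ 1 / ρ := by
      have h8 : σ' * lf ≤ L := le_trans (by gcongr) hσl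
      have h9 : L + L ≤ 1 / (2 * ρ) := by rw [le_div_iff₀ (by positivity)]; linarith
      have : 1 / ρ = 1 / (2 * ρ) + 1 / (2 * ρ) := by field_simp; norm_num
      linarith
    calc _ ≤ 1 / ρ * ‖v - w'‖ ^ 2 := by gcongr
      _ = _ := by ring
  set κ := (σ - σ') / σ' with hκ
  have hκ0 : 0 ≤ κ := div_nonneg (by linarith) hσ'.le
  have e : σ / σ' = 1 + κ := by rw [hκ]; field_simp; ring
  have e' : κ * σ' = σ - σ' := by rw [hκ]; field_simp
  rw [e]
  simp only [proxObj] at *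
  -- U is the gap for σ', and σ/σ' U = U + κU. The first summand is compared with the gap for σ by
  -- minimality of w, at the cost of the oscillation of f; the second is bounded by the quadratic
  -- model at w', whose gradient is at most M.
  set U := σ' * f x v + g x v + 1 / (2 * ρ) * ‖v - y‖ ^ 2
    - (σ' * f x w' + g x w' + 1 / (2 * ρ) * ‖w' - y‖ ^ 2) with hU
  have h8 : U ≤ M * ‖v - w'‖ + ‖v - w'‖ ^ 2 / ρ := by
    rw [hU]; linarith
  have h9 := mul_le_mul_of_nonneg_left h8 hκ0
  have h10 : -(f x v - f x w') ≤ 2 * Cf := by linarith [h4.1, h5.2]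
  have h11 : -((σ - σ') * (f x v - f x w')) ≤ 2 * ((σ - σ') * Cf) := by
    have h12 : 0 ≤ σ - σ' := by linarith
    linarith only [mul_le_mul_of_nonneg_left h10 h12]
  have h12 : κ * (σ' * f x v + g x v + 1 / (2 * ρ) * ‖v - y‖ ^ 2
    - (σ' * f x w' + g x w' + 1 / (2 * ρ) * ‖w' - y‖ ^ 2)) = κ * U := rfl
  have h13 := congrArg (· * (f x v - f x w')) e'
  linarith only [h1, h8, h9, h11, h12, h13, hU]

end Drift

/-- Bookkeeping of the constants in the one-step estimate for the inner iteration; `t = γ / ρ`,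
`a = α / ρ`. -/
theorem inner_step_bookkeeping {ρ t a b lam ε κ M E Ep R W dx dy et e' dr e2 u u0 up u' F : ℝ}
    (hρ : 0 < ρ) (ht : 0 < t) (ht1 : t ≤ 1 / 16) (ha : 0 < a) (hat : a ≤ t / 100000)
    (hb : 0 ≤ b) (hbt : b ≤ t / 100000) (hlam : 0 ≤ lam) (hlam1 : lam ≤ 1 / 500) (hε : 0 ≤ ε)
    (hε1 : ε ≤ 1 / 100) (hκ1 : κ ≤ t / 100000)
    (hE : 0 ≤ E) (hR : 0 ≤ R) (he2 : 0 ≤ e2) (hF : 0 ≤ F)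
    (het : 0 ≤ et) (he' : 0 ≤ e')
    (s1 : Ep ^ 2 ≤ (1 - t / 2) * E + 2 * ρ ^ 2 * t * e2)
    (s2 : dy ^ 2 ≤ 2 * b ^ 2 * (R + Ep ^ 2))
    (s3 : ρ * u0 ≤ ρ * u - W / (2 * t) + ρ ^ 2 * t * e2)
    (s4 : ρ * up ≤ ρ * u0 + lam * et * dx + 2 * lam * dx ^ 2 + et * dy)
    (s5 : et ≤ Ep + (2 * dy + 2 * lam * dx))
    (s6 : e' ≤ Ep + (2 * dy + 2 * lam * dx) + dr)
    (s7 : ρ * u' ≤ ρ * up + κ * (ρ * M * e' + e' ^ 2) + 2 * (ρ * F))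
    (s8 : t * dr ^ 2 ≤ 8 * (t * κ ^ 2) * (ρ * M) ^ 2 + t ^ 2 / 100 * (ρ * F)) :
    (1 + κ) * e' ^ 2 + ε * (ρ * u') + t / 16 * Ep ^ 2
      ≤ E + ε * (ρ * u) - ε * W / (2 * t) + 4 * ρ ^ 2 * t * e2 + b / 100 * R
        + dx ^ 2 / (100 * a) + 289 * κ ^ 2 * (ρ * M) ^ 2 / t + 2 * (ρ * F) := by
  have hdrt : dr ^ 2 / t ≤ 8 * (κ ^ 2 * (ρ * M) ^ 2 / t) + ρ * F / 100 := by
    rw [div_le_iff₀ ht]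
    have h1 : t * dr ^ 2 ≤ t * ((8 * (κ ^ 2 * (ρ * M) ^ 2 / t) + ρ * F / 100) * t) := by
      refine s8.trans (le_of_eq ?_); field_simp
    exact le_of_mul_le_mul_left h1 ht
  -- The displacement of y carries b²; one factor b is traded for t, so division by t leaves a small
  -- multiple of b R.
  have hdyt : dy ^ 2 / t ≤ b / 50000 * R + t / 5000000000 * Ep ^ 2 := by
    rw [div_le_iff₀ ht]
    have h1 : b ^ 2 ≤ t / 100000 * b := by rw [sq]; gcongr
    have h2 : b ^ 2 ≤ t / 100000 * (t / 100000) := by rw [sq]; gcongr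
    linarith only [s2, mul_le_mul_of_nonneg_right h1 hR,
      mul_le_mul_of_nonneg_right h2 (sq_nonneg Ep)]
  have hdxt : lam ^ 2 * dx ^ 2 / t ≤ dx ^ 2 / a / 10000000000 := by
    rw [div_le_iff₀ ht, div_div, div_mul_eq_mul_div, le_div_iff₀ (by positivity)]
    have h1 : lam ^ 2 ≤ 1 / 500 * (1 / 500) := by rw [sq]; gcongr
    have h2 : lam ^ 2 * a ≤ (1 / 500 * (1 / 500)) * (t / 100000) := by gcongr
    have h3 := mul_le_mul_of_nonneg_right h2 (sq_nonneg dx)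
    have h4 : 0 ≤ dx ^ 2 * t := by positivity
    linarith only [h3, h4]
  have hdxa : lam * dx ^ 2 ≤ dx ^ 2 / a / 100000000 := by
    rw [div_div, le_div_iff₀ (by positivity)]
    have h2 : lam * a ≤ 1 / 500 * (1 / 16 / 100000) := by
      apply mul_le_mul hlam1 _ ha.le (by norm_num); linarith
    have h3 := mul_le_mul_of_nonneg_right h2 (sq_nonneg dx)
    have h4 := sq_nonneg dx
    linarith only [h3, h4]
  -- The growth factor 1 + t/16 is small compared with the contraction 1 - t/2; the price is the
  -- factor 17/t on all displacements.
  have hyoung : ∀ p q : ℝ, (p + q) ^ 2 ≤ (1 + t / 16) * p ^ 2 + 17 / t * q ^ 2 := by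
    intro p q
    have h1 : (1 + t / 16) * p ^ 2 + 17 / t * q ^ 2 - (p + q) ^ 2
        = t / 16 * (p - 16 / t * q) ^ 2 + (1 - t) / t * q ^ 2 := by
      field_simp; ring
    have h2 : 0 ≤ (1 - t) / t := div_nonneg (by linarith only [ht1]) ht.le
    have : 0 ≤ t / 16 * (p - 16 / t * q) ^ 2 + (1 - t) / t * q ^ 2 := by positivity
    linarith only [h1, this]
  set P := dy ^ 2 / t with hP
  set Q := lam ^ 2 * dx ^ 2 / t with hQ
  set V := dr ^ 2 / t with hV
  have hP0 : 0 ≤ P := by positivity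
  have hQ0 : 0 ≤ Q := by positivity
  have hV0 : 0 ≤ V := by positivity
  have het2 : et ^ 2 ≤ (1 + t / 16) * Ep ^ 2 + 136 * (P + Q) := by
    have h1 : et ^ 2 ≤ (Ep + (2 * dy + 2 * lam * dx)) ^ 2 := pow_le_pow_left₀ het s5 2
    refine h1.trans ((hyoung _ _).trans ?_)
    have : 17 / t * (2 * dy + 2 * lam * dx) ^ 2 ≤ 17 / t * (8 * dy ^ 2 + 8 * (lam * dx) ^ 2) := by
      gcongr; linarith only [sq_nonneg (dy - lam * dx)]
    have e1 : 17 / t * (8 * dy ^ 2 + 8 * (lam * dx) ^ 2) = 136 * (P + Q) := by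
      rw [hP, hQ]; ring
    linarith only [this, e1]
  have he'2 : e' ^ 2 ≤ (1 + t / 16) * Ep ^ 2 + 272 * (P + Q) + 34 * V := by
    have h1 : e' ^ 2 ≤ (Ep + (2 * dy + 2 * lam * dx + dr)) ^ 2 :=
      pow_le_pow_left₀ he' (by linarith only [s6]) 2
    refine h1.trans ((hyoung _ _).trans ?_)
    have : 17 / t * (2 * dy + 2 * lam * dx + dr) ^ 2
        ≤ 17 / t * (16 * dy ^ 2 + 16 * (lam * dx) ^ 2 + 2 * dr ^ 2) := by
      gcongr; linarith only [sq_nonneg (dy - lam * dx), sq_nonneg (2 * dy + 2 * lam * dx - dr)]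
    have e1 : 17 / t * (16 * dy ^ 2 + 16 * (lam * dx) ^ 2 + 2 * dr ^ 2)
        = 272 * (P + Q) + 34 * V := by
      rw [hP, hQ, hV]; ring
    linarith only [this, e1]
  have hup : ρ * up ≤ ρ * u - W / (2 * t) + ρ ^ 2 * t * e2 + t / 2 * et ^ 2 + P + Q
      + 2 * (lam * dx ^ 2) := by
    have h1 : lam * et * dx ≤ t / 4 * et ^ 2 + Q := by
      have h3 : t / 4 * et ^ 2 + Q - lam * et * dx = (t * et / 2 - lam * dx) ^ 2 / t := by
        rw [hQ]; field_simp; ring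
      have h4 : 0 ≤ (t * et / 2 - lam * dx) ^ 2 / t := by positivity
      linarith only [h3, h4]
    have h2 : et * dy ≤ t / 4 * et ^ 2 + P := by
      have h3 : t / 4 * et ^ 2 + P - et * dy = (t * et / 2 - dy) ^ 2 / t := by
        rw [hP]; field_simp; ring
      have h4 : 0 ≤ (t * et / 2 - dy) ^ 2 / t := by positivity
      linarith only [h3, h4]
    linarith only [h1, h2, s3, s4]
  set N := κ ^ 2 * (ρ * M) ^ 2 / t with hN
  have hN0 : 0 ≤ N := by positivity
  have hu' : ρ * u' ≤ ρ * up + N + t / 2 * e' ^ 2 + 2 * (ρ * F) := by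
    have h1 : κ * (ρ * M * e') ≤ N + t / 4 * e' ^ 2 := by
      have h3 : N + t / 4 * e' ^ 2 - κ * (ρ * M * e') = (κ * (ρ * M) - t * e' / 2) ^ 2 / t := by
        rw [hN]; field_simp; ring
      have h4 : 0 ≤ (κ * (ρ * M) - t * e' / 2) ^ 2 / t := by positivity
      linarith only [h3, h4]
    have h2 : κ * e' ^ 2 ≤ t / 4 * e' ^ 2 := by gcongr; linarith only [hκ1, ht]
    linarith only [h1, h2, s7]
  -- The decrease in W keeps its full weight ε, while all error terms of the gap are estimated with
  -- the cruder 1/100.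
  have hεu : ε * (ρ * u') ≤ ε * (ρ * u) - ε * (W / (2 * t)) + 1 / 100 * (ρ ^ 2 * t * e2
      + t / 2 * et ^ 2 + P + Q + 2 * (lam * dx ^ 2) + N + t / 2 * e' ^ 2 + 2 * (ρ * F)) := by
    have h1 : ρ * u' ≤ ρ * u - W / (2 * t) + (ρ ^ 2 * t * e2
      + t / 2 * et ^ 2 + P + Q + 2 * (lam * dx ^ 2) + N + t / 2 * e' ^ 2 + 2 * (ρ * F)) := by
      linarith only [hu', hup]
    have h2 := mul_le_mul_of_nonneg_left h1 hε
    have h3 : 0 ≤ ρ ^ 2 * t * e2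
      + t / 2 * et ^ 2 + P + Q + 2 * (lam * dx ^ 2) + N + t / 2 * e' ^ 2 + 2 * (ρ * F) := by
      positivity
    have h4 := mul_le_mul_of_nonneg_right hε1 h3
    linarith only [h2, h4]
  have e1 : ε * W / (2 * t) = ε * (W / (2 * t)) := by ring
  have e2' : dx ^ 2 / (100 * a) = dx ^ 2 / a / 100 := by field_simp
  have e3 : 289 * κ ^ 2 * (ρ * M) ^ 2 / t = 289 * N := by rw [hN]; ring
  rw [e1, e2', e3]
  have hDX0 : 0 ≤ dx ^ 2 / a := by positivity
  have hF0 : 0 ≤ ρ * F := by positivity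
  have hc : (1 + κ + t / 200) ≤ 1 + t / 100 := by linarith only [hκ1, ht]
  have h1 : (1 + κ + t / 200) * e' ^ 2
      ≤ (1 + t / 100) * ((1 + t / 16) * Ep ^ 2 + 272 * (P + Q) + 34 * V) := by
    apply mul_le_mul hc he'2 (sq_nonneg _) (by positivity)
  have h2 : (1 + t / 100) * ((1 + t / 16) * Ep ^ 2 + 272 * (P + Q) + 34 * V)
      ≤ (1 + t / 10) * Ep ^ 2 + 273 * (P + Q) + 35 * V := by
    have h3 : (1 + t / 100) * (1 + t / 16) ≤ 1 + t / 10 := by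
      have : t * t ≤ 1 / 16 * t := by gcongr
      linarith only [this, ht]
    have h4 := mul_le_mul_of_nonneg_right h3 (sq_nonneg Ep)
    have h5 : 0 ≤ (1 / 16 - t) * (P + Q) := mul_nonneg (by linarith only [ht1]) (by linarith only [hP0, hQ0])
    have h6 : 0 ≤ (1 / 16 - t) * V := mul_nonneg (by linarith only [ht1]) hV0
    have h7 : 0 ≤ t * Ep ^ 2 := by positivity
    linarith only [h4, h5, h6, h7, hP0, hQ0, hV0]
  have h3 : t / 200 * et ^ 2 ≤ t / 100 * Ep ^ 2 + P + Q := by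
    have h4 : t / 200 * et ^ 2 ≤ t / 200 * ((1 + t / 16) * Ep ^ 2 + 136 * (P + Q)) := by gcongr
    have h5 : t * (t * Ep ^ 2) ≤ 1 * (t * Ep ^ 2) := by gcongr; linarith only [ht1]
    have h6 : t * (P + Q) ≤ 1 / 16 * (P + Q) := by gcongr
    have h7 : 0 ≤ t * Ep ^ 2 := by positivity
    linarith only [h4, h5, h6, h7, hP0, hQ0]
  -- The contraction leaves room for the factor 1 + t/4. The requirements are t/10 and t/100 from
  -- the moving data and t/16 from the term on the left, which is kept for the outer step.
  have h4 : (1 + t / 4) * Ep ^ 2 ≤ E - t / 4 * E + 3 * (ρ ^ 2 * t * e2) - t ^ 2 / 8 * E := by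
    have h5 : (1 + t / 4) * Ep ^ 2 ≤ (1 + t / 4) * ((1 - t / 2) * E + 2 * ρ ^ 2 * t * e2) := by
      gcongr
    have h6 : 0 ≤ (1 / 16 - t) * (ρ ^ 2 * t * e2) :=
      mul_nonneg (by linarith only [ht1]) (by positivity)
    have h7 : 0 ≤ ρ ^ 2 * t * e2 := by positivity
    linarith only [h5, h6, h7]
  have h7 : 0 ≤ ρ ^ 2 * t * e2 := by positivity
  have h8 : 0 ≤ t / 4 * E + t ^ 2 / 8 * E := by positivity
  have hEpt : 0 ≤ t * Ep ^ 2 := by positivity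
  have hbR : 0 ≤ b * R := by positivity
  linarith only [hεu, h1, h2, h3, h4, h7, h8, hEpt, hP0, hQ0, hV0, hdyt, hdxt, hdxa, hdrt,
    hN0, hDX0, hF0, hbR]

/-! ### Assembly of the inner step from contraction, moving data and changing penalty weight. -/

section InnerStep

variable {dx dy : ℕ} {X : Set (Vec dx)} {Y : Set (Vec dy)} {f g : Vec dx → Vec dy → ℝ}
  {fx gx : Vec dx → Vec dy → Vec dx} {fy gy : Vec dx → Vec dy → Vec dy}
  {lf L ρ σ σ' Cf M α β γ ε : ℝ}

theorem norm_sq_average_step_le {d : ℕ} {y y' w ws : Vec d} (hβ : 0 ≤ β)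
    (hy' : y' = (1 - β) • y + β • w) :
    ‖y' - y‖ ^ 2 ≤ 2 * β ^ 2 * (‖y - ws‖ ^ 2 + ‖w - ws‖ ^ 2) := by
  have e : y' - y = β • ((w - ws) - (y - ws)) := by rw [hy']; module
  rw [e, norm_smul, Real.norm_of_nonneg hβ, mul_pow]
  have h := norm_sub_le (w - ws) (y - ws)
  have h2 : ‖(w - ws) - (y - ws)‖ ^ 2 ≤ (‖w - ws‖ + ‖y - ws‖) ^ 2 :=
    pow_le_pow_left₀ (norm_nonneg _) h 2
  have h3 : ‖(w - ws) - (y - ws)‖ ^ 2 ≤ 2 * (‖y - ws‖ ^ 2 + ‖w - ws‖ ^ 2) := by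
    linarith [sq_nonneg (‖w - ws‖ - ‖y - ws‖)]
  calc _ ≤ β ^ 2 * (2 * (‖y - ws‖ ^ 2 + ‖w - ws‖ ^ 2)) := by gcongr
    _ = _ := by ring

set_option maxHeartbeats 1000000 in
/-- One step of the inner iteration: the squared tracking error and the optimality gap of the
proximal subproblem decrease, up to the effect of the moving data. -/
theorem inner_step_estimate (hf : SmoothPair X Y f fx fy lf) (hg : SmoothPair X Y g gx gy L)
    (hY : Convex ℝ Y) (hYc : IsClosed Y) (hρ : 0 < ρ) (hL : ρ * L ≤ 1 / 1000) (hlf : 0 ≤ lf)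
    (hσ' : 0 < σ') (hσσ' : σ' ≤ σ) (hσl : σ * lf ≤ L)
    (hCf : ∀ x ∈ X, ∀ w ∈ Y, |f x w| ≤ Cf) (hγ : 0 < γ) (hγρ : γ ≤ ρ / 16) (hα : 0 < α)
    (hβ : 0 ≤ β) (hβαγ : ρ * β + α ≤ γ / 100000)
    (hκ : (σ - σ') / σ' ≤ γ / ρ / 100000) (hε : 0 ≤ ε) (hε1 : ε ≤ 1 / 100)
    {x x' : Vec dx} (hx : x ∈ X) (hx' : x' ∈ X) {y y' w wp v ws ws' wt w₀ : Vec dy} (hw : w ∈ Y)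
    (hwp : wp = proj Y (w - γ • (v + ρ⁻¹ • (w - y)))) (hy' : y' = (1 - β) • y + β • wp)
    (hws : IsProx Y ρ (fun w => σ * f x w + g x w) y ws)
    (hwt : IsProx Y ρ (fun w => σ * f x' w + g x' w) y' wt)
    (hws' : IsProx Y ρ (fun w => σ' * f x' w + g x' w) y' ws')
    (hw₀ : IsProx Y ρ (g x') y' w₀)
    (hM : ‖σ' • fy x' ws' + gy x' ws' + ρ⁻¹ • (ws' - y')‖ ≤ M)
    (hM₀ : ‖gy x' w₀ + ρ⁻¹ • (w₀ - y')‖ ≤ M) :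
    ρ⁻¹ * (σ / σ') * ‖wp - ws'‖ ^ 2
      + ε * (σ / σ' * (proxObj (fun w => σ' * f x' w + g x' w) ρ y' wp
        - proxObj (fun w => σ' * f x' w + g x' w) ρ y' ws'))
      + γ / (16 * ρ ^ 2) * ‖wp - ws‖ ^ 2
    ≤ ρ⁻¹ * ‖w - ws‖ ^ 2
      + ε * (proxObj (fun w => σ * f x w + g x w) ρ y w
        - proxObj (fun w => σ * f x w + g x w) ρ y ws)
      - ε / (2 * γ) * ‖wp - w‖ ^ 2 + 4 * γ * ‖v - (σ • fy x w + gy x w)‖ ^ 2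
      + β / (100 * ρ) * ‖y - ws‖ ^ 2 + ‖x' - x‖ ^ 2 / (100 * α)
      + 289 * ((σ - σ') / σ') ^ 2 * (M ^ 2 * ρ ^ 2) / γ + 2 * ((σ - σ') * Cf) := by
  have hσ : 0 < σ := hσ'.trans_le hσσ'
  have hL0 : 0 ≤ L := le_trans (by positivity) hσl
  have hh : SmoothPair X Y (fun x w => σ * f x w + g x w) (fun x w => σ • fx x w + gx x w)
      (fun x w => σ • fy x w + gy x w) (2 * L) :=
    (hf.smul_add hg hσ.le).mono (by linarith)
  have hwpY : wp ∈ Y := hwp ▸ proj_mem hY hYc ⟨w, hw⟩ _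
  have hCf0 : 0 ≤ Cf := (abs_nonneg _).trans (hCf x hx w hw)
  have hΛ : ρ * (2 * L) ≤ 1 / 500 := by linarith
  have hΛ' : ρ * (2 * L) ≤ 1 / 2 := by linarith
  set t := γ / ρ with ht
  have ht0 : 0 < t := by positivity
  have htρ : ρ * t = γ := by rw [ht]; field_simp
  have s1 := hh.prox_step_contract hY hYc hρ hΛ' hγ (by linarith) hx hw hws v
  rw [← hwp] at s1
  have s2 := norm_sq_average_step_le (ws := ws) hβ hy'
  have s3 := hh.prox_step_descent (y := y) hY hYc hρ hΛ' hγ hγρ hx hw v hwp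
  -- The data change in two stages through wt, the proximal point for the new (x', y') and the old
  -- σ: first x and y move, then σ.
  have s4 := hh.prox_gap_move hρ hx hx' hws hwt hwpY
  have hlip := hh.prox_lipschitz hY hρ hΛ' hx hx' hws hwt
  have s5 : ‖wp - wt‖ ≤ ‖wp - ws‖ + (2 * ‖y' - y‖ + 2 * (ρ * (2 * L)) * ‖x' - x‖) := by
    have : ‖wp - wt‖ ≤ ‖wp - ws‖ + ‖wt - ws‖ := by
      rw [norm_sub_rev wt]; exact norm_sub_le_norm_sub_add_norm_sub _ _ _
    linarith
  have s6 : ‖wp - ws'‖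
      ≤ ‖wp - ws‖ + (2 * ‖y' - y‖ + 2 * (ρ * (2 * L)) * ‖x' - x‖) + ‖ws' - wt‖ := by
    have : ‖wp - ws'‖ ≤ ‖wp - wt‖ + ‖ws' - wt‖ := by
      rw [norm_sub_rev ws']; exact norm_sub_le_norm_sub_add_norm_sub _ _ _
    linarith
  have s7 := prox_gap_rescale hf hg hρ (by linarith) hlf hσ' hσσ' hσl hx' (hCf x' hx') hwt hws'
    hwpY hM
  have s8 := norm_sq_prox_drift_le hf hg hY hρ (by linarith) hlf hσ' hσσ' hσl hx' (hCf x' hx')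
    hwt hws' hw₀ hM₀
  set κ := (σ - σ') / σ' with hκd
  have hκ0 : 0 ≤ κ := div_nonneg (by linarith) hσ'.le
  have hσκ : σ / σ' = 1 + κ := by rw [hκd]; field_simp; ring
  have hF0 : 0 ≤ (σ - σ') * Cf := mul_nonneg (by linarith) hCf0
  rw [hσκ] at s7 ⊢
  -- Everything is multiplied by ρ to make the parameters dimensionless. The variable u' already
  -- contains the factor σ/σ' = 1 + κ.
  have key := inner_step_bookkeeping (ρ := ρ) (t := t) (a := α / ρ) (b := β)
    (lam := ρ * (2 * L)) (ε := ε) (κ := κ) (M := M) (E := ‖w - ws‖ ^ 2) (Ep := ‖wp - ws‖)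
    (R := ‖y - ws‖ ^ 2) (W := ‖wp - w‖ ^ 2) (dx := ‖x' - x‖) (dy := ‖y' - y‖)
    (et := ‖wp - wt‖) (e' := ‖wp - ws'‖) (dr := ‖ws' - wt‖)
    (e2 := ‖v - (σ • fy x w + gy x w)‖ ^ 2)
    (u := proxObj (fun w => σ * f x w + g x w) ρ y w
        - proxObj (fun w => σ * f x w + g x w) ρ y ws)
    (u0 := proxObj (fun w => σ * f x w + g x w) ρ y wp
        - proxObj (fun w => σ * f x w + g x w) ρ y ws)
    (up := proxObj (fun w => σ * f x' w + g x' w) ρ y' wp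
        - proxObj (fun w => σ * f x' w + g x' w) ρ y' wt)
    (u' := (1 + κ) * (proxObj (fun w => σ' * f x' w + g x' w) ρ y' wp
        - proxObj (fun w => σ' * f x' w + g x' w) ρ y' ws'))
    (F := (σ - σ') * Cf) hρ ht0 (by rw [ht, div_le_iff₀ hρ]; linarith) (by positivity)
    (by
      rw [ht, div_div, mul_comm ρ, ← div_div]
      exact div_le_div_of_nonneg_right (by linarith only [hβαγ, mul_nonneg hρ.le hβ]) hρ.le) hβ
    (by rw [ht, div_div, le_div_iff₀ (by positivity)]; linarith) (by positivity) hΛ hε hε1 hκ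
    (by positivity) (by positivity) (by positivity) hF0 (norm_nonneg _) (norm_nonneg _)
    (s1.trans (le_of_eq (by rw [← htρ]; field_simp))) s2
    (by
      have h1 := mul_le_mul_of_nonneg_left s3 hρ.le
      have e : ρ * (‖wp - w‖ ^ 2 / (2 * γ)) = ‖wp - w‖ ^ 2 / (2 * t) := by
        rw [← htρ]; field_simp
      have e2 : ρ * (γ * ‖v - (σ • fy x w + gy x w)‖ ^ 2)
        = ρ ^ 2 * t * ‖v - (σ • fy x w + gy x w)‖ ^ 2 := by
        rw [← htρ]; ring
      linarith)
    (by
      have h1 := mul_le_mul_of_nonneg_left s4 hρ.le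
      have e : ρ * (ρ⁻¹ * (‖wp - wt‖ * ‖y' - y‖)) = ‖wp - wt‖ * ‖y' - y‖ := by field_simp
      linarith)
    s5 s6
    (by
      have h1 := mul_le_mul_of_nonneg_left s7 hρ.le
      have e : ρ * (κ * (M * ‖wp - ws'‖ + ‖wp - ws'‖ ^ 2 / ρ))
        = κ * (ρ * M * ‖wp - ws'‖ + ‖wp - ws'‖ ^ 2) := by field_simp
      linarith)
    (by
      have hκ'0 : 0 ≤ (σ - σ') / σ := div_nonneg (by linarith) hσ.le
      have hκ' : (σ - σ') / σ ≤ κ := by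
        rw [hκd]; exact div_le_div_of_nonneg_left (by linarith) hσ' hσσ'
      -- In the Cf part one factor (σ - σ')/σ combines with σ to σ - σ', and the other one is small
      -- compared with t.
      have h1 : 4 * ρ ^ 2 * ((σ - σ') / σ) ^ 2 * (2 * M ^ 2 + 32 * (σ * Cf) / ρ)
        = 8 * ((σ - σ') / σ) ^ 2 * (ρ * M) ^ 2
          + 128 * ((σ - σ') / σ) * (ρ * ((σ - σ') * Cf)) := by
        field_simp; ring
      have h2 : ((σ - σ') / σ) ^ 2 * (ρ * M) ^ 2 ≤ κ ^ 2 * (ρ * M) ^ 2 := by gcongr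
      have h3 : 128 * ((σ - σ') / σ) * (ρ * ((σ - σ') * Cf))
        ≤ t / 100 * (ρ * ((σ - σ') * Cf)) := by
        gcongr; linarith
      have h4 : ‖ws' - wt‖ ^ 2 ≤ 8 * (κ ^ 2 * (ρ * M) ^ 2) + t / 100 * (ρ * ((σ - σ') * Cf)) := by
        linarith
      have h5 := mul_le_mul_of_nonneg_left h4 ht0.le
      linarith)
  have hfin := mul_le_mul_of_nonneg_left key (inv_pos.2 hρ).le
  refine le_trans (le_of_eq ?_) (hfin.trans (le_of_eq ?_))
  · rw [← htρ]; field_simp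
  · rw [← htρ]; field_simp

end InnerStep

/-! ### One step of the outer iteration -/

section OuterStep

variable {dx dy : ℕ} {X : Set (Vec dx)} {Y : Set (Vec dy)} {f g φ : Vec dx → Vec dy → ℝ}
  {fx gx φx : Vec dx → Vec dy → Vec dx} {fy gy φy : Vec dx → Vec dy → Vec dy}
  {lf L Λ ρ σ σ' Cf α β γ s : ℝ}

/-- The upper half of Danskin's theorem: the old proximal point is a trial point for the new
subproblem. It identifies the partial gradients of the envelope as φx x ws and ρ⁻¹(y - ws). -/
theorem SmoothPair.prox_value_move (h : SmoothPair X Y φ φx φy Λ) (hρ : 0 < ρ) {x x' : Vec dx}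
    (hx : x ∈ X) (hx' : x' ∈ X) {y y' ws ws' : Vec dy} (hws : IsProx Y ρ (φ x) y ws)
    (hws' : IsProx Y ρ (φ x') y' ws') :
    proxObj (φ x') ρ y' ws' ≤ proxObj (φ x) ρ y ws + inner ℝ (φx x ws) (x' - x)
      + Λ * ‖x' - x‖ ^ 2 + (ρ⁻¹ * inner ℝ (y - ws) (y' - y) + ρ⁻¹ / 2 * ‖y' - y‖ ^ 2) := by
  have h1 := hws'.obj_le hρ hws.1
  have h2 := (abs_le.1 (h.taylor_fst hx hx' hws.1)).2
  have e1 : ‖ws - y'‖ ^ 2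
      = ‖ws - y‖ ^ 2 + 2 * inner ℝ (y - ws) (y' - y) + ‖y' - y‖ ^ 2 := by
    have : ws - y' = -((y - ws) + (y' - y)) := by abel
    rw [this, norm_neg, norm_add_sq_real, norm_sub_rev y ws]
  have e : 1 / (2 * ρ) = ρ⁻¹ / 2 := by rw [one_div, mul_inv]; ring
  unfold proxObj at *
  rw [e] at h1 ⊢
  rw [e1] at h1
  linarith

/-- Since (y - ws)/ρ is the y-gradient of the envelope, averaging y towards w ≈ ws is a descent
step. Of the coefficient 1, a quarter goes to Young's inequality and β ≤ 1/16 to the quadratic term,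
which leaves more than 5/8. -/
theorem average_step_descent {d : ℕ} {y y' w ws : Vec d} (hβ : 0 ≤ β) (hβ1 : β ≤ 1 / 16)
    (hy' : y' = (1 - β) • y + β • w) :
    inner ℝ (y - ws) (y' - y) + 1 / 2 * ‖y' - y‖ ^ 2
      ≤ - (5 / 8 * β * ‖y - ws‖ ^ 2) + 2 * β * ‖w - ws‖ ^ 2 := by
  have h1 := norm_sq_average_step_le (ws := ws) hβ hy'
  have e : y' - y = β • ((w - ws) - (y - ws)) := by rw [hy']; module
  have h2 : inner ℝ (y - ws) (y' - y) = β * (inner ℝ (y - ws) (w - ws) - ‖y - ws‖ ^ 2) := by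
    rw [e, inner_smul_right, inner_sub_right, real_inner_self_eq_norm_sq]
  have h3 := real_inner_le_norm (y - ws) (w - ws)
  have h4 : inner ℝ (y - ws) (w - ws) ≤ ‖y - ws‖ ^ 2 / 4 + ‖w - ws‖ ^ 2 := by
    linarith [sq_nonneg (‖y - ws‖ / 2 - ‖w - ws‖)]
  have h5 := mul_le_mul_of_nonneg_left h4 hβ
  have h6 : β ^ 2 * (‖y - ws‖ ^ 2 + ‖w - ws‖ ^ 2)
      ≤ 1 / 16 * β * (‖y - ws‖ ^ 2 + ‖w - ws‖ ^ 2) := by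
    rw [sq]; gcongr
  have h7 : 0 ≤ β * ‖y - ws‖ ^ 2 := by positivity
  have h8 : 0 ≤ β * ‖w - ws‖ ^ 2 := by positivity
  rw [h2]
  linarith

/-- Descent along an inexact projected gradient step, together with the stationarity measure of the
exact step. -/
theorem proj_step_descent {d : ℕ} {S : Set (Vec d)} (hS : Convex ℝ S) (hSc : IsClosed S)
    (hα : 0 < α) {x x' xh q D : Vec d} (hx : x ∈ S) (hx' : x' = proj S (x - α • q))
    (hxh : xh = proj S (x - α • D)) :
    inner ℝ D (x' - x) + α / 16 * ‖α⁻¹ • (x - xh)‖ ^ 2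
      ≤ - (5 / 8 * (‖x' - x‖ ^ 2 / α)) + 9 / 8 * (α * ‖q - D‖ ^ 2) := by
  have h1 := inner_proj_step_le hS hSc hx hα q
  have h2 := norm_proj_sub_proj_le hS hSc ⟨x, hx⟩ (x - α • D) (x - α • q)
  rw [← hx'] at h1 h2
  rw [← hxh] at h2
  have e1 : x - α • q - (x - α • D) = -(α • (q - D)) := by module
  rw [e1, norm_neg, norm_smul, Real.norm_of_nonneg hα.le] at h2
  have h3 := (abs_le.1 (abs_real_inner_le_norm (q - D) (x' - x))).1
  rw [inner_sub_left] at h3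
  set r := ‖q - D‖
  set n := ‖x' - x‖
  have h4 : r * n ≤ n ^ 2 / α / 4 + α * r ^ 2 := by
    have h5 : n ^ 2 / α / 4 + α * r ^ 2 - r * n = (n / 2 - α * r) ^ 2 / α := by
      field_simp; ring
    have h6 : 0 ≤ (n / 2 - α * r) ^ 2 / α := by positivity
    linarith
  -- The exact and the actual step differ by at most α‖q - D‖, so the stationarity measure is paid
  -- from the gain n²/α.
  have h5 : ‖x - xh‖ ≤ n + α * r := by
    have : ‖x - xh‖ ≤ ‖x - x'‖ + ‖x' - xh‖ := norm_sub_le_norm_sub_add_norm_sub _ _ _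
    rw [norm_sub_rev x x'] at this
    linarith
  have h6 : ‖x - xh‖ ^ 2 ≤ 2 * n ^ 2 + 2 * (α * r) ^ 2 := by
    have := pow_le_pow_left₀ (norm_nonneg _) h5 2
    linarith [sq_nonneg (n - α * r)]
  have h7 : α / 16 * ‖α⁻¹ • (x - xh)‖ ^ 2 ≤ 1 / 8 * (n ^ 2 / α) + 1 / 8 * (α * r ^ 2) := by
    rw [norm_smul, norm_inv, Real.norm_of_nonneg hα.le, mul_pow]
    calc _ = ‖x - xh‖ ^ 2 / (16 * α) := by field_simp
      _ ≤ (2 * n ^ 2 + 2 * (α * r) ^ 2) / (16 * α) := by gcongr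
      _ = _ := by field_simp; ring
  linarith

/-- Decrease of the lower-level value function, compared with the linear model at `ws`. -/
theorem value_move (hg : SmoothPair X Y g gx gy L) (hY : Convex ℝ Y) (hρ : 0 < ρ)
    (hL : ρ * L ≤ 1 / 8) (hL0 : 0 ≤ L) (hs : 0 < s) (hsρ : ρ * s ≤ 3) {x x' : Vec dx}
    (hx : x ∈ X) (hx' : x' ∈ X) {z ws wh t : Vec dy} {V : ℝ} (hws : IsProx Y ρ (g x) z ws)
    (hwh : IsProx Y ρ (g x') z wh) (ht : t ∈ Y) (hV : ∀ w ∈ Y, V ≤ g x w)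
    (hEB : s * ‖z - t‖ ≤ 2 * (ρ⁻¹ * ‖z - wh‖)) :
    inner ℝ (gx x ws) (x' - x) - (g x' t - V)
      ≤ L / s * (5 * (ρ⁻¹ * ‖z - ws‖) + 4 * L * ‖x' - x‖) * ‖x' - x‖ + L * ‖x' - x‖ ^ 2 := by
  -- With t minimising at x', g*(x') - g*(x) ≥ g(x', t) - g(x, t). This is why the error bound is
  -- used at x', with the residual then moved back to x.
  have h1 := (abs_le.1 (hg.taylor_fst hx hx' ht)).1
  have h2 := hV t ht
  have h3 : inner ℝ (gx x ws) (x' - x) - inner ℝ (gx x t) (x' - x)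
      ≤ L * ‖ws - t‖ * ‖x' - x‖ := by
    rw [← inner_sub_left]
    refine (real_inner_le_norm _ _).trans ?_
    gcongr
    exact hg.lip_x_snd hx ht hws.1
  have h4 := hg.prox_lipschitz hY hρ (by linarith) hx hx' hws hwh
  rw [sub_self, norm_zero] at h4
  have h5 : ‖z - wh‖ ≤ ‖z - ws‖ + 2 * (ρ * L) * ‖x' - x‖ := by
    have : ‖z - wh‖ ≤ ‖z - ws‖ + ‖wh - ws‖ := by
      rw [norm_sub_rev wh]; exact norm_sub_le_norm_sub_add_norm_sub _ _ _
    linarith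
  have h6 : s * ‖ws - t‖ ≤ 5 * (ρ⁻¹ * ‖z - ws‖) + 4 * L * ‖x' - x‖ := by
    have h7 : ‖ws - t‖ ≤ ‖z - ws‖ + ‖z - t‖ := by
      rw [norm_sub_rev z ws]; exact norm_sub_le_norm_sub_add_norm_sub _ _ _
    -- The triangle inequality through z costs s‖z - ws‖, which is at most 3 residuals because ρs ≤
    -- 3. With the factor 2 of the error bound this gives the 5.
    have h8 : s ≤ 3 * ρ⁻¹ := by rw [← div_eq_mul_inv, le_div_iff₀ hρ]; linarith
    have h9 : ρ⁻¹ * ‖z - wh‖ ≤ ρ⁻¹ * ‖z - ws‖ + 2 * L * ‖x' - x‖ := by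
      calc _ ≤ ρ⁻¹ * (‖z - ws‖ + 2 * (ρ * L) * ‖x' - x‖) := by gcongr
        _ = _ := by field_simp
    calc s * ‖ws - t‖ ≤ s * (‖z - ws‖ + ‖z - t‖) := by gcongr
      _ = s * ‖z - ws‖ + s * ‖z - t‖ := by ring
      _ ≤ 3 * ρ⁻¹ * ‖z - ws‖ + s * ‖z - t‖ := by gcongr
      _ ≤ _ := by linarith
  have h7 : L * ‖ws - t‖ * ‖x' - x‖
      ≤ L / s * (5 * (ρ⁻¹ * ‖z - ws‖) + 4 * L * ‖x' - x‖) * ‖x' - x‖ := by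
    have : L * ‖ws - t‖ = L / s * (s * ‖ws - t‖) := by field_simp
    rw [this]
    gcongr
  linarith

/-- The proximal envelope exceeds the minimum by at most the squared proximal residual. -/
theorem prox_value_sub_min_le {d : ℕ} {S : Set (Vec d)} {φ : Vec d → ℝ} (hρ : 0 < ρ)
    (hs : 0 < s) {y w t : Vec d} (hw : IsProx S ρ φ y w) (ht : t ∈ S)
    (hEB : s * ‖y - t‖ ≤ 2 * (ρ⁻¹ * ‖y - w‖)) :
    proxObj φ ρ y w - φ t ≤ 2 / (s ^ 2 * ρ ^ 3) * ‖y - w‖ ^ 2 := by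
  have h1 := hw.obj_le hρ ht
  have h2 : ‖t - y‖ ^ 2 ≤ (2 * (ρ⁻¹ * ‖y - w‖) / s) ^ 2 := by
    rw [norm_sub_rev]
    refine pow_le_pow_left₀ (norm_nonneg _) ?_ 2
    rw [le_div_iff₀ hs]; linarith
  have h3 : 1 / (2 * ρ) * ‖t - y‖ ^ 2 ≤ 1 / (2 * ρ) * (2 * (ρ⁻¹ * ‖y - w‖) / s) ^ 2 := by gcongr
  have h4 : 1 / (2 * ρ) * (2 * (ρ⁻¹ * ‖y - w‖) / s) ^ 2
      = 2 / (s ^ 2 * ρ ^ 3) * ‖y - w‖ ^ 2 := by field_simp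
  have h5 : proxObj φ ρ y t = φ t + 1 / (2 * ρ) * ‖t - y‖ ^ 2 := rfl
  linarith

/-- Effect of the change of the penalty weight on the envelope part of the potential. -/
theorem outer_rescale (hρ : 0 < ρ) (hs : 0 < s) (hσ' : 0 < σ') (hσσ' : σ' ≤ σ)
    {f g : Vec dy → ℝ} (hCf : ∀ w ∈ Y, |f w| ≤ Cf) {y z wt ws' wz ty tz : Vec dy}
    (hwt : IsProx Y ρ (fun w => σ * f w + g w) y wt)
    (hws' : IsProx Y ρ (fun w => σ' * f w + g w) y ws') (hwz : IsProx Y ρ g z wz)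
    (hty : ty ∈ Y) (htymin : ∀ w ∈ Y, σ * f ty + g ty ≤ σ * f w + g w)
    (htz : tz ∈ Y)
    (hEBy : s * ‖y - ty‖ ≤ 2 * (ρ⁻¹ * ‖y - wt‖))
    (hEBz : s * ‖z - tz‖ ≤ 2 * (ρ⁻¹ * ‖z - wz‖)) :
    σ / σ' * (proxObj (fun w => σ' * f w + g w) ρ y ws' - proxObj g ρ z wz
        + 4 * (proxObj g ρ z wz - g tz))
      ≤ proxObj (fun w => σ * f w + g w) ρ y wt - proxObj g ρ z wz
        + 4 * (proxObj g ρ z wz - g tz)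
        + (σ - σ') / σ' * (2 * (σ * Cf) + 2 / (s ^ 2 * ρ ^ 3) * ‖y - wt‖ ^ 2
          + 3 * (2 / (s ^ 2 * ρ ^ 3) * ‖z - wz‖ ^ 2)) := by
  have hσ : 0 < σ := hσ'.trans_le hσσ'
  have h1 := hws'.obj_le hρ hwt.1
  have h2 := prox_value_sub_min_le hρ hs hwt hty hEBy
  have h3 := prox_value_sub_min_le hρ hs hwz htz hEBz
  have h4 := htymin tz htz
  have h5 := mul_le_mul_of_nonneg_left (abs_le.1 (hCf tz htz)).2 hσ.le
  have h6 := mul_le_mul_of_nonneg_left (abs_le.1 (hCf wt hwt.1)).1 hσ.le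
  set κ := (σ - σ') / σ' with hκ
  have hκ0 : 0 ≤ κ := div_nonneg (by linarith) hσ'.le
  have e : σ / σ' = 1 + κ := by rw [hκ]; field_simp; ring
  have h7 := mul_le_mul_of_nonneg_left h1 (div_pos hσ hσ').le
  -- Rescaling by σ/σ' turns σ'f into σf and multiplies only the rest by 1 + κ; the cost is κ times
  -- the g-part at wt.
  have h8 : σ / σ' * proxObj (fun w => σ' * f w + g w) ρ y wt
      = proxObj (fun w => σ * f w + g w) ρ y wt + κ * proxObj g ρ y wt := by
    unfold proxObj
    have : σ / σ' * σ' = σ := by field_simp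
    calc _ = (σ / σ' * σ') * f wt + σ / σ' * (g wt + 1 / (2 * ρ) * ‖wt - y‖ ^ 2) := by ring
      _ = _ := by rw [this, e]; ring
  rw [h8] at h7
  have h9 : proxObj (fun w => σ * f w + g w) ρ y wt = σ * f wt + proxObj g ρ y wt := by
    unfold proxObj; ring
  -- That g-part is close to the lower-level minimum: the error bound compares the envelope with min
  -- h_σ, tz is a trial point for min h_σ, and f contributes at most 2σCf.
  have h10 : proxObj g ρ y wt - g tz ≤ 2 * (σ * Cf) + 2 / (s ^ 2 * ρ ^ 3) * ‖y - wt‖ ^ 2 := by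
    linarith
  have h11 := mul_le_mul_of_nonneg_left h10 hκ0
  have h12 := mul_le_mul_of_nonneg_left h3 hκ0
  rw [e] at h7 ⊢
  linarith

/-- Bookkeeping of the constants in the one-step estimate for the outer iteration; `t = γ / ρ`,
`a = α / ρ`. -/
theorem outer_step_bookkeeping {a b t l s κ n Ry Rz Ey Ez Dy Dz ry rz r ex J F A : ℝ}
    (ha : 0 < a) (hb : 0 ≤ b) (hb1 : b ≤ 1 / 16) (hs : 0 < s) (hs3 : s ≤ 3)
    (ht : 0 < t) (ht1 : t ≤ 1 / 16)
    (hbt : b ≤ t / 100000) (hat : a ≤ t / 100000) (hab : a ≤ 1 / 100 * s ^ 2 * b)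
    (hl : 0 ≤ l) (hl1 : l ≤ 1 / 1000) (hκ0 : 0 ≤ κ) (hκ : κ ≤ 1 / 1000 * s ^ 2 * b)
    (hEy : 0 ≤ Ey) (hEz : 0 ≤ Ez)
    (hDy : Dy ≤ 2 * b ^ 2 * (Ry ^ 2 + Ey)) (hDz : Dz ≤ 2 * b ^ 2 * (Rz ^ 2 + Ez))
    (hry : ry ≤ 3 * Ry ^ 2 + 27 * Dy + 48 * l ^ 2 * n ^ 2)
    (hrz : rz ≤ 3 * Rz ^ 2 + 27 * Dz + 48 * l ^ 2 * n ^ 2)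
    (hr : r ≤ 3 * ex + 12 * l ^ 2 * Ey + 3 * l ^ 2 * Ez)
    (hex : 0 ≤ ex)
    (hJ : J ≤ - (5 / 8 * (n ^ 2 / a)) + 9 / 8 * (a * r))
    (hA : A ≤ J + 12 * l * n ^ 2 + 4 * (l / s * (5 * Rz + 4 * l * n) * n)
      + (- (5 / 8 * b * Ry ^ 2) + 2 * b * Ey) + 3 * (- (5 / 8 * b * Rz ^ 2) + 2 * b * Ez)
      + κ * (2 / s ^ 2 * ry + 3 * (2 / s ^ 2 * rz)) + F) :
    A ≤ - (1 / 4 * b * (Ry ^ 2 + Rz ^ 2)) - 1 / 4 * (n ^ 2 / a) + t / 16 * (Ey + Ez)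
      + 4 * (a * ex) + F := by
  have hN0 : 0 ≤ n ^ 2 / a := by positivity
  have hs2 : 0 < s ^ 2 := by positivity
  have ha1 : a ≤ 1 / 1000000 := by linarith only [hat, ht1]
  have hln : l * n ^ 2 ≤ 1 / 1000000000 * (n ^ 2 / a) := by
    have h1 : l * a ≤ 1 / 1000 * (1 / 1000000) := by gcongr
    have h2 := mul_le_mul_of_nonneg_right h1 hN0
    have h3 : l * a * (n ^ 2 / a) = l * n ^ 2 := by field_simp
    linarith only [h2, h3]
  have hl2 : l ^ 2 ≤ 1 / 1000 * (1 / 1000) := by rw [sq]; gcongr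
  have hl2n : l ^ 2 * n ^ 2 ≤ 1 / 1000000000 * (n ^ 2 / a) := by
    have h1 : l * (l * n ^ 2) ≤ 1 * (l * n ^ 2) := by gcongr; linarith only [hl1]
    linarith only [h1, hln]
  -- Here the coupling of the step sizes is essential: Young's inequality leaves a l²/s² Rz², and a
  -- ≤ s²b/100 makes it a small part of the gain b Rz².
  have h1 : 4 * (l / s * (5 * Rz) * n) ≤ 1 / 16 * (n ^ 2 / a) + 1 / 1000 * (b * Rz ^ 2) := by
    have h2 : 4 * (l / s * (5 * Rz) * n) ≤ 1 / 16 * (n ^ 2 / a) + 4 * (a * (20 * l / s * Rz) ^ 2) := by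
      have h3 : 1 / 16 * (n ^ 2 / a) + 4 * (a * (20 * l / s * Rz) ^ 2) - 4 * (l / s * (5 * Rz) * n)
          = (n / 4 - 2 * a * (20 * l / s * Rz)) ^ 2 / a := by field_simp; ring
      have h4 : 0 ≤ (n / 4 - 2 * a * (20 * l / s * Rz)) ^ 2 / a := by positivity
      linarith only [h3, h4]
    have h5 : 4 * (a * (20 * l / s * Rz) ^ 2) = a / s ^ 2 * (1600 * l ^ 2 * Rz ^ 2) := by
      field_simp; ring
    have h6 : a / s ^ 2 ≤ 1 / 100 * b := by rw [div_le_iff₀ hs2]; linarith only [hab]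
    have h7 : a / s ^ 2 * (1600 * l ^ 2 * Rz ^ 2)
        ≤ 1 / 100 * b * (1600 * (1 / 1000 * (1 / 1000)) * Rz ^ 2) := by gcongr
    have h8 : 0 ≤ b * Rz ^ 2 := by positivity
    linarith only [h2, h5, h7, h8]
  have h2 : 4 * (l / s * (4 * l * n) * n) ≤ 1 / 1000 * (n ^ 2 / a) := by
    have h3 : 4 * (l / s * (4 * l * n) * n) = 16 * l ^ 2 * (a / s) * (n ^ 2 / a) := by
      field_simp; ring
    have h4 : a / s ≤ 1 := by
      rw [div_le_iff₀ hs]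
      have h5 : s * (s * b) ≤ s * (3 * (1 / 16)) := by gcongr
      linarith only [h5, hab, hs]
    have h5 : 16 * l ^ 2 * (a / s) ≤ 16 * (1 / 1000 * (1 / 1000)) * 1 := by
      have : 0 ≤ a / s := by positivity
      gcongr
    have h6 := mul_le_mul_of_nonneg_right h5 hN0
    linarith only [h3, h6, hN0]
  have hbb : b ^ 2 ≤ 1 / 16 * b := by rw [sq]; gcongr
  have hDy' : Dy ≤ 1 / 8 * (b * Ry ^ 2 + b * Ey) := by
    have := mul_le_mul_of_nonneg_right hbb (add_nonneg (sq_nonneg Ry) hEy)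
    linarith only [this, hDy]
  have hDz' : Dz ≤ 1 / 8 * (b * Rz ^ 2 + b * Ez) := by
    have := mul_le_mul_of_nonneg_right hbb (add_nonneg (sq_nonneg Rz) hEz)
    linarith only [this, hDz]
  -- The factor s² in the bound on the decrease of σ cancels the loss 1/s² of the error bound.
  have hκs : κ * (2 / s ^ 2) ≤ 1 / 500 * b := by
    rw [mul_div_assoc', div_le_iff₀ hs2]; linarith only [hκ]
  have hκs0 : 0 ≤ κ * (2 / s ^ 2) := by positivity
  have hresc : ∀ R E D r : ℝ, 0 ≤ E → D ≤ 1 / 8 * (b * R ^ 2 + b * E) →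
      r ≤ 3 * R ^ 2 + 27 * D + 48 * l ^ 2 * n ^ 2 →
      κ * (2 / s ^ 2) * r ≤ 1 / 500 * b * (7 * R ^ 2 + E) + 1 / 10000 * (n ^ 2 / a) := by
    intro R E D r hE hD hr
    have h3 : r ≤ 7 * R ^ 2 + E + 48 * (1 / 1000000000 * (n ^ 2 / a)) := by
      have h4 : b * R ^ 2 ≤ 1 / 16 * R ^ 2 := by gcongr
      have h5 : b * E ≤ 1 / 16 * E := by gcongr
      linarith only [hr, hD, h4, h5, hl2n, sq_nonneg R, hE]
    have h4 : 0 ≤ 7 * R ^ 2 + E + 48 * (1 / 1000000000 * (n ^ 2 / a)) := by positivity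
    calc _ ≤ κ * (2 / s ^ 2) * (7 * R ^ 2 + E + 48 * (1 / 1000000000 * (n ^ 2 / a))) := by gcongr
      _ ≤ 1 / 500 * b * (7 * R ^ 2 + E + 48 * (1 / 1000000000 * (n ^ 2 / a))) := by gcongr
      _ ≤ _ := by
        have h5 : b * (n ^ 2 / a) ≤ 1 / 16 * (n ^ 2 / a) := by gcongr
        linarith only [h5, hN0]
  have h3 := hresc Ry Ey Dy ry hEy hDy' hry
  have h4 := hresc Rz Ez Dz rz hEz hDz' hrz
  have har : a * r ≤ 3 * (a * ex) + t / 10000 * (Ey + Ez) := by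
    have h5 : a * r ≤ a * (3 * ex + 12 * l ^ 2 * Ey + 3 * l ^ 2 * Ez) := by gcongr
    have h6 : a * l ^ 2 ≤ t / 100000 * (1 / 1000 * (1 / 1000)) := by gcongr
    have h7 := mul_le_mul_of_nonneg_right h6 hEy
    have h8 := mul_le_mul_of_nonneg_right h6 hEz
    have h9 : 0 ≤ t * Ey := by positivity
    have h10 : 0 ≤ t * Ez := by positivity
    linarith only [h5, h7, h8, h9, h10]
  have hbE : b * Ey ≤ t / 100000 * Ey := by gcongr
  have hbE' : b * Ez ≤ t / 100000 * Ez := by gcongr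
  have h5 : 0 ≤ b * Ry ^ 2 := by positivity
  have h6 : 0 ≤ b * Rz ^ 2 := by positivity
  have h7 : 0 ≤ t * Ey := by positivity
  have h8 : 0 ≤ t * Ez := by positivity
  have h9 : 0 ≤ a * ex := by positivity
  linarith only [hA, hJ, har, hln, h1, h2, h3, h4, hbE, hbE', h5, h6, h7, h8, h9, hN0]

end OuterStep

/-! ### Assembly of the outer step: envelopes, value function and change of the penalty weight. -/

section PenaltyStep

variable {dx dy : ℕ} {X : Set (Vec dx)} {Y : Set (Vec dy)} {f g : Vec dx → Vec dy → ℝ}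
  {fx gx : Vec dx → Vec dy → Vec dx} {fy gy : Vec dx → Vec dy → Vec dy}
  {lf L ρ σ σ' Cf α β γ s : ℝ}

theorem norm_sq_residual_move {d : ℕ} {y y' w w' : Vec d} {c : ℝ}
    (h : ‖w' - w‖ ≤ 2 * ‖y' - y‖ + c) :
    ‖y' - w'‖ ^ 2 ≤ 3 * ‖y - w‖ ^ 2 + 27 * ‖y' - y‖ ^ 2 + 3 * c ^ 2 := by
  have e : y' - w' = (y - w) + (y' - y) - (w' - w) := by abel
  have h1 : ‖y' - w'‖ ≤ ‖y - w‖ + 3 * ‖y' - y‖ + c := by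
    have h2 := norm_sub_le ((y - w) + (y' - y)) (w' - w)
    have h3 := norm_add_le (y - w) (y' - y)
    rw [e]; linarith
  have h2 := pow_le_pow_left₀ (norm_nonneg _) h1 2
  linarith [sq_nonneg (‖y - w‖ - 3 * ‖y' - y‖), sq_nonneg (‖y - w‖ - c),
    sq_nonneg (3 * ‖y' - y‖ - c)]

set_option maxHeartbeats 1000000 in
/-- One step of the outer iteration: decrease of the envelope part of the potential. -/
theorem outer_step_estimate (hf : SmoothPair X Y f fx fy lf) (hg : SmoothPair X Y g gx gy L)
    (hX : Convex ℝ X) (hXc : IsClosed X) (hY : Convex ℝ Y) (hρ : 0 < ρ)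
    (hL : ρ * L ≤ 1 / 1000) (hlf : 0 ≤ lf) (hs : 0 < s) (hsρ : ρ * s ≤ 3)
    (hσ' : 0 < σ') (hσσ' : σ' ≤ σ) (hσl : σ * lf ≤ L)
    (hCf : ∀ x ∈ X, ∀ w ∈ Y, |f x w| ≤ Cf) (hγ : 0 < γ) (hγρ : γ ≤ ρ / 16) (hα : 0 < α)
    (hβ : 0 ≤ β) (hβ1 : β ≤ 1 / 16) (hβαγ : ρ * β + α ≤ γ / 100000)
    (hαβ : α ≤ 1 / 100 * ρ ^ 3 * s ^ 2 * β)
    (hκ : (σ - σ') / σ' ≤ 1 / 1000 * ρ ^ 2 * s ^ 2 * β)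
    {x x' xh q : Vec dx} (hx : x ∈ X) (hx' : x' ∈ X) (hxq : x' = proj X (x - α • q))
    {y y' z z' wy wz wys wys' wyt wzs wzs' wzh ty tz tz' : Vec dy} {V : ℝ}
    (hwy : wy ∈ Y) (hwz : wz ∈ Y)
    (hy' : y' = (1 - β) • y + β • wy) (hz' : z' = (1 - β) • z + β • wz)
    (hwys : IsProx Y ρ (fun w => σ * f x w + g x w) y wys)
    (hwyt : IsProx Y ρ (fun w => σ * f x' w + g x' w) y' wyt)
    (hwys' : IsProx Y ρ (fun w => σ' * f x' w + g x' w) y' wys')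
    (hwzs : IsProx Y ρ (g x) z wzs) (hwzh : IsProx Y ρ (g x') z wzh)
    (hwzs' : IsProx Y ρ (g x') z' wzs')
    (hxh : xh = proj X (x - α • (σ • fx x wys + gx x wys - gx x wzs)))
    (hV : ∀ w ∈ Y, V ≤ g x w)
    (hty : ty ∈ Y) (htymin : ∀ w ∈ Y, σ * f x' ty + g x' ty ≤ σ * f x' w + g x' w)
    (hEBy : s * ‖y' - ty‖ ≤ 2 * (ρ⁻¹ * ‖y' - wyt‖))
    (htz : tz ∈ Y) (htzmin : ∀ w ∈ Y, g x' tz ≤ g x' w)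
    (hEBz : s * ‖z - tz‖ ≤ 2 * (ρ⁻¹ * ‖z - wzh‖))
    (htz' : tz' ∈ Y) (htzmin' : ∀ w ∈ Y, g x' tz' ≤ g x' w)
    (hEBz' : s * ‖z' - tz'‖ ≤ 2 * (ρ⁻¹ * ‖z' - wzs'‖)) :
    σ / σ' * (proxObj (fun w => σ' * f x' w + g x' w) ρ y' wys' - proxObj (g x') ρ z' wzs'
        + 4 * (proxObj (g x') ρ z' wzs' - g x' tz'))
      - (proxObj (fun w => σ * f x w + g x w) ρ y wys - proxObj (g x) ρ z wzs
        + 4 * (proxObj (g x) ρ z wzs - V))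
      + α / 16 * ‖α⁻¹ • (x - xh)‖ ^ 2
    ≤ - (β / (4 * ρ) * (‖y - wys‖ ^ 2 + ‖z - wzs‖ ^ 2)) - ‖x' - x‖ ^ 2 / (4 * α)
      + γ / (16 * ρ ^ 2) * (‖wy - wys‖ ^ 2 + ‖wz - wzs‖ ^ 2)
      + 4 * α * ‖q - (σ • fx x wy + gx x wy - gx x wz)‖ ^ 2 + 4 * ((σ - σ') * Cf) := by
  have hσ : 0 < σ := hσ'.trans_le hσσ'
  have hL0 : 0 ≤ L := le_trans (by positivity) hσl
  have hh : SmoothPair X Y (fun x w => σ * f x w + g x w) (fun x w => σ • fx x w + gx x w)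
      (fun x w => σ • fy x w + gy x w) (2 * L) :=
    (hf.smul_add hg hσ.le).mono (by linarith)
  have hCf0 : 0 ≤ Cf := (abs_nonneg _).trans (hCf x hx wy hwy)
  -- Two lower-level solutions at x' are used, tz near z for the value function and tz' near z' for
  -- the rescaling. Only their common value enters the potential.
  have eV : g x' tz' = g x' tz := le_antisymm (htzmin' _ htz) (htzmin _ htz')
  have p1 := hh.prox_value_move hρ hx hx' hwys hwyt
  have p2 := hg.prox_value_move hρ hx hx' hwzs hwzs'
  have p3 := value_move hg hY hρ (by linarith) hL0 hs hsρ hx hx' hwzs hwzh htz hV hEBz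
  have p4 := average_step_descent (ws := wys) hβ hβ1 hy'
  have p5 := average_step_descent (ws := wzs) hβ hβ1 hz'
  have p6 := outer_rescale hρ hs hσ' hσσ' (hCf x' hx') hwyt hwys' hwzs' hty htymin htz' hEBy hEBz'
  have p7 := proj_step_descent hX hXc hα hx hxq hxh
  rw [eV] at p6 ⊢
  have d1 := norm_sq_average_step_le (ws := wys) hβ hy'
  have d2 := norm_sq_average_step_le (ws := wzs) hβ hz'
  have m1 := norm_sq_residual_move (hh.prox_lipschitz hY hρ (by linarith) hx hx' hwys hwyt)
  have m2 := norm_sq_residual_move (hg.prox_lipschitz hY hρ (by linarith) hx hx' hwzs hwzs')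
  -- The direction error splits into the estimator error at (wy, wz) and the tracking errors,
  -- through Lipschitz continuity of the x-gradients.
  have hr : ‖q - (σ • fx x wys + gx x wys - gx x wzs)‖ ^ 2
      ≤ 3 * ‖q - (σ • fx x wy + gx x wy - gx x wz)‖ ^ 2 + 12 * L ^ 2 * ‖wy - wys‖ ^ 2
        + 3 * L ^ 2 * ‖wz - wzs‖ ^ 2 := by
    have e : q - (σ • fx x wys + gx x wys - gx x wzs)
        = (q - (σ • fx x wy + gx x wy - gx x wz))
          + ((σ • fx x wy + gx x wy) - (σ • fx x wys + gx x wys)) - (gx x wz - gx x wzs) := by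
      abel
    have h1 := hh.lip_x_snd hx hwys.1 hwy
    have h2 := hg.lip_x_snd hx hwzs.1 hwz
    have h3 : ‖q - (σ • fx x wys + gx x wys - gx x wzs)‖
        ≤ ‖q - (σ • fx x wy + gx x wy - gx x wz)‖ + 2 * L * ‖wy - wys‖ + L * ‖wz - wzs‖ := by
      rw [e]
      refine (norm_sub_le _ _).trans (add_le_add ((norm_add_le _ _).trans ?_) h2)
      exact add_le_add le_rfl h1
    have h4 := pow_le_pow_left₀ (norm_nonneg _) h3 2
    set A := ‖q - (σ • fx x wy + gx x wy - gx x wz)‖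
    linarith [sq_nonneg (A - 2 * L * ‖wy - wys‖), sq_nonneg (A - L * ‖wz - wzs‖),
      sq_nonneg (2 * L * ‖wy - wys‖ - L * ‖wz - wzs‖)]
  set κ := (σ - σ') / σ' with hκd
  have hκ0 : 0 ≤ κ := div_nonneg (by linarith) hσ'.le
  have hκ1 : κ ≤ 1 := by
    have h1 : (ρ * s) ^ 2 ≤ 3 ^ 2 := pow_le_pow_left₀ (by positivity) hsρ 2
    have h2 : (ρ * s) ^ 2 * β ≤ 3 ^ 2 * (1 / 16) := by gcongr
    linarith
  have hκσ : κ * (2 * (σ * Cf)) ≤ 4 * ((σ - σ') * Cf) := by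
    have e : κ * (2 * (σ * Cf)) = 2 * (1 + κ) * ((σ - σ') * Cf) := by
      rw [hκd]; field_simp; ring
    have : 0 ≤ (σ - σ') * Cf := mul_nonneg (by linarith) hCf0
    rw [e]
    have := mul_le_mul_of_nonneg_right hκ1 this
    linarith only [this]
  set t := γ / ρ with ht
  have ht0 : 0 < t := by positivity
  have hρ2 : 0 < ρ ^ 2 := by positivity
  have key := outer_step_bookkeeping (a := α / ρ) (b := β) (t := t) (l := ρ * L) (s := ρ * s)
    (κ := κ) (n := ‖x' - x‖) (Ry := ‖y - wys‖) (Rz := ‖z - wzs‖) (Ey := ‖wy - wys‖ ^ 2)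
    (Ez := ‖wz - wzs‖ ^ 2) (Dy := ‖y' - y‖ ^ 2) (Dz := ‖z' - z‖ ^ 2) (ry := ‖y' - wyt‖ ^ 2)
    (rz := ‖z' - wzs'‖ ^ 2)
    (r := ρ ^ 2 * ‖q - (σ • fx x wys + gx x wys - gx x wzs)‖ ^ 2)
    (ex := ρ ^ 2 * ‖q - (σ • fx x wy + gx x wy - gx x wz)‖ ^ 2)
    (J := ρ * (inner ℝ (σ • fx x wys + gx x wys - gx x wzs) (x' - x)
      + α / 16 * ‖α⁻¹ • (x - xh)‖ ^ 2))
    (F := ρ * (4 * ((σ - σ') * Cf)))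
    (A := ρ * (σ / σ' * (proxObj (fun w => σ' * f x' w + g x' w) ρ y' wys'
        - proxObj (g x') ρ z' wzs' + 4 * (proxObj (g x') ρ z' wzs' - g x' tz))
      - (proxObj (fun w => σ * f x w + g x w) ρ y wys - proxObj (g x) ρ z wzs
        + 4 * (proxObj (g x) ρ z wzs - V))
      + α / 16 * ‖α⁻¹ • (x - xh)‖ ^ 2))
    (by positivity) hβ hβ1 (by positivity) hsρ ht0 (by rw [ht, div_le_iff₀ hρ]; linarith)
    (by rw [ht, div_div, le_div_iff₀ (by positivity)]; linarith)
    (by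
      rw [ht, div_div, mul_comm ρ, ← div_div]
      exact div_le_div_of_nonneg_right (by linarith only [hβαγ, mul_nonneg hρ.le hβ]) hρ.le)
    (by rw [div_le_iff₀ hρ]; linarith) (by positivity) hL hκ0 (by linarith)
    (by positivity) (by positivity) d1 d2 (by linarith)
    (by linarith [sq_nonneg (ρ * L * ‖x' - x‖)])
    (by
      have := mul_le_mul_of_nonneg_left hr hρ2.le
      linarith)
    (by positivity)
    (by
      have h1 := mul_le_mul_of_nonneg_left p7 hρ.le
      refine h1.trans (le_of_eq ?_)
      field_simp)
    (by
      have e1 : ρ * (ρ⁻¹ * inner ℝ (y - wys) (y' - y) + ρ⁻¹ / 2 * ‖y' - y‖ ^ 2)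
          = inner ℝ (y - wys) (y' - y) + 1 / 2 * ‖y' - y‖ ^ 2 := by field_simp
      have e2 : ρ * (ρ⁻¹ * inner ℝ (z - wzs) (z' - z) + ρ⁻¹ / 2 * ‖z' - z‖ ^ 2)
          = inner ℝ (z - wzs) (z' - z) + 1 / 2 * ‖z' - z‖ ^ 2 := by field_simp
      have e3 : ρ * (L / s * (5 * (ρ⁻¹ * ‖z - wzs‖) + 4 * L * ‖x' - x‖) * ‖x' - x‖)
          = ρ * L / (ρ * s) * (5 * ‖z - wzs‖ + 4 * (ρ * L) * ‖x' - x‖) * ‖x' - x‖ := by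
        field_simp
      have e4 : ∀ r : ℝ, ρ * (2 / (s ^ 2 * ρ ^ 3) * r) = 2 / (ρ * s) ^ 2 * r := by
        intro r; field_simp
      have q1 := mul_le_mul_of_nonneg_left p1 hρ.le
      have q2 := mul_le_mul_of_nonneg_left p2 hρ.le
      have q3 := mul_le_mul_of_nonneg_left p3 hρ.le
      have q6 := mul_le_mul_of_nonneg_left p6 hρ.le
      have q7 := mul_le_mul_of_nonneg_left hκσ hρ.le
      have e5 := congrArg (κ * ·) (e4 (‖y' - wyt‖ ^ 2))
      have e6 := congrArg (κ * ·) (e4 (‖z' - wzs'‖ ^ 2))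
      have h0 : 0 ≤ ρ * L * ‖x' - x‖ ^ 2 := by positivity
      -- The slope in x is ∇_x h(wys) + 3∇_x g(wzs) - 4∇_x g(t), that is, the direction ∇_x h(wys) -
      -- ∇_x g(wzs) plus 4 times the mismatch estimated in p3. The positive coefficient 3 = C - 1
      -- also makes the z-step a descent.
      rw [inner_sub_left]
      linarith only [q1, q2, q3, q6, q7, e1, e2, e3, e5, e6, p4, p5, h0])
  have hfin := mul_le_mul_of_nonneg_left key (inv_pos.2 hρ).le
  refine le_trans (le_of_eq ?_) (hfin.trans (le_of_eq ?_))
  · field_simp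
  · rw [ht]; field_simp

end PenaltyStep

/-! ### Consequences of the assumptions on the problem -/

section BaseStep

variable {dx dy : ℕ} {X : Set (Vec dx)} {Y : Set (Vec dy)} {g : Vec dx → Vec dy → ℝ}
  {gx : Vec dx → Vec dy → Vec dx} {gy : Vec dx → Vec dy → Vec dy} {L ρ σ σ' M α β γ ε : ℝ}

/-- The estimate `inner_step_estimate` for the iteration on the lower-level objective itself. -/
theorem inner_step_estimate_base (hg : SmoothPair X Y g gx gy L)
    (hY : Convex ℝ Y) (hYc : IsClosed Y) (hρ : 0 < ρ) (hL : ρ * L ≤ 1 / 1000) (hL0 : 0 ≤ L)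
    (hσ' : 0 < σ') (hσσ' : σ' ≤ σ) (hγ : 0 < γ) (hγρ : γ ≤ ρ / 16) (hα : 0 < α)
    (hβ : 0 ≤ β) (hβαγ : ρ * β + α ≤ γ / 100000)
    (hκ : (σ - σ') / σ' ≤ γ / ρ / 100000) (hε : 0 ≤ ε) (hε1 : ε ≤ 1 / 100)
    {x x' : Vec dx} (hx : x ∈ X) (hx' : x' ∈ X) {y y' w wp v ws ws' : Vec dy} (hw : w ∈ Y)
    (hwp : wp = proj Y (w - γ • (v + ρ⁻¹ • (w - y)))) (hy' : y' = (1 - β) • y + β • wp)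
    (hws : IsProx Y ρ (g x) y ws) (hws' : IsProx Y ρ (g x') y' ws')
    (hM : ‖gy x' ws' + ρ⁻¹ • (ws' - y')‖ ≤ M) :
    ρ⁻¹ * (σ / σ') * ‖wp - ws'‖ ^ 2
      + ε * (σ / σ' * (proxObj (g x') ρ y' wp - proxObj (g x') ρ y' ws'))
      + γ / (16 * ρ ^ 2) * ‖wp - ws‖ ^ 2
    ≤ ρ⁻¹ * ‖w - ws‖ ^ 2 + ε * (proxObj (g x) ρ y w - proxObj (g x) ρ y ws)
      - ε / (2 * γ) * ‖wp - w‖ ^ 2 + 4 * γ * ‖v - gy x w‖ ^ 2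
      + β / (100 * ρ) * ‖y - ws‖ ^ 2 + ‖x' - x‖ ^ 2 / (100 * α)
      + 289 * ((σ - σ') / σ') ^ 2 * (M ^ 2 * ρ ^ 2) / γ := by
  -- For f = 0 and Cf = 0 the proximal points for σ and σ' coincide. The term with M stays, since
  -- the gap is still multiplied by σ/σ'.
  have h := inner_step_estimate (σ := σ) (σ' := σ') (Cf := 0) (M := M)
    (SmoothPair.zero (X := X) (Y := Y)) hg hY hYc hρ hL
    le_rfl hσ' hσσ' (by simpa using hL0) (by simp) hγ hγρ hα hβ hβαγ hκ hε hε1 hx hx' hw hwp hy'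
    (by simpa using hws) (by simpa using hws') (by simpa using hws') hws' (by simpa using hM) hM
  simpa using h

end BaseStep

namespace Bilevel

variable {dx dy : ℕ} {Z Ξ : Type*} [MeasurableSpace Z] [MeasurableSpace Ξ]
  {B : Bilevel dx dy Z Ξ} {p : ProblemConsts} {ρ σ : ℝ}

theorem hasGradientAt_snd {φ : Joint dx dy → ℝ} {x : Vec dx} {w : Vec dy} {v : Joint dx dy}
    (h : HasGradientAt φ v (pt x w)) : HasGradientAt (fun w => φ (pt x w)) v.snd w := by
  have h1 : HasFDerivAt (fun w : Vec dy => pt x w)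
      (((WithLp.prodContinuousLinearEquiv 2 ℝ (Vec dx) (Vec dy)).symm :
          (Vec dx × Vec dy) →L[ℝ] Joint dx dy).comp (ContinuousLinearMap.inr ℝ (Vec dx) (Vec dy)))
      w := by
    have h2 : HasFDerivAt (fun w : Vec dy => (x, w))
        (ContinuousLinearMap.inr ℝ (Vec dx) (Vec dy)) w := hasFDerivAt_prodMk_right x w
    exact ((WithLp.prodContinuousLinearEquiv 2 ℝ (Vec dx) (Vec dy)).symm :
          (Vec dx × Vec dy) →L[ℝ] Joint dx dy).hasFDerivAt.comp w h2
  have h3 := h.hasFDerivAt.comp w h1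
  rw [hasGradientAt_iff_hasFDerivAt]
  refine h3.congr_fderiv ?_
  ext u
  simp only [ContinuousLinearMap.comp_apply, InnerProductSpace.toDual_apply_apply,
    ContinuousLinearEquiv.coe_coe]
  rw [joint_inner]
  simp

/-- Makes the gradients in `BoundedProxGradients` explicit, in the form used by the inner estimates.
-/
theorem gradient_add_prox_term {φ : Vec dy → ℝ} {v y w : Vec dy} (h : HasGradientAt φ v w) :
    gradient (fun w' => φ w' + 1 / (2 * ρ) * ‖w' - y‖ ^ 2) w = v + ρ⁻¹ • (w - y) := by
  refine HasGradientAt.gradient ?_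
  rw [hasGradientAt_iff_hasFDerivAt, map_add]
  refine h.hasFDerivAt.add ?_
  have h1 : HasFDerivAt (fun w' : Vec dy => w' - y) (ContinuousLinearMap.id ℝ (Vec dy)) w :=
    (hasFDerivAt_id w).sub_const y
  have h2 := (h1.norm_sq).const_mul (1 / (2 * ρ))
  refine h2.congr_fderiv ?_
  ext u
  simp
  ring

theorem hEnv_eq (hρ : 0 < ρ) {x : Vec dx} {y w : Vec dy} (hw : IsProx B.Y ρ (B.h σ x) y w) :
    B.hEnv ρ σ x y = proxObj (B.h σ x) ρ y w := hw.sInf_eq hρ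

theorem gEnv_eq (hρ : 0 < ρ) {x : Vec dx} {y w : Vec dy} (hw : IsProx B.Y ρ (B.gc x) y w) :
    B.gEnv ρ x y = proxObj (B.gc x) ρ y w := hw.sInf_eq hρ

theorem gMin_eq {x : Vec dx} {t : Vec dy} (ht : t ∈ B.Y) (hmin : ∀ w ∈ B.Y, B.gc x t ≤ B.gc x w) :
    B.gMin x = B.gc x t :=
  IsLeast.csInf_eq ⟨⟨t, ht, rfl⟩, by rintro _ ⟨z, hz, rfl⟩; exact hmin z hz⟩

namespace Assumptions

theorem smoothPair_f (hB : B.Assumptions p ρ) : SmoothPair B.X B.Y (fun x w => B.f (pt x w)) B.fx B.fy p.lf1 :=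
  hB.smooth_f.smoothPair hB.lf1_pos.le hB.convex_X hB.convex_Y

theorem smoothPair_g (hB : B.Assumptions p ρ) : SmoothPair B.X B.Y B.gc B.gx B.gy p.lg1 :=
  hB.smooth_g.smoothPair hB.lg1_pos.le hB.convex_X hB.convex_Y

theorem isCompact_Y (hB : B.Assumptions p ρ) : IsCompact B.Y := by
  refine Metric.isCompact_of_isClosed_isBounded hB.closed_Y ?_
  rw [isBounded_iff_forall_norm_le]
  exact ⟨_, hB.bounded_Y⟩

theorem continuousOn_h (hB : B.Assumptions p ρ) {x : Vec dx} (hx : x ∈ B.X) : ContinuousOn (B.h σ x) B.Y := by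
  intro w hw
  have hpt : Continuous fun w : Vec dy => pt x w := by unfold pt; fun_prop
  have h1 := (hB.smooth_f.contDiffAt (pt_mem_jointSet hx hw)).continuousAt
  have h2 := (hB.smooth_g.contDiffAt (pt_mem_jointSet hx hw)).continuousAt
  have h3 : ContinuousAt (fun w => B.f (pt x w)) w := ContinuousAt.comp h1 hpt.continuousAt
  have h4 : ContinuousAt (fun w => B.g (pt x w)) w := ContinuousAt.comp h2 hpt.continuousAt
  exact ((h3.const_mul σ).add h4).continuousWithinAt

theorem continuousOn_gc (hB : B.Assumptions p ρ) {x : Vec dx} (hx : x ∈ B.X) : ContinuousOn (B.gc x) B.Y := by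
  refine (hB.continuousOn_h (σ := 0) hx).congr fun w _ => ?_
  simp [Bilevel.h, gc]

theorem isProx_proxH (hB : B.Assumptions p ρ) (hne : B.Y.Nonempty) {x : Vec dx} (hx : x ∈ B.X) (r σ : ℝ) (y : Vec dy) :
    IsProx B.Y r (B.h σ x) y (B.proxH r σ x y) :=
  isProx_prox (exists_isProx hB.isCompact_Y hne (hB.continuousOn_h hx) r y)

theorem isProx_proxG (hB : B.Assumptions p ρ) (hne : B.Y.Nonempty) {x : Vec dx} (hx : x ∈ B.X) (r : ℝ) (y : Vec dy) :
    IsProx B.Y r (B.gc x) y (B.proxG r x y) :=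
  isProx_prox (exists_isProx hB.isCompact_Y hne (hB.continuousOn_gc hx) r y)

theorem gMin_le (hB : B.Assumptions p ρ) {x : Vec dx} (hx : x ∈ B.X) {w : Vec dy} (hw : w ∈ B.Y) : B.gMin x ≤ B.gc x w :=
  csInf_le (hB.isCompact_Y.image_of_continuousOn (hB.continuousOn_gc hx)).bddBelow ⟨w, hw, rfl⟩

theorem norm_grad_h_le (hB : B.Assumptions p ρ) {x : Vec dx} (hx : x ∈ B.X) (hσ : σ ∈ Set.Icc 0 p.σbar) {y w : Vec dy}
    (hy : y ∈ B.Y) (hw : IsProx B.Y ρ (B.h σ x) y w) :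
    ‖σ • B.fy x w + B.gy x w + ρ⁻¹ • (w - y)‖ ≤ p.Mw := by
  have h := hB.proxGrad.1 x hx σ hσ y hy w hw
  have h1 := hasGradientAt_snd (hB.smooth_f.hasGradientAt (pt_mem_jointSet hx hw.1))
  have h2 := hasGradientAt_snd (hB.smooth_g.hasGradientAt (pt_mem_jointSet hx hw.1))
  have h3 : HasGradientAt (B.h σ x) (σ • B.fy x w + B.gy x w) w := by
    rw [hasGradientAt_iff_hasFDerivAt, map_add, map_smul]
    exact (h1.hasFDerivAt.const_mul σ).add h2.hasFDerivAt
  have h4 := gradient_add_prox_term (ρ := ρ) (y := y) h3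
  have h5 : (fun w' => B.h3 ρ σ x y w') = fun w' => B.h σ x w' + 1 / (2 * ρ) * ‖w' - y‖ ^ 2 := rfl
  rwa [h5, h4] at h

theorem norm_grad_g_le (hB : B.Assumptions p ρ) {x : Vec dx} (hx : x ∈ B.X) {y w : Vec dy}
    (hy : y ∈ B.Y) (hw : IsProx B.Y ρ (B.gc x) y w) :
    ‖B.gy x w + ρ⁻¹ • (w - y)‖ ≤ p.Mw := by
  have h := hB.proxGrad.2 x hx y hy w hw
  have h2 : HasGradientAt (B.gc x) (B.gy x w) w :=
    hasGradientAt_snd (hB.smooth_g.hasGradientAt (pt_mem_jointSet hx hw.1))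
  have h4 := gradient_add_prox_term (ρ := ρ) (y := y) h2
  have h5 : (fun w' => B.g3 ρ x y w') = fun w' => B.gc x w' + 1 / (2 * ρ) * ‖w' - y‖ ^ 2 := rfl
  rwa [h5, h4] at h

/-- The proximal error bound without the locality restriction. -/
theorem exists_minimizer_near (hB : B.Assumptions p ρ) (hne : B.Y.Nonempty) (hρ : 0 < ρ) {x : Vec dx} (hx : x ∈ B.X)
    (hσ : σ ∈ Set.Icc 0 p.σbar) {y w : Vec dy} (hy : y ∈ B.Y)
    (hw : IsProx B.Y ρ (B.h σ x) y w) :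
    ∃ t ∈ B.T x σ, Real.sqrt (min (p.μ ^ 2) (p.δ ^ 2 / p.DY ^ 2)) * ‖y - t‖
      ≤ 2 * (ρ⁻¹ * ‖y - w‖) := by
  have hcont := hB.continuousOn_h (σ := σ) hx
  -- Compactness of the solution set makes the distance in the error bound attained at some t.
  have hclosed : IsCompact (B.T x σ) := by
    obtain ⟨t0, ht0, hmin⟩ := hB.isCompact_Y.exists_isMinOn hne hcont
    have h2 : B.T x σ = B.Y ∩ (B.h σ x) ⁻¹' (Set.Iic (B.h σ x t0)) := by
      ext u
      simp only [T, Set.mem_inter_iff, Set.mem_ofPred_eq, Set.mem_preimage, Set.mem_Iic]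
      exact ⟨fun h => ⟨h.1, h.2 t0 ht0⟩, fun h => ⟨h.1, fun z hz => h.2.trans (hmin hz)⟩⟩
    rw [h2]
    exact hB.isCompact_Y.of_isClosed_subset
      (hcont.preimage_isClosed_of_isClosed hB.closed_Y isClosed_Iic) Set.inter_subset_left
  have hTne : (B.T x σ).Nonempty := by
    obtain ⟨t0, ht0, hmin⟩ := hB.isCompact_Y.exists_isMinOn hne hcont
    exact ⟨t0, ht0, fun z hz => hmin hz⟩
  obtain ⟨t, ht, hdist⟩ := hclosed.exists_infDist_eq_dist hTne y
  refine ⟨t, ht, ?_⟩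
  set m := min (p.μ ^ 2) (p.δ ^ 2 / p.DY ^ 2)
  have hDY := hB.DY_pos
  by_cases hd : ρ⁻¹ * ‖y - w‖ ≤ p.δ
  · have h1 := hB.proximalEB x hx σ hσ y hy w hw hd
    rw [hdist, dist_eq_norm] at h1
    have h2 : Real.sqrt m ≤ p.μ := by
      rw [Real.sqrt_le_left hB.μ_pos.le]; exact min_le_left _ _
    have h3 : Real.sqrt m * ‖y - t‖ ≤ p.μ * ‖y - t‖ := by gcongr
    have h4 : 0 ≤ ρ⁻¹ * ‖y - w‖ := by positivity
    linarith
  -- When the residual exceeds δ, boundedness of Y replaces the error bound: any two of its points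
  -- are at most 2 p.DY apart. This case produces δ/p.DY in the rate and the factor 2.
  · push Not at hd
    have h2 : Real.sqrt m ≤ p.δ / p.DY := by
      rw [Real.sqrt_le_left (div_pos hB.δ_pos hDY).le, div_pow]; exact min_le_right _ _
    have h3 : ‖y - t‖ ≤ 2 * p.DY := by
      have := norm_sub_le y t
      have h5 := hB.bounded_Y y hy
      have h6 := hB.bounded_Y t ht.1
      linarith
    calc Real.sqrt m * ‖y - t‖ ≤ p.δ / p.DY * (2 * p.DY) := by
          have := hB.δ_pos
          gcongr
      _ = 2 * p.δ := by field_simp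
      _ ≤ _ := by linarith

end Assumptions

end Bilevel

/-! ### Pathwise estimates along the algorithm -/

namespace Alg

variable {dx dy : ℕ} {Z Ξ : Type*} [MeasurableSpace Z] [MeasurableSpace Ξ]
  {B : Bilevel dx dy Z Ξ} {p : ProblemConsts} {I : AlgInput dx dy}

/-- The current and the previous points of the state lie in the domains. -/
structure Feasible (B : Bilevel dx dy Z Ξ) (st : AlgState dx dy) : Prop where
  x : st.x ∈ B.X
  y : st.y ∈ B.Y
  z : st.z ∈ B.Y
  wy : st.wy ∈ B.Y
  wz : st.wz ∈ B.Y
  xp : st.xp ∈ B.X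
  wyp : st.wyp ∈ B.Y
  wzp : st.wzp ∈ B.Y

theorem feasible_step (hB : B.Assumptions p I.ρ) (hI : Admissible B p I) (k : ℕ)
    {st : AlgState dx dy} (h : Feasible B st) (s : Seeds Z Ξ) : Feasible B (step B I k st s) := by
  have hwy : nextWy B I k st s ∈ B.Y := proj_mem hB.convex_Y hB.closed_Y ⟨_, h.y⟩ _
  have hwz : nextWz B I k st s ∈ B.Y := proj_mem hB.convex_Y hB.closed_Y ⟨_, h.y⟩ _
  have hβ : 0 ≤ 1 - I.β k := by linarith [hI.β_le k]
  exact
    { x := proj_mem hB.convex_X hB.closed_X ⟨_, h.x⟩ _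
      y := hB.convex_Y h.y hwy hβ (hI.β_pos k).le (by ring)
      z := hB.convex_Y h.z hwz hβ (hI.β_pos k).le (by ring)
      wy := hwy
      wz := hwz
      xp := h.x
      wyp := h.wy
      wzp := h.wz }

theorem feasible_state (hB : B.Assumptions p I.ρ) (hI : Admissible B p I) (s : ℕ → Seeds Z Ξ)
    (k : ℕ) : Feasible B (state B I s k) := by
  induction k with
  | zero => exact ⟨hI.x₀_mem, hI.y₀_mem, hI.z₀_mem, hI.y₀_mem, hI.z₀_mem, hI.x₀_mem, hI.y₀_mem,
      hI.z₀_mem⟩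
  | succ k ih => exact feasible_step hB hI k ih (s k)

/-- The conditions on the step sizes, for the constants chosen in the proof. -/
abbrev Conditions (p : ProblemConsts) (I : AlgInput dx dy) : Prop :=
  StepConditions p I 1 (1 / 1000) (1 / 16) (1 / 16) 1 (1 / 100) (1 / 1000) (1 / 100000) 100 (1 / 4)

/-- The weight of the optimality gaps of the proximal subproblems. -/
noncomputable def gapWeight (p : ProblemConsts) (I : AlgInput dx dy) : ℝ := 1000 * (I.ρ ^ 2 * p.lg1 ^ 2)

/-- The optimality gap of the proximal subproblem for `y`. -/
noncomputable def gapY (B : Bilevel dx dy Z Ξ) (I : AlgInput dx dy) (s : ℕ → Seeds Z Ξ) (k : ℕ) : ℝ :=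
  B.h3 I.ρ (I.σ k) (state B I s k).x (state B I s k).y (state B I s k).wy
    - B.hEnv I.ρ (I.σ k) (state B I s k).x (state B I s k).y

/-- The optimality gap of the proximal subproblem for `z`. -/
noncomputable def gapZ (B : Bilevel dx dy Z Ξ) (I : AlgInput dx dy) (s : ℕ → Seeds Z Ξ) (k : ℕ) : ℝ :=
  B.g3 I.ρ (state B I s k).x (state B I s k).z (state B I s k).wz
    - B.gEnv I.ρ (state B I s k).x (state B I s k).z

/-- The noise-free part of the potential. -/
noncomputable def basePotential (B : Bilevel dx dy Z Ξ) (I : AlgInput dx dy) (s : ℕ → Seeds Z Ξ) (k : ℕ) : ℝ :=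
  B.Phi 4 I.ρ (I.σ k) (state B I s k).x (state B I s k).y (state B I s k).z
  + 1 / (I.σ k * I.ρ) *
      (‖(state B I s k).wy - wyStar B I s k‖ ^ 2 + ‖(state B I s k).wz - wzStar B I s k‖ ^ 2)

/-- The optimality gaps of both proximal subproblems, relative to the penalty weight. -/
noncomputable def gapPotential (B : Bilevel dx dy Z Ξ) (I : AlgInput dx dy) (s : ℕ → Seeds Z Ξ) (k : ℕ) : ℝ :=
  (gapY B I s k + gapZ B I s k) / I.σ k

/-- The `k`-th summand of `residual`. -/
noncomputable def residualTerm (B : Bilevel dx dy Z Ξ) (I : AlgInput dx dy) (s : ℕ → Seeds Z Ξ) (k : ℕ) : ℝ :=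
  I.α k / (16 * I.σ k) * ‖deltaX B I s k‖ ^ 2
      + I.β k / (16 * I.σ k * I.ρ) *
        (‖(state B I s k).y - wyStar B I s k‖ ^ 2 + ‖(state B I s k).z - wzStar B I s k‖ ^ 2)

/-- The squared displacement of `x` in iteration `k`. -/
noncomputable def moveX (B : Bilevel dx dy Z Ξ) (I : AlgInput dx dy) (s : ℕ → Seeds Z Ξ) (k : ℕ) : ℝ :=
  ‖(state B I s (k + 1)).x - (state B I s k).x‖ ^ 2

/-- The squared displacement of `(w_y, w_z)` in iteration `k`. -/
noncomputable def moveW (B : Bilevel dx dy Z Ξ) (I : AlgInput dx dy) (s : ℕ → Seeds Z Ξ) (k : ℕ) : ℝ :=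
  ‖(state B I s (k + 1)).wy - (state B I s k).wy‖ ^ 2
    + ‖(state B I s (k + 1)).wz - (state B I s k).wz‖ ^ 2

theorem wyStar_spec (hB : B.Assumptions p I.ρ) (hI : Admissible B p I) (s : ℕ → Seeds Z Ξ)
    (k : ℕ) : IsProx B.Y I.ρ (B.h (I.σ k) (state B I s k).x) (state B I s k).y
      (wyStar B I s k) :=
  hB.isProx_proxH ⟨_, hI.y₀_mem⟩ (feasible_state hB hI s k).x _ _ _

theorem wzStar_spec (hB : B.Assumptions p I.ρ) (hI : Admissible B p I) (s : ℕ → Seeds Z Ξ)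
    (k : ℕ) : IsProx B.Y I.ρ (B.gc (state B I s k).x) (state B I s k).z (wzStar B I s k) :=
  hB.isProx_proxG ⟨_, hI.y₀_mem⟩ (feasible_state hB hI s k).x _ _

theorem gapY_eq (hB : B.Assumptions p I.ρ) (hI : Admissible B p I) (s : ℕ → Seeds Z Ξ) (k : ℕ) :
    gapY B I s k
      = proxObj (B.h (I.σ k) (state B I s k).x) I.ρ (state B I s k).y (state B I s k).wy
        - proxObj (B.h (I.σ k) (state B I s k).x) I.ρ (state B I s k).y (wyStar B I s k) := by
  rw [gapY, Bilevel.hEnv_eq hI.ρ_pos (wyStar_spec hB hI s k)]; rfl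

theorem gapZ_eq (hB : B.Assumptions p I.ρ) (hI : Admissible B p I) (s : ℕ → Seeds Z Ξ) (k : ℕ) :
    gapZ B I s k
      = proxObj (B.gc (state B I s k).x) I.ρ (state B I s k).z (state B I s k).wz
        - proxObj (B.gc (state B I s k).x) I.ρ (state B I s k).z (wzStar B I s k) := by
  rw [gapZ, Bilevel.gEnv_eq hI.ρ_pos (wzStar_spec hB hI s k)]; rfl

/-- The feasible points w_y and w_z are trial points in the minima defining the envelopes. This sign
lets the gap be discarded at the final time. -/
theorem gapPotential_nonneg (hB : B.Assumptions p I.ρ) (hI : Admissible B p I)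
    (s : ℕ → Seeds Z Ξ) (k : ℕ) : 0 ≤ gapPotential B I s k := by
  refine div_nonneg (add_nonneg ?_ ?_) (hI.σ_pos k).le
  · rw [gapY_eq hB hI]
    exact sub_nonneg.2 ((wyStar_spec hB hI s k).obj_le hI.ρ_pos (feasible_state hB hI s k).wy)
  · rw [gapZ_eq hB hI]
    exact sub_nonneg.2 ((wzStar_spec hB hI s k).obj_le hI.ρ_pos (feasible_state hB hI s k).wz)

/-! #### Consequences of the step-size conditions -/

theorem rho_lg1_le (hB : B.Assumptions p I.ρ) (hc : Conditions p I) :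
    I.ρ * p.lg1 ≤ 1 / 1000 := by
  have := hc.cond_ρ
  rw [lt_div_iff₀ hB.lg1_pos] at this
  exact this.le

theorem sigma_lf1_le (hB : B.Assumptions p I.ρ) (hc : Conditions p I) (k : ℕ) :
    I.σ k * p.lf1 ≤ p.lg1 := by
  have := hc.cond_σ k
  rw [lt_div_iff₀ hB.lf1_pos, one_mul] at this
  exact this.le

theorem gapWeight_nonneg : 0 ≤ gapWeight p I := by unfold gapWeight; positivity

theorem gapWeight_le (hB : B.Assumptions p I.ρ) (hI : Admissible B p I) (hc : Conditions p I) :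
    gapWeight p I ≤ 1 / 100 := by
  have h := rho_lg1_le hB hc
  have h0 : 0 ≤ I.ρ * p.lg1 := mul_nonneg hI.ρ_pos.le hB.lg1_pos.le
  have h1 : (I.ρ * p.lg1) * (I.ρ * p.lg1) ≤ 1 / 1000 * (1 / 1000) := by gcongr
  unfold gapWeight
  linarith only [h1]

/-- The square root of `min (μ²) (δ² / D_Y²)`. -/
noncomputable def ebRate (p : ProblemConsts) : ℝ := Real.sqrt (min (p.μ ^ 2) (p.δ ^ 2 / p.DY ^ 2))

theorem ebRate_pos (hB : B.Assumptions p I.ρ) : 0 < ebRate p := by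
  have h1 := hB.μ_pos
  have h2 := hB.δ_pos
  have h3 := hB.DY_pos
  exact Real.sqrt_pos.2 (lt_min (by positivity) (by positivity))

theorem ebRate_sq : ebRate p ^ 2 = min (p.μ ^ 2) (p.δ ^ 2 / p.DY ^ 2) :=
  Real.sq_sqrt (le_min (by positivity) (by positivity))

theorem rho_ebRate_le (hB : B.Assumptions p I.ρ) (hI : Admissible B p I) :
    I.ρ * ebRate p ≤ 3 := by
  have h : ebRate p ≤ p.μ := by
    rw [ebRate, Real.sqrt_le_left hB.μ_pos.le]; exact min_le_left _ _
  exact (mul_le_mul_of_nonneg_left h hI.ρ_pos.le).trans hI.ρμ_le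

/-- The factor 9 is the bound (ρ · `ebRate p`)² ≤ 3², where the admissibility condition ρμ ≤ 3
enters. -/
theorem sigma_drop_le (hB : B.Assumptions p I.ρ) (hI : Admissible B p I) (hc : Conditions p I)
    (k : ℕ) : (I.σ k - I.σ (k + 1)) / I.σ (k + 1) ≤ 9 / 1000 * I.β k := by
  have h1 := hc.cond_σβ k
  rw [← ebRate_sq] at h1
  have h2 : (I.ρ * ebRate p) ^ 2 ≤ 3 ^ 2 :=
    pow_le_pow_left₀ (mul_nonneg hI.ρ_pos.le (ebRate_pos hB).le) (rho_ebRate_le hB hI) 2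
  have h3 := mul_le_mul_of_nonneg_right h2 (hI.β_pos k).le
  linarith only [h1, h3]

theorem beta_le (hI : Admissible B p I) (hc : Conditions p I) (k : ℕ) :
    I.β k ≤ I.γ k / I.ρ / 100000 := by
  have h1 := hc.cond_βαγ k
  have h2 := hI.α_pos k
  rw [div_div, le_div_iff₀ (mul_pos hI.ρ_pos (by norm_num))]
  linarith

end Alg

/-! ### One-step estimates for the iterates of the algorithm. -/

namespace Alg

variable {dx dy : ℕ} {Z Ξ : Type*} [MeasurableSpace Z] [MeasurableSpace Ξ]
  {B : Bilevel dx dy Z Ξ} {p : ProblemConsts} {I : AlgInput dx dy}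

/-- The error bound for g alone is the case σ = 0 of the one for h_σ. -/
theorem h_zero (x : Vec dx) : B.h 0 x = B.gc x := by
  funext w; simp [Bilevel.h, Bilevel.gc]

/-- An instance of `inner_step_estimate`: the update rules hold by definition, and β ≪ γ/ρ makes the
decrease of σ slow compared with the contraction. The same holds for z, with
`inner_step_estimate_base`. -/
theorem inner_step_y (hB : B.Assumptions p I.ρ) (hI : Admissible B p I) (hc : Conditions p I)
    (s : ℕ → Seeds Z Ξ) (k : ℕ) :
    I.ρ⁻¹ * (I.σ k / I.σ (k + 1)) * ‖(state B I s (k + 1)).wy - wyStar B I s (k + 1)‖ ^ 2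
      + gapWeight p I * (I.σ k / I.σ (k + 1) * gapY B I s (k + 1))
      + I.γ k / (16 * I.ρ ^ 2) * ‖(state B I s (k + 1)).wy - wyStar B I s k‖ ^ 2
    ≤ I.ρ⁻¹ * ‖(state B I s k).wy - wyStar B I s k‖ ^ 2 + gapWeight p I * gapY B I s k
      - gapWeight p I / (2 * I.γ k) * ‖(state B I s (k + 1)).wy - (state B I s k).wy‖ ^ 2
      + 4 * I.γ k * ‖errWy B I s k‖ ^ 2
      + I.β k / (100 * I.ρ) * ‖(state B I s k).y - wyStar B I s k‖ ^ 2
      + moveX B I s k / (100 * I.α k)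
      + 289 * ((I.σ k - I.σ (k + 1)) / I.σ (k + 1)) ^ 2 * (p.Mw ^ 2 * I.ρ ^ 2) / I.γ k
      + 2 * ((I.σ k - I.σ (k + 1)) * p.Cf) := by
  have hF := feasible_state hB hI s k
  have hF' := feasible_state hB hI s (k + 1)
  have hne : B.Y.Nonempty := ⟨_, hI.y₀_mem⟩
  have hρ := hI.ρ_pos
  have hw' := wyStar_spec hB hI s (k + 1)
  have hw₀ := hB.isProx_proxG hne hF'.x I.ρ (state B I s (k + 1)).y
  have hκ : (I.σ k - I.σ (k + 1)) / I.σ (k + 1) ≤ I.γ k / I.ρ / 100000 := by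
    have h1 := sigma_drop_le hB hI hc k
    have h2 := beta_le hI hc k
    have h3 := hI.β_pos k
    linarith
  rw [gapY_eq hB hI, gapY_eq hB hI]
  exact inner_step_estimate (f := fun x w => B.f (pt x w)) (g := B.gc) hB.smoothPair_f
    hB.smoothPair_g hB.convex_Y hB.closed_Y hρ (rho_lg1_le hB hc) hB.lf1_pos.le (hI.σ_pos _)
    (hI.σ_anti (Nat.le_succ k)) (sigma_lf1_le hB hc k) hB.bounded_f (hI.γ_pos k)
    (by have := hc.cond_γ k; linarith) (hI.α_pos k) (hI.β_pos k).le
    (by have := hc.cond_βαγ k; linarith) hκ gapWeight_nonneg (gapWeight_le hB hI hc) hF.x hF'.x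
    (v := I.σ k • estFwy B I k (state B I s k) (s k) + estGwy B I k (state B I s k) (s k))
    hF.wy rfl rfl (wyStar_spec hB hI s k)
    (hB.isProx_proxH hne hF'.x I.ρ (I.σ k) (state B I s (k + 1)).y) hw' hw₀
    (hB.norm_grad_h_le hF'.x ⟨(hI.σ_pos _).le, hI.σ_le _⟩ hF'.y hw')
    (hB.norm_grad_g_le hF'.x hF'.y hw₀)

theorem inner_step_z (hB : B.Assumptions p I.ρ) (hI : Admissible B p I) (hc : Conditions p I)
    (s : ℕ → Seeds Z Ξ) (k : ℕ) :
    I.ρ⁻¹ * (I.σ k / I.σ (k + 1)) * ‖(state B I s (k + 1)).wz - wzStar B I s (k + 1)‖ ^ 2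
      + gapWeight p I * (I.σ k / I.σ (k + 1) * gapZ B I s (k + 1))
      + I.γ k / (16 * I.ρ ^ 2) * ‖(state B I s (k + 1)).wz - wzStar B I s k‖ ^ 2
    ≤ I.ρ⁻¹ * ‖(state B I s k).wz - wzStar B I s k‖ ^ 2 + gapWeight p I * gapZ B I s k
      - gapWeight p I / (2 * I.γ k) * ‖(state B I s (k + 1)).wz - (state B I s k).wz‖ ^ 2
      + 4 * I.γ k * ‖errWz B I s k‖ ^ 2
      + I.β k / (100 * I.ρ) * ‖(state B I s k).z - wzStar B I s k‖ ^ 2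
      + moveX B I s k / (100 * I.α k)
      + 289 * ((I.σ k - I.σ (k + 1)) / I.σ (k + 1)) ^ 2 * (p.Mw ^ 2 * I.ρ ^ 2) / I.γ k := by
  have hF := feasible_state hB hI s k
  have hF' := feasible_state hB hI s (k + 1)
  have hρ := hI.ρ_pos
  have hw' := wzStar_spec hB hI s (k + 1)
  have hκ : (I.σ k - I.σ (k + 1)) / I.σ (k + 1) ≤ I.γ k / I.ρ / 100000 := by
    have h1 := sigma_drop_le hB hI hc k
    have h2 := beta_le hI hc k
    have h3 := hI.β_pos k
    linarith
  rw [gapZ_eq hB hI, gapZ_eq hB hI]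
  exact inner_step_estimate_base hB.smoothPair_g hB.convex_Y hB.closed_Y hρ (rho_lg1_le hB hc)
    hB.lg1_pos.le (hI.σ_pos _) (hI.σ_anti (Nat.le_succ k)) (hI.γ_pos k)
    (by have := hc.cond_γ k; linarith) (hI.α_pos k) (hI.β_pos k).le
    (by have := hc.cond_βαγ k; linarith) hκ gapWeight_nonneg (gapWeight_le hB hI hc) hF.x hF'.x
    (v := estGwz B I k (state B I s k) (s k))
    hF.wz rfl rfl (wzStar_spec hB hI s k) hw' (hB.norm_grad_g_le hF'.x hF'.z hw')

theorem outer_step (hB : B.Assumptions p I.ρ) (hI : Admissible B p I) (hc : Conditions p I)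
    (s : ℕ → Seeds Z Ξ) (k : ℕ) :
    I.σ k * B.Phi 4 I.ρ (I.σ (k + 1)) (state B I s (k + 1)).x (state B I s (k + 1)).y
          (state B I s (k + 1)).z
      - I.σ k * B.Phi 4 I.ρ (I.σ k) (state B I s k).x (state B I s k).y (state B I s k).z
      + I.α k / 16 * ‖deltaX B I s k‖ ^ 2
    ≤ - (I.β k / (4 * I.ρ) * (‖(state B I s k).y - wyStar B I s k‖ ^ 2
          + ‖(state B I s k).z - wzStar B I s k‖ ^ 2)) - moveX B I s k / (4 * I.α k)
      + I.γ k / (16 * I.ρ ^ 2) * (‖(state B I s (k + 1)).wy - wyStar B I s k‖ ^ 2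
          + ‖(state B I s (k + 1)).wz - wzStar B I s k‖ ^ 2)
      + 4 * I.α k * ‖errX B I s k‖ ^ 2 + 4 * ((I.σ k - I.σ (k + 1)) * p.Cf) := by
  have hF := feasible_state hB hI s k
  have hF' := feasible_state hB hI s (k + 1)
  have hne : B.Y.Nonempty := ⟨_, hI.y₀_mem⟩
  have hρ := hI.ρ_pos
  have hσ := hI.σ_pos k
  have hσ' := hI.σ_pos (k + 1)
  have hwt := hB.isProx_proxH hne hF'.x I.ρ (I.σ k) (state B I s (k + 1)).y
  have hwzh := hB.isProx_proxG hne hF'.x I.ρ (state B I s k).z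
  have hw := wyStar_spec hB hI s k
  have hw' := wyStar_spec hB hI s (k + 1)
  have hwz := wzStar_spec hB hI s k
  have hwz' := wzStar_spec hB hI s (k + 1)
  -- The error bound is used at x_{k+1} three times: for h_{σ_k} at y_{k+1}, and for g at both z_k
  -- and z_{k+1}.
  obtain ⟨ty, hty, hEBy⟩ := hB.exists_minimizer_near hne hρ hF'.x ⟨hσ.le, hI.σ_le k⟩ hF'.y hwt
  obtain ⟨tz, htz, hEBz⟩ := hB.exists_minimizer_near (σ := 0) hne hρ hF'.x
    ⟨le_rfl, hB.σbar_pos.le⟩ hF.z (by rw [h_zero]; exact hwzh)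
  obtain ⟨tz', htz', hEBz'⟩ := hB.exists_minimizer_near (σ := 0) hne hρ hF'.x
    ⟨le_rfl, hB.σbar_pos.le⟩ hF'.z (by rw [h_zero]; exact hwz')
  simp only [Bilevel.T, Set.mem_ofPred_eq, h_zero] at htz htz'
  have key := outer_step_estimate (f := fun x w => B.f (pt x w)) (g := B.gc) (s := ebRate p)
    (V := B.gMin (state B I s k).x) hB.smoothPair_f hB.smoothPair_g hB.convex_X hB.closed_X
    hB.convex_Y hρ (rho_lg1_le hB hc) hB.lf1_pos.le (ebRate_pos hB) (rho_ebRate_le hB hI) hσ'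
    (hI.σ_anti (Nat.le_succ k)) (sigma_lf1_le hB hc k) hB.bounded_f (hI.γ_pos k)
    (by have := hc.cond_γ k; linarith) (hI.α_pos k) (hI.β_pos k).le (hc.cond_β k)
    (by have := hc.cond_βαγ k; linarith) (by rw [ebRate_sq]; exact hc.cond_αβ k)
    (by rw [ebRate_sq]; exact hc.cond_σβ k) hF.x hF'.x
    (q := I.σ k • estFx B I k (state B I s k) (s k) + estGxy B I k (state B I s k) (s k)
      - estGxz B I k (state B I s k) (s k)) rfl hF'.wy hF'.wz rfl rfl hw hwt hw' hwz hwzh hwz'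
    (xh := xHat B I s k) rfl (fun w hw => hB.gMin_le hF.x hw) hty.1 hty.2 hEBy htz.1 htz.2 hEBz
    htz'.1 htz'.2 hEBz'
  have eΦ : ∀ (a b v : ℝ), I.σ k * ((a - b) / I.σ k + 4 / I.σ k * (b - v))
      = a - b + 4 * (b - v) := by intro a b v; field_simp
  have eΦ' : ∀ (a b v : ℝ), I.σ k * ((a - b) / I.σ (k + 1) + 4 / I.σ (k + 1) * (b - v))
      = I.σ k / I.σ (k + 1) * (a - b + 4 * (b - v)) := by intro a b v; field_simp
  rw [Bilevel.Phi, Bilevel.Phi, eΦ, eΦ', Bilevel.hEnv_eq hρ hw, Bilevel.hEnv_eq hρ hw',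
    Bilevel.gEnv_eq hρ hwz, Bilevel.gEnv_eq hρ hwz', Bilevel.gMin_eq htz'.1 htz'.2]
  have e : errX B I s k = I.σ k • estFx B I k (state B I s k) (s k)
      + estGxy B I k (state B I s k) (s k) - estGxz B I k (state B I s k) (s k)
      - (I.σ k • B.fx (state B I s k).x (state B I s (k + 1)).wy
        + B.gx (state B I s k).x (state B I s (k + 1)).wy
        - B.gx (state B I s k).x (state B I s (k + 1)).wz) := by
    unfold errX; congr 1; exact (add_sub_assoc _ _ _).symm
  rw [e]
  exact key

/-- Decrease of the noise-free potential along one iteration. -/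
theorem potential_step (hB : B.Assumptions p I.ρ) (hI : Admissible B p I) (hc : Conditions p I)
    (s : ℕ → Seeds Z Ξ) (k : ℕ) :
    basePotential B I s (k + 1) + gapWeight p I * gapPotential B I s (k + 1)
      + residualTerm B I s k + moveX B I s k / (5 * (I.σ k * I.α k))
      + gapWeight p I / (2 * (I.σ k * I.γ k)) * moveW B I s k
    ≤ basePotential B I s k + gapWeight p I * gapPotential B I s k
      + 4 * I.γ k / I.σ k * (‖errWy B I s k‖ ^ 2 + ‖errWz B I s k‖ ^ 2)
      + 4 * I.α k / I.σ k * ‖errX B I s k‖ ^ 2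
      + 8 * ((I.σ k - I.σ (k + 1)) / I.σ k * p.Cf)
      + 578 * (p.Mw ^ 2 * I.ρ ^ 2 / (I.σ k * I.γ k)
          * ((I.σ k - I.σ (k + 1)) / I.σ (k + 1)) ^ 2) := by
  have h1 := inner_step_y hB hI hc s k
  have h2 := inner_step_z hB hI hc s k
  have h3 := outer_step hB hI hc s k
  have hρ := hI.ρ_pos
  have hσ := hI.σ_pos k
  have hσ' := hI.σ_pos (k + 1)
  have hγ := hI.γ_pos k
  have hα := hI.α_pos k
  have hβ := hI.β_pos k
  have hCf : 0 ≤ p.Cf := (abs_nonneg _).trans (hB.bounded_f _ hI.x₀_mem _ hI.y₀_mem)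
  have hd : 0 ≤ (I.σ k - I.σ (k + 1)) * p.Cf :=
    mul_nonneg (sub_nonneg.2 (hI.σ_anti (Nat.le_succ k))) hCf
  have hmx : 0 ≤ moveX B I s k := sq_nonneg _
  -- Multiplication by σ_k turns all quotients by σ_{k+1} into the ratio σ_k/σ_{k+1} of the one-step
  -- estimates.
  refine le_of_mul_le_mul_left ?_ hσ
  unfold basePotential gapPotential residualTerm moveW
  set Φ' := B.Phi 4 I.ρ (I.σ (k + 1)) (state B I s (k + 1)).x (state B I s (k + 1)).y
          (state B I s (k + 1)).z
  set Φ := B.Phi 4 I.ρ (I.σ k) (state B I s k).x (state B I s k).y (state B I s k).z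
  set Ey' := ‖(state B I s (k + 1)).wy - wyStar B I s (k + 1)‖ ^ 2
  set Ez' := ‖(state B I s (k + 1)).wz - wzStar B I s (k + 1)‖ ^ 2
  set Ey := ‖(state B I s k).wy - wyStar B I s k‖ ^ 2
  set Ez := ‖(state B I s k).wz - wzStar B I s k‖ ^ 2
  set Ry := ‖(state B I s k).y - wyStar B I s k‖ ^ 2 with hRy
  set Rz := ‖(state B I s k).z - wzStar B I s k‖ ^ 2 with hRz
  set uy' := gapY B I s (k + 1)
  set uz' := gapZ B I s (k + 1)
  set uy := gapY B I s k
  set uz := gapZ B I s k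
  set ε := gapWeight p I
  set m := moveX B I s k
  set Wy := ‖(state B I s (k + 1)).wy - (state B I s k).wy‖ ^ 2
  set Wz := ‖(state B I s (k + 1)).wz - (state B I s k).wz‖ ^ 2
  set κ := (I.σ k - I.σ (k + 1)) / I.σ (k + 1)
  have e1 : I.σ k * (1 / (I.σ (k + 1) * I.ρ) * (Ey' + Ez'))
      = I.ρ⁻¹ * (I.σ k / I.σ (k + 1)) * Ey' + I.ρ⁻¹ * (I.σ k / I.σ (k + 1)) * Ez' := by
    field_simp
  have e2 : I.σ k * (ε * ((uy' + uz') / I.σ (k + 1)))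
      = ε * (I.σ k / I.σ (k + 1) * uy') + ε * (I.σ k / I.σ (k + 1) * uz') := by
    field_simp
  have e3 : I.σ k * (1 / (I.σ k * I.ρ) * (Ey + Ez)) = I.ρ⁻¹ * Ey + I.ρ⁻¹ * Ez := by
    field_simp
  have e4 : I.σ k * (ε * ((uy + uz) / I.σ k)) = ε * uy + ε * uz := by field_simp
  have e5 : I.σ k * (I.α k / (16 * I.σ k) * ‖deltaX B I s k‖ ^ 2)
      = I.α k / 16 * ‖deltaX B I s k‖ ^ 2 := by field_simp
  have e6 : I.σ k * (I.β k / (16 * I.σ k * I.ρ) * (Ry + Rz))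
      = 1 / 16 * (I.β k / I.ρ * (Ry + Rz)) := by field_simp
  have e7 : I.σ k * (m / (5 * (I.σ k * I.α k))) = 1 / 5 * (m / I.α k) := by field_simp
  have e8 : I.σ k * (ε / (2 * (I.σ k * I.γ k)) * (Wy + Wz))
      = ε / (2 * I.γ k) * Wy + ε / (2 * I.γ k) * Wz := by field_simp
  have e9 : ∀ a b : ℝ, I.σ k * (4 * a / I.σ k * b) = 4 * a * b := by intro a b; field_simp
  have e10 : I.σ k * (8 * ((I.σ k - I.σ (k + 1)) / I.σ k * p.Cf))
      = 8 * ((I.σ k - I.σ (k + 1)) * p.Cf) := by field_simp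
  have e11 : I.σ k * (578 * (p.Mw ^ 2 * I.ρ ^ 2 / (I.σ k * I.γ k) * κ ^ 2))
      = 289 * κ ^ 2 * (p.Mw ^ 2 * I.ρ ^ 2) / I.γ k
        + 289 * κ ^ 2 * (p.Mw ^ 2 * I.ρ ^ 2) / I.γ k := by field_simp; ring
  have e12 : I.β k / (4 * I.ρ) * (Ry + Rz) = 1 / 4 * (I.β k / I.ρ * (Ry + Rz)) := by
    field_simp
  have e13 : I.β k / (100 * I.ρ) * Ry + I.β k / (100 * I.ρ) * Rz
      = 1 / 100 * (I.β k / I.ρ * (Ry + Rz)) := by field_simp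
  have e14 : m / (4 * I.α k) = 1 / 4 * (m / I.α k) := by field_simp
  have e15 : m / (100 * I.α k) = 1 / 100 * (m / I.α k) := by field_simp
  have hR : 0 ≤ I.β k / I.ρ * (Ry + Rz) := by positivity
  have hm : 0 ≤ m / I.α k := by positivity
  simp only [mul_add (I.σ k), e1, e2, e3, e4, e5, e6, e7, e8, e9, e10, e11]
  rw [e12, e14] at h3
  rw [e15] at h1 h2
  -- The tracking terms γ/(16ρ²) cancel between inner and outer estimates. The gain β/(4ρ) minus
  -- β/(100ρ) leaves more than β/(16ρ), and 1/4 minus two times 1/100 leaves 1/5 for the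
  -- displacement of x.
  linarith only [h1, h2, h3, e13, hR, hm, hd]

end Alg

/-! ### Noise of the stochastic oracles -/

theorem integrable_inner_of_memLp {Ω E : Type*} [MeasurableSpace Ω] {P : Measure Ω}
    [NormedAddCommGroup E] [InnerProductSpace ℝ E] {u v : Ω → E} (hu : MemLp u 2 P)
    (hv : MemLp v 2 P) : Integrable (fun ω => inner ℝ (u ω) (v ω)) P :=
  (hu.norm.integrable_mul hv.norm).mono' (hu.1.inner hv.1)
    (Filter.Eventually.of_forall fun _ => norm_inner_le_norm _ _)

section Fubini

variable {Ω 𝒯 𝒱 : Type*} [MeasurableSpace Ω] [MeasurableSpace 𝒯] [MeasurableSpace 𝒱]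
  {P : Measure Ω} {κ : Measure 𝒯} {ν : Measure 𝒱}
  [IsProbabilityMeasure κ] [IsProbabilityMeasure ν]
  {T : Ω → 𝒯} {V : Ω → 𝒱} {d : ℕ} {n : 𝒯 → 𝒱 → Vec d} {b : 𝒯 → ℝ}

/-- Fubini in place of conditioning: a second-moment bound for almost every frozen value of T
integrates to a global one. -/
theorem memLp_two_of_fiber_bound (hTV : MeasurePreserving (fun ω => (T ω, V ω)) P (κ.prod ν))
    (hn : Measurable fun q : 𝒯 × 𝒱 => n q.1 q.2) (hb : Integrable b κ)
    (hint : ∀ᵐ t ∂κ, Integrable (fun v => ‖n t v‖ ^ 2) ν)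
    (hle : ∀ᵐ t ∂κ, ∫ v, ‖n t v‖ ^ 2 ∂ν ≤ b t) :
    MemLp (fun ω => n (T ω) (V ω)) 2 P ∧ ∫ ω, ‖n (T ω) (V ω)‖ ^ 2 ∂P ≤ ∫ t, b t ∂κ := by
  have hm : AEStronglyMeasurable (fun q : 𝒯 × 𝒱 => ‖n q.1 q.2‖ ^ 2) (κ.prod ν) :=
    (hn.norm.pow_const 2).aestronglyMeasurable
  have hI : Integrable (fun q : 𝒯 × 𝒱 => ‖n q.1 q.2‖ ^ 2) (κ.prod ν) := by
    rw [integrable_prod_iff hm]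
    refine ⟨hint, hb.mono' hm.norm.integral_prod_right' ?_⟩
    filter_upwards [hle] with t ht
    rw [Real.norm_of_nonneg (integral_nonneg fun _ => norm_nonneg _)]
    simpa using ht
  have hI' : Integrable (fun ω => ‖n (T ω) (V ω)‖ ^ 2) P :=
    hTV.integrable_comp_of_integrable hI
  have hnm : Measurable fun ω => n (T ω) (V ω) := hn.comp hTV.measurable
  refine ⟨(memLp_two_iff_integrable_sq_norm hnm.aestronglyMeasurable).2 hI', ?_⟩
  have e : ∫ ω, ‖n (T ω) (V ω)‖ ^ 2 ∂P = ∫ q, ‖n q.1 q.2‖ ^ 2 ∂(κ.prod ν) := by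
    rw [← hTV.map_eq, integral_map hTV.measurable.aemeasurable]
    rw [hTV.map_eq]; exact hm
  rw [e, integral_prod _ hI]
  exact integral_mono_ae hI.integral_prod_left hb hle

/-- The tower property by Fubini: with T frozen, q is constant and n averages to zero over the fresh
seed. -/
theorem integral_inner_eq_zero_of_fiber (hTV : MeasurePreserving (fun ω => (T ω, V ω)) P (κ.prod ν))
    (hn : Measurable fun q : 𝒯 × 𝒱 => n q.1 q.2) (hN : MemLp (fun ω => n (T ω) (V ω)) 2 P)
    (hint : ∀ᵐ t ∂κ, Integrable (n t) ν) (h0 : ∀ᵐ t ∂κ, ∫ v, n t v ∂ν = 0)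
    {q : 𝒯 → Vec d} (hq : Measurable q) (hqL : MemLp (fun ω => q (T ω)) 2 P) :
    ∫ ω, inner ℝ (q (T ω)) (n (T ω) (V ω)) ∂P = 0 := by
  have hm : Measurable fun r : 𝒯 × 𝒱 => inner ℝ (q r.1) (n r.1 r.2) :=
    (hq.comp measurable_fst).inner hn
  have hI : Integrable (fun ω => inner ℝ (q (T ω)) (n (T ω) (V ω))) P := integrable_inner_of_memLp hqL hN
  have hI' : Integrable (fun r : 𝒯 × 𝒱 => inner ℝ (q r.1) (n r.1 r.2)) (κ.prod ν) :=
    (hTV.integrable_comp hm.aestronglyMeasurable).1 hI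
  have e : ∫ ω, inner ℝ (q (T ω)) (n (T ω) (V ω)) ∂P
      = ∫ r, inner ℝ (q r.1) (n r.1 r.2) ∂(κ.prod ν) := by
    rw [← hTV.map_eq, integral_map hTV.measurable.aemeasurable hm.aestronglyMeasurable]
  rw [e, integral_prod _ hI']
  refine integral_eq_zero_of_ae ?_
  filter_upwards [hint, h0] with t ht1 ht2
  simp only [Pi.zero_apply]
  rw [integral_inner ht1, ht2, inner_zero_right]

end Fubini

/-! ### Splitting off one independent component of the randomness. -/

section Split

variable {S R V W : Type*} [MeasurableSpace S] [MeasurableSpace R] [MeasurableSpace V]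
  [MeasurableSpace W]

/-- Under `m`, the component `f` has law `ν` and is independent of the remaining part `e`. -/
def IsSplit (m : Measure S) (ν : Measure V) (e : S → R) (f : S → V) : Prop :=
  ∃ κ : Measure R, IsProbabilityMeasure κ ∧ MeasurePreserving (fun s => (e s, f s)) m (κ.prod ν)

/-- The removed component is replaced by the constant v₀ instead of being dropped. The remainder
keeps its type, so independence of a component becomes invariance under a self-map. -/
theorem isSplit_fst (ν : Measure V) (r : Measure R) [IsProbabilityMeasure ν]
    [IsProbabilityMeasure r] (v₀ : V) :
    IsSplit (ν.prod r) ν (fun s : V × R => (v₀, s.2)) Prod.fst := by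
  have h1 : MeasurePreserving (Prod.mk v₀ : R → V × R) r (r.map (Prod.mk v₀)) :=
    measurable_prodMk_left.measurePreserving r
  have : IsProbabilityMeasure (r.map (Prod.mk v₀ : R → V × R)) :=
    Measure.isProbabilityMeasure_map measurable_prodMk_left.aemeasurable
  exact ⟨r.map (Prod.mk v₀), this,
    (h1.prod (MeasurePreserving.id ν)).comp Measure.measurePreserving_swap⟩

theorem isSplit_snd (ν : Measure V) (r : Measure R) [IsProbabilityMeasure ν]
    [IsProbabilityMeasure r] (v₀ : V) :
    IsSplit (r.prod ν) ν (fun s : R × V => (s.1, v₀)) Prod.snd := by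
  have hm : Measurable fun u : R => (u, v₀) := measurable_prodMk_right
  have : IsProbabilityMeasure (r.map fun u : R => (u, v₀)) :=
    Measure.isProbabilityMeasure_map hm.aemeasurable
  exact ⟨r.map fun u => (u, v₀), this, (hm.measurePreserving r).prod (MeasurePreserving.id ν)⟩

theorem IsSplit.prod_left {m : Measure S} {ν : Measure V} [IsProbabilityMeasure m]
    [IsProbabilityMeasure ν] {e : S → R} {f : S → V} (h : IsSplit m ν e f) (α : Measure W)
    [IsProbabilityMeasure α] :
    IsSplit (α.prod m) ν (fun q : W × S => (q.1, e q.2)) (fun q => f q.2) := by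
  obtain ⟨κ, hκ, hmp⟩ := h
  exact ⟨α.prod κ, inferInstance,
    (measurePreserving_prodAssoc α κ ν).symm.comp ((MeasurePreserving.id α).prod hmp)⟩

end Split

/-- The noise `(∇φ(a; v) - ∇φ(a)) - (1 - η) (∇φ(a'; v) - ∇φ(a'))` which enters a momentum estimator. -/
noncomputable def oracleNoise {dx dy : ℕ} {S : Type*} (G : Joint dx dy → S → Joint dx dy)
    (φ : Joint dx dy → ℝ) (η : ℝ) (a a' : Joint dx dy) (v : S) : Joint dx dy :=
  (G a v - gradient φ a) - (1 - η) • (G a' v - gradient φ a')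

theorem measurable_gradient {dx dy : ℕ} (φ : Joint dx dy → ℝ) : Measurable (gradient φ) :=
  (InnerProductSpace.toDual ℝ (Joint dx dy)).symm.continuous.measurable.comp (measurable_fderiv ℝ φ)

namespace Bilevel

variable {dx dy : ℕ} {Z Ξ : Type*} [MeasurableSpace Z] [MeasurableSpace Ξ]
  {B : Bilevel dx dy Z Ξ} {S : Type*} [MeasurableSpace S] {law : Measure S}
  {φ : Joint dx dy → ℝ} {G : Joint dx dy → S → Joint dx dy} {s l η : ℝ}

theorem UnbiasedOracle.measurable_noise (h : B.UnbiasedOracle law φ G s) {𝒯 : Type*}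
    [MeasurableSpace 𝒯] {a a' : 𝒯 → Joint dx dy} {v : 𝒯 → S} (ha : Measurable a)
    (ha' : Measurable a') (hv : Measurable v) :
    Measurable fun q => oracleNoise G φ η (a q) (a' q) (v q) := by
  have hG : ∀ {a : 𝒯 → Joint dx dy}, Measurable a → Measurable fun q => G (a q) (v q) :=
    fun ha => h.1.comp (ha.prodMk hv)
  have h1 := (hG ha).sub ((measurable_gradient φ).comp ha)
  have h2 := (hG ha').sub ((measurable_gradient φ).comp ha')
  exact h1.sub (h2.const_smul (1 - η))

/-- Mean and second moment of the noise in a momentum estimator. -/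
theorem UnbiasedOracle.noise_moments [IsProbabilityMeasure law]
    (h : B.UnbiasedOracle law φ G s) (hms : B.MeanSquaredSmooth law G l)
    (hφ : B.SmoothOn φ l) (hX : Convex ℝ B.X) (hY : Convex ℝ B.Y)
    (hη : 0 ≤ η) (hη1 : η ≤ 1) {a a' : Joint dx dy} (ha : a ∈ jointSet B.X B.Y)
    (ha' : a' ∈ jointSet B.X B.Y) :
    Integrable (oracleNoise G φ η a a') law ∧ ∫ v, oracleNoise G φ η a a' v ∂law = 0 ∧
      Integrable (fun v => ‖oracleNoise G φ η a a' v‖ ^ 2) law ∧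
      ∫ v, ‖oracleNoise G φ η a a' v‖ ^ 2 ∂law ≤ 2 * η ^ 2 * s ^ 2 + 8 * l ^ 2 * ‖a - a'‖ ^ 2 := by
  obtain ⟨i1, m1, v1, b1⟩ := h.2 a.fst ha.1 a.snd ha.2
  obtain ⟨i2, m2, v2, b2⟩ := h.2 a'.fst ha'.1 a'.snd ha'.2
  have hmss := hms a.fst ha.1 a.snd ha.2 a'.fst ha'.1 a'.snd ha'.2
  change Integrable (G a) law at i1
  change Integrable (G a') law at i2
  change ∫ t, G a t ∂law = gradient φ a at m1
  change ∫ t, G a' t ∂law = gradient φ a' at m2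
  change Integrable (fun t => ‖G a t - gradient φ a‖ ^ 2) law at v1
  change Integrable (fun t => ‖G a' t - gradient φ a'‖ ^ 2) law at v2
  change ∫ t, ‖G a t - gradient φ a‖ ^ 2 ∂law ≤ s ^ 2 at b1
  change ∫ t, ‖G a t - G a' t‖ ^ 2 ∂law ≤ l ^ 2 * (‖(a - a').fst‖ ^ 2 + ‖(a - a').snd‖ ^ 2) at hmss
  rw [← joint_norm_sq] at hmss
  have i1' : Integrable (fun v => G a v - gradient φ a) law := i1.sub (integrable_const _)
  have i2' : Integrable (fun v => G a' v - gradient φ a') law := i2.sub (integrable_const _)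
  have M1 : MemLp (fun v => G a v - gradient φ a) 2 law :=
    (memLp_two_iff_integrable_sq_norm i1'.aestronglyMeasurable).2 v1
  have M2 : MemLp (fun v => G a' v - gradient φ a') 2 law :=
    (memLp_two_iff_integrable_sq_norm i2'.aestronglyMeasurable).2 v2
  have MN : MemLp (oracleNoise G φ η a a') 2 law := M1.sub (M2.const_smul (1 - η))
  -- `MeanSquaredSmooth` bounds an integral without asserting integrability; this follows from the
  -- finite variances at both points.
  have MD : MemLp (fun v => G a v - G a' v) 2 law := by
    have := (M1.sub M2).add (memLp_const (gradient φ a - gradient φ a'))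
    refine this.congr_norm (i1.sub i2).aestronglyMeasurable (Filter.Eventually.of_forall fun v => ?_)
    simp only [Pi.add_apply, Pi.sub_apply]
    congr 1; abel
  have hDi := (memLp_two_iff_integrable_sq_norm MD.1).1 MD
  have hNi := (memLp_two_iff_integrable_sq_norm MN.1).1 MN
  refine ⟨i1'.sub (i2'.smul (1 - η)), ?_, hNi, ?_⟩
  · have e1 : ∫ v, (G a v - gradient φ a) ∂law = 0 := by
      rw [integral_sub i1 (integrable_const _), m1]; simp
    have e2 : ∫ v, (G a' v - gradient φ a') ∂law = 0 := by
      rw [integral_sub i2 (integrable_const _), m2]; simp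
    unfold oracleNoise
    have e3 := integral_sub i1' (i2'.smul (1 - η))
    simp only [Pi.smul_apply] at e3
    rw [e3, integral_smul, e1, e2]; simp
  · have hgrad := hφ.norm_gradient_sub_le hX hY ha' ha
    have hpt : ∀ v, ‖oracleNoise G φ η a a' v‖ ^ 2 ≤ 2 * η ^ 2 * ‖G a v - gradient φ a‖ ^ 2
        + 4 * ‖G a v - G a' v‖ ^ 2 + 4 * (l ^ 2 * ‖a - a'‖ ^ 2) := by
      intro v
      -- The fresh noise enters with weight η only. The rest is a centred difference between two
      -- points with the same seed, hence of the size of the displacement.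
      have e : oracleNoise G φ η a a' v = η • (G a v - gradient φ a)
          + (1 - η) • ((G a v - G a' v) - (gradient φ a - gradient φ a')) := by
        unfold oracleNoise; module
      have h1 : ‖oracleNoise G φ η a a' v‖ ≤ η * ‖G a v - gradient φ a‖
          + (‖G a v - G a' v‖ + l * ‖a - a'‖) := by
        rw [e]
        refine (norm_add_le _ _).trans ?_
        rw [norm_smul, norm_smul, Real.norm_of_nonneg hη, Real.norm_of_nonneg (by linarith)]
        have h2 := norm_sub_le (G a v - G a' v) (gradient φ a - gradient φ a')
        have h3 : (1 - η) * ‖(G a v - G a' v) - (gradient φ a - gradient φ a')‖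
            ≤ 1 * ‖(G a v - G a' v) - (gradient φ a - gradient φ a')‖ := by
          gcongr; linarith
        linarith
      have h2 := pow_le_pow_left₀ (norm_nonneg _) h1 2
      set A := η * ‖G a v - gradient φ a‖ with hA
      have e2 : 2 * η ^ 2 * ‖G a v - gradient φ a‖ ^ 2 = 2 * A ^ 2 := by rw [hA]; ring
      have e3 : l ^ 2 * ‖a - a'‖ ^ 2 = (l * ‖a - a'‖) ^ 2 := by ring
      rw [e2, e3]
      linarith [sq_nonneg (A - (‖G a v - G a' v‖ + l * ‖a - a'‖)),
        sq_nonneg (‖G a v - G a' v‖ - l * ‖a - a'‖)]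
    have hRi : Integrable (fun v => 2 * η ^ 2 * ‖G a v - gradient φ a‖ ^ 2
        + 4 * ‖G a v - G a' v‖ ^ 2 + 4 * (l ^ 2 * ‖a - a'‖ ^ 2)) law :=
      ((v1.const_mul _).add (hDi.const_mul _)).add (integrable_const _)
    refine (integral_mono hNi hRi hpt).trans ?_
    have e : ∫ v, (2 * η ^ 2 * ‖G a v - gradient φ a‖ ^ 2 + 4 * ‖G a v - G a' v‖ ^ 2
        + 4 * (l ^ 2 * ‖a - a'‖ ^ 2)) ∂law = 2 * η ^ 2 * ∫ t, ‖G a t - gradient φ a‖ ^ 2 ∂law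
        + 4 * ∫ t, ‖G a t - G a' t‖ ^ 2 ∂law + 4 * (l ^ 2 * ‖a - a'‖ ^ 2) := by
      have e1 := integral_add ((v1.const_mul (2 * η ^ 2)).add (hDi.const_mul 4))
        (integrable_const (μ := law) (4 * (l ^ 2 * ‖a - a'‖ ^ 2)))
      have e2 := integral_add (v1.const_mul (2 * η ^ 2)) (hDi.const_mul 4)
      simp only [Pi.add_apply] at e1
      rw [e1, e2, integral_const_mul, integral_const_mul]
      simp
    rw [e]
    have h3 : 2 * η ^ 2 * ∫ t, ‖G a t - gradient φ a‖ ^ 2 ∂law ≤ 2 * η ^ 2 * s ^ 2 := by gcongr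
    linarith

/-- The noise of a momentum estimator, when queried with a fresh seed `V` at points depending only
on `T`: square integrability, second moment, and orthogonality to functions of `T`. -/
theorem UnbiasedOracle.noise_estimate [IsProbabilityMeasure law]
    (h : B.UnbiasedOracle law φ G s) (hms : B.MeanSquaredSmooth law G l)
    (hφ : B.SmoothOn φ l) (hX : Convex ℝ B.X) (hY : Convex ℝ B.Y)
    (hXc : IsClosed B.X) (hYc : IsClosed B.Y) (hη : 0 ≤ η) (hη1 : η ≤ 1)
    {Ω 𝒯 : Type*} [MeasurableSpace Ω] [MeasurableSpace 𝒯] {P : Measure Ω} [IsProbabilityMeasure P]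
    {T : Ω → 𝒯} {V : Ω → S} (hsplit : IsSplit P law T V) {d : ℕ} (π : Joint dx dy →L[ℝ] Vec d)
    (hπ : ∀ u, ‖π u‖ ≤ ‖u‖) {a a' : 𝒯 → Joint dx dy} (ha : Measurable a) (ha' : Measurable a')
    (haX : ∀ ω, a (T ω) ∈ jointSet B.X B.Y) (ha'X : ∀ ω, a' (T ω) ∈ jointSet B.X B.Y)
    (hdiff : Integrable (fun ω => ‖a (T ω) - a' (T ω)‖ ^ 2) P) :
    MemLp (fun ω => π (oracleNoise G φ η (a (T ω)) (a' (T ω)) (V ω))) 2 P ∧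
    ∫ ω, ‖π (oracleNoise G φ η (a (T ω)) (a' (T ω)) (V ω))‖ ^ 2 ∂P
      ≤ 2 * η ^ 2 * s ^ 2 + 8 * l ^ 2 * ∫ ω, ‖a (T ω) - a' (T ω)‖ ^ 2 ∂P ∧
    ∀ q : 𝒯 → Vec d, Measurable q → MemLp (fun ω => q (T ω)) 2 P →
      ∫ ω, inner ℝ (q (T ω)) (π (oracleNoise G φ η (a (T ω)) (a' (T ω)) (V ω))) ∂P = 0 := by
  obtain ⟨κ, hκ, hTV⟩ := hsplit
  have hT : MeasurePreserving T P κ := by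
    have := (measurePreserving_fst (μ := κ) (ν := law)).comp hTV
    exact this
  have hcl := (isClosed_jointSet hXc hYc).measurableSet
  -- Feasibility is known along T only, so on the factor space it holds almost everywhere;
  -- closedness of X and Y provides the measurability.
  have hae : ∀ᵐ t ∂κ, a t ∈ jointSet B.X B.Y ∧ a' t ∈ jointSet B.X B.Y := by
    rw [← hT.map_eq]
    refine (ae_map_iff hT.measurable.aemeasurable
      (p := fun t => a t ∈ jointSet B.X B.Y ∧ a' t ∈ jointSet B.X B.Y)
      ((ha hcl).inter (ha' hcl))).2 ?_
    exact Filter.Eventually.of_forall fun ω => ⟨haX ω, ha'X ω⟩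
  have hmom : ∀ᵐ t ∂κ, Integrable (oracleNoise G φ η (a t) (a' t)) law ∧
      ∫ v, oracleNoise G φ η (a t) (a' t) v ∂law = 0 ∧
      Integrable (fun v => ‖oracleNoise G φ η (a t) (a' t) v‖ ^ 2) law ∧
      ∫ v, ‖oracleNoise G φ η (a t) (a' t) v‖ ^ 2 ∂law
        ≤ 2 * η ^ 2 * s ^ 2 + 8 * l ^ 2 * ‖a t - a' t‖ ^ 2 := by
    filter_upwards [hae] with t ht
    exact h.noise_moments hms hφ hX hY hη hη1 ht.1 ht.2
  have hmeas : Measurable fun q : 𝒯 × S => oracleNoise G φ η (a q.1) (a' q.1) q.2 :=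
    h.measurable_noise (ha.comp measurable_fst) (ha'.comp measurable_fst) measurable_snd
  have hn : Measurable fun q : 𝒯 × S => π (oracleNoise G φ η (a q.1) (a' q.1) q.2) :=
    π.continuous.measurable.comp hmeas
  have hdm : Measurable fun t => ‖a t - a' t‖ ^ 2 := (ha.sub ha').norm.pow_const 2
  have hdκ : Integrable (fun t => ‖a t - a' t‖ ^ 2) κ :=
    (hT.integrable_comp hdm.aestronglyMeasurable).1 hdiff
  have hb : Integrable (fun t => 2 * η ^ 2 * s ^ 2 + 8 * l ^ 2 * ‖a t - a' t‖ ^ 2) κ :=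
    (integrable_const _).add (hdκ.const_mul _)
  have hsq : ∀ t v, ‖π (oracleNoise G φ η (a t) (a' t) v)‖ ^ 2
      ≤ ‖oracleNoise G φ η (a t) (a' t) v‖ ^ 2 := fun t v =>
    pow_le_pow_left₀ (norm_nonneg _) (hπ _) 2
  have hint : ∀ᵐ t ∂κ, Integrable (fun v => ‖π (oracleNoise G φ η (a t) (a' t) v)‖ ^ 2) law := by
    filter_upwards [hmom] with t ht
    refine ht.2.2.1.mono' ?_ (Filter.Eventually.of_forall fun v => ?_)
    · exact ((π.continuous.comp_aestronglyMeasurable ht.1.aestronglyMeasurable).norm.pow 2)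
    · rw [Real.norm_of_nonneg (by positivity)]; exact hsq t v
  have hle : ∀ᵐ t ∂κ, ∫ v, ‖π (oracleNoise G φ η (a t) (a' t) v)‖ ^ 2 ∂law
      ≤ 2 * η ^ 2 * s ^ 2 + 8 * l ^ 2 * ‖a t - a' t‖ ^ 2 := by
    filter_upwards [hmom, hint] with t ht hti
    exact (integral_mono hti ht.2.2.1 (hsq t)).trans ht.2.2.2
  obtain ⟨hL, hbd⟩ := memLp_two_of_fiber_bound hTV hn hb hint hle
  refine ⟨hL, hbd.trans (le_of_eq ?_), fun q hq hqL => ?_⟩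
  · have e1 := integral_add (integrable_const (μ := κ) (2 * η ^ 2 * s ^ 2))
      (hdκ.const_mul (8 * l ^ 2))
    have e2 : ∫ t, ‖a t - a' t‖ ^ 2 ∂κ = ∫ ω, ‖a (T ω) - a' (T ω)‖ ^ 2 ∂P := by
      rw [← hT.map_eq, integral_map hT.measurable.aemeasurable hdm.aestronglyMeasurable]
    have e3 := integral_const_mul (μ := κ) (8 * l ^ 2) fun t => ‖a t - a' t‖ ^ 2
    rw [e1, e3, e2]
    simp
  · refine integral_inner_eq_zero_of_fiber
      (n := fun t v => π (oracleNoise G φ η (a t) (a' t) v)) hTV hn hL ?_ ?_ hq hqL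
    · filter_upwards [hmom] with t ht using π.integrable_comp ht.1
    · filter_upwards [hmom] with t ht
      rw [π.integral_comp_comm ht.1, ht.2.1, map_zero]

end Bilevel

/-! ### Measurability of the iterates and independence of the fresh seeds -/

theorem measurable_pt {α : Type*} [MeasurableSpace α] {dx dy : ℕ} {u : α → Vec dx} {v : α → Vec dy}
    (hu : Measurable u) (hv : Measurable v) : Measurable fun a => pt (u a) (v a) :=
  (WithLp.prod_continuous_toLp 2 (Vec dx) (Vec dy)).measurable.comp (hu.prodMk hv)

theorem measurable_joint_fst {dx dy : ℕ} : Measurable fun q : Joint dx dy => q.fst :=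
  (WithLp.fstL 2 ℝ (Vec dx) (Vec dy)).continuous.measurable

theorem measurable_joint_snd {dx dy : ℕ} : Measurable fun q : Joint dx dy => q.snd :=
  (WithLp.sndL 2 ℝ (Vec dx) (Vec dy)).continuous.measurable

namespace Alg

variable {dx dy : ℕ} {Z Ξ : Type*} [MeasurableSpace Z] [MeasurableSpace Ξ]
  {B : Bilevel dx dy Z Ξ} {p : ProblemConsts} {I : AlgInput dx dy}

/-- All components of a random state are measurable. -/
structure MeasurableState {α : Type*} [MeasurableSpace α] (f : α → AlgState dx dy) : Prop where
  x : Measurable fun a => (f a).x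
  y : Measurable fun a => (f a).y
  z : Measurable fun a => (f a).z
  wy : Measurable fun a => (f a).wy
  wz : Measurable fun a => (f a).wz
  xp : Measurable fun a => (f a).xp
  wyp : Measurable fun a => (f a).wyp
  wzp : Measurable fun a => (f a).wzp
  fwyp : Measurable fun a => (f a).fwyp
  gwyp : Measurable fun a => (f a).gwyp
  gwzp : Measurable fun a => (f a).gwzp
  fxp : Measurable fun a => (f a).fxp
  gxyp : Measurable fun a => (f a).gxyp
  gxzp : Measurable fun a => (f a).gxzp

theorem measurable_momentum {α : Type*} [MeasurableSpace α] {d : ℕ} (η : ℝ) {u v w : α → Vec d}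
    (hu : Measurable u) (hv : Measurable v) (hw : Measurable w) :
    Measurable fun a => momentum η (u a) (v a) (w a) := by
  have h := (hv.sub hw).const_smul (1 - η)
  exact hu.add h

theorem measurableState_step (hB : B.Assumptions p I.ρ) (hne : B.Y.Nonempty) (hneX : B.X.Nonempty)
    (k : ℕ) {α : Type*} [MeasurableSpace α] {f : α → AlgState dx dy} (hf : MeasurableState f)
    {s : α → Seeds Z Ξ} (hs : Measurable s) : MeasurableState fun a => step B I k (f a) (s a) := by
  have gf : ∀ {u : α → Vec dx} {v : α → Vec dy} {t : α → Z}, Measurable u → Measurable v →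
      Measurable t → Measurable fun a => B.Gf (pt (u a) (v a)) (t a) := fun hu hv ht =>
    hB.oracle_f.1.comp ((measurable_pt hu hv).prodMk ht)
  have gg : ∀ {u : α → Vec dx} {v : α → Vec dy} {t : α → Ξ}, Measurable u → Measurable v →
      Measurable t → Measurable fun a => B.Gg (pt (u a) (v a)) (t a) := fun hu hv ht =>
    hB.oracle_g.1.comp ((measurable_pt hu hv).prodMk ht)
  have pY := (continuous_proj hB.convex_Y hB.closed_Y hne).measurable
  have pX := (continuous_proj hB.convex_X hB.closed_X hneX).measurable
  have s1 : Measurable fun a => (s a).ζwy := hs.fst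
  have s2 : Measurable fun a => (s a).ζx := hs.snd.fst
  have s3 : Measurable fun a => (s a).ξwy := hs.snd.snd.fst
  have s4 : Measurable fun a => (s a).ξwz := hs.snd.snd.snd.fst
  have s5 : Measurable fun a => (s a).ξxy := hs.snd.snd.snd.snd.fst
  have s6 : Measurable fun a => (s a).ξxz := hs.snd.snd.snd.snd.snd
  have hfwy : Measurable fun a => estFwy B I k (f a) (s a) :=
    measurable_momentum _ (measurable_joint_snd.comp (gf hf.x hf.wy s1)) hf.fwyp
      (measurable_joint_snd.comp (gf hf.xp hf.wyp s1))
  have hgwy : Measurable fun a => estGwy B I k (f a) (s a) :=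
    measurable_momentum _ (measurable_joint_snd.comp (gg hf.x hf.wy s3)) hf.gwyp
      (measurable_joint_snd.comp (gg hf.xp hf.wyp s3))
  have hgwz : Measurable fun a => estGwz B I k (f a) (s a) :=
    measurable_momentum _ (measurable_joint_snd.comp (gg hf.x hf.wz s4)) hf.gwzp
      (measurable_joint_snd.comp (gg hf.xp hf.wzp s4))
  have hwy : Measurable fun a => nextWy B I k (f a) (s a) := by
    have h1 := hfwy.const_smul (I.σ k)
    have h2 := (hf.wy.sub hf.y).const_smul I.ρ⁻¹
    have h3 := ((h1.add hgwy).add h2).const_smul (I.γ k)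
    exact pY.comp (hf.wy.sub h3)
  have hwz : Measurable fun a => nextWz B I k (f a) (s a) := by
    have h2 := (hf.wz.sub hf.z).const_smul I.ρ⁻¹
    have h3 := (hgwz.add h2).const_smul (I.γ k)
    exact pY.comp (hf.wz.sub h3)
  have hfx : Measurable fun a => estFx B I k (f a) (s a) :=
    measurable_momentum _ (measurable_joint_fst.comp (gf hf.x hwy s2)) hf.fxp
      (measurable_joint_fst.comp (gf hf.xp hf.wy s2))
  have hgxy : Measurable fun a => estGxy B I k (f a) (s a) :=
    measurable_momentum _ (measurable_joint_fst.comp (gg hf.x hwy s5)) hf.gxyp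
      (measurable_joint_fst.comp (gg hf.xp hf.wy s5))
  have hgxz : Measurable fun a => estGxz B I k (f a) (s a) :=
    measurable_momentum _ (measurable_joint_fst.comp (gg hf.x hwz s6)) hf.gxzp
      (measurable_joint_fst.comp (gg hf.xp hf.wz s6))
  exact
    { x := by
        have h1 := hfx.const_smul (I.σ k)
        have h2 := ((h1.add hgxy).sub hgxz).const_smul (I.α k)
        exact pX.comp (hf.x.sub h2)
      y := by
        have h1 := hf.y.const_smul (1 - I.β k)
        have h2 := hwy.const_smul (I.β k)
        exact h1.add h2
      z := by
        have h1 := hf.z.const_smul (1 - I.β k)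
        have h2 := hwz.const_smul (I.β k)
        exact h1.add h2
      wy := hwy
      wz := hwz
      xp := hf.x
      wyp := hf.wy
      wzp := hf.wz
      fwyp := hfwy
      gwyp := hgwy
      gwzp := hgwz
      fxp := hfx
      gxyp := hgxy
      gxzp := hgxz }

theorem measurableState_state (hB : B.Assumptions p I.ρ) (hI : Admissible B p I) (k : ℕ) :
    MeasurableState fun s : ℕ → Seeds Z Ξ => state B I s k := by
  induction k with
  | zero => constructor <;> exact measurable_const
  | succ k ih =>
    exact measurableState_step hB ⟨_, hI.y₀_mem⟩ ⟨_, hI.x₀_mem⟩ k ih (measurable_pi_apply k)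

/-- The state at the start of iteration k depends only on the seeds of earlier iterations, hence is
not changed by any mask at time k. -/
theorem state_congr {s s' : ℕ → Seeds Z Ξ} {k : ℕ} (h : ∀ i < k, s i = s' i) :
    state B I s k = state B I s' k := by
  induction k with
  | zero => rfl
  | succ k ih =>
    rw [state, state, ih fun i hi => h i (hi.trans (Nat.lt_succ_self k)), h k (Nat.lt_succ_self k)]

/-- The seed sequence `s` with `e (s k)` in place of `s k`, and `s₀` at all later times. -/
noncomputable def mask (s₀ : Seeds Z Ξ) (k : ℕ) (e : Seeds Z Ξ → Seeds Z Ξ) (s : ℕ → Seeds Z Ξ) :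
    ℕ → Seeds Z Ξ :=
  Function.update (fun i => if i < k then s i else s₀) k (e (s k))

variable {s₀ : Seeds Z Ξ} {k : ℕ} {e : Seeds Z Ξ → Seeds Z Ξ}

theorem state_mask (s : ℕ → Seeds Z Ξ) : state B I (mask s₀ k e s) k = state B I s k :=
  state_congr fun i hi => by simp [mask, hi, hi.ne]

theorem mask_self {Z Ξ : Type*} {s₀ : Seeds Z Ξ} {k : ℕ} {e : Seeds Z Ξ → Seeds Z Ξ}
    (s : ℕ → Seeds Z Ξ) : mask s₀ k e s k = e (s k) := by
  simp [mask]

theorem state_succ_mask (s : ℕ → Seeds Z Ξ) :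
    state B I (mask s₀ k e s) (k + 1) = step B I k (state B I s k) (e (s k)) := by
  rw [state, state_mask, mask_self]

/-- Under `Q`, the seeds of every iteration have law `seedLaw` and are independent of the earlier
ones. -/
def FreshSeeds (B : Bilevel dx dy Z Ξ) (s₀ : Seeds Z Ξ) (Q : Measure (ℕ → Seeds Z Ξ)) : Prop :=
  ∀ k, IsSplit Q B.seedLaw (fun s i => if i < k then s i else s₀) fun s => s k

/-- Independence of the family gives independence of the blocks of indices below k and of k alone.
Padding the past by s₀ makes it a seed sequence again. -/
theorem freshSeeds_map (s₀ : Seeds Z Ξ) {Ω : Type*} [MeasurableSpace Ω] {P : Measure Ω}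
    [IsProbabilityMeasure P] {S : ℕ → Ω → Seeds Z Ξ} (hS : ∀ k, Measurable (S k))
    (hlaw : ∀ k, P.map (S k) = B.seedLaw) (hind : iIndepFun S P) :
    FreshSeeds B s₀ (P.map fun ω k => S k ω) := by
  intro k
  have hSS : Measurable fun ω k => S k ω := measurable_pi_lambda _ hS
  have hpast : Measurable fun (s : ℕ → Seeds Z Ξ) (i : ℕ) => if i < k then s i else s₀ := by
    refine measurable_pi_lambda _ fun i => ?_
    split_ifs
    · exact measurable_pi_apply i
    · exact measurable_const
  have hdis : Disjoint (Finset.range k) {k} := by simp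
  have h1 := hind.indepFun_finset (Finset.range k) {k} hdis hS
  have hg : Measurable fun (u : Finset.range k → Seeds Z Ξ) (i : ℕ) =>
      if h : i < k then u ⟨i, Finset.mem_range.2 h⟩ else s₀ := by
    refine measurable_pi_lambda _ fun i => ?_
    by_cases h : i < k
    · simpa only [h, dif_pos] using measurable_pi_apply _
    · simpa only [h, dif_neg, not_false_eq_true] using measurable_const
  have hg' : Measurable fun u : ({k} : Finset ℕ) → Seeds Z Ξ => u ⟨k, Finset.mem_singleton_self k⟩ :=
    measurable_pi_apply _
  have h2 := h1.comp hg hg'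
  have h3 : IndepFun (fun ω (i : ℕ) => if i < k then S i ω else s₀) (S k) P := by
    have e1 : (fun ω (i : ℕ) => if i < k then S i ω else s₀) = (fun (u : Finset.range k → Seeds Z Ξ)
        (i : ℕ) => if h : i < k then u ⟨i, Finset.mem_range.2 h⟩ else s₀) ∘ fun ω i => S i ω := by
      funext ω i
      by_cases h : i < k <;> simp [h]
    rw [e1]
    exact h2
  have hm := hpast.comp hSS
  have h4 := (indepFun_iff_map_prod_eq_prod_map_map hm.aemeasurable (hS k).aemeasurable).1 h3
  have hpair : Measurable fun s : ℕ → Seeds Z Ξ =>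
      ((fun i => if i < k then s i else s₀ : ℕ → Seeds Z Ξ), s k) :=
    hpast.prodMk (measurable_pi_apply k)
  refine ⟨P.map ((fun (s : ℕ → Seeds Z Ξ) (i : ℕ) => if i < k then s i else s₀) ∘ fun ω k => S k ω),
    Measure.isProbabilityMeasure_map hm.aemeasurable, hpair, ?_⟩
  rw [Measure.map_map hpair hSS, ← hlaw k]
  exact h4

end Alg

theorem IsSplit.map_left {S R R' V : Type*} [MeasurableSpace S] [MeasurableSpace R]
    [MeasurableSpace R'] [MeasurableSpace V] {m : Measure S} {ν : Measure V}
    [IsProbabilityMeasure ν] {e : S → R} {f : S → V} (h : IsSplit m ν e f) {g : R → R'}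
    (hg : Measurable g) : IsSplit m ν (fun s => g (e s)) f := by
  obtain ⟨κ, hκ, hmp⟩ := h
  have := Measure.isProbabilityMeasure_map (μ := κ) hg.aemeasurable
  exact ⟨κ.map g, this, ((hg.measurePreserving κ).prod (MeasurePreserving.id ν)).comp hmp⟩

/-- A component of a component which is independent of everything else. -/
theorem IsSplit.trans {S R R' V V' : Type*} [MeasurableSpace S] [MeasurableSpace R]
    [MeasurableSpace R'] [MeasurableSpace V] [MeasurableSpace V'] {m : Measure S} {ν : Measure V}
    {ν' : Measure V'} [IsProbabilityMeasure ν] [IsProbabilityMeasure ν'] {e : S → R} {f : S → V}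
    (h : IsSplit m ν e f) {e' : V → R'} {f' : V → V'} (h' : IsSplit ν ν' e' f') :
    IsSplit m ν' (fun s => (e s, e' (f s))) fun s => f' (f s) := by
  obtain ⟨κ, hκ, hmp⟩ := h
  obtain ⟨κ', hκ', hmp'⟩ := h'.prod_left κ
  exact ⟨κ', hκ', hmp'.comp hmp⟩

namespace Alg

variable {dx dy : ℕ} {Z Ξ : Type*} [MeasurableSpace Z] [MeasurableSpace Ξ]
  {B : Bilevel dx dy Z Ξ} {s₀ : Seeds Z Ξ} {Q : Measure (ℕ → Seeds Z Ξ)}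

/-- Two splittings compose: iteration k is independent of the past, and within it one component is
independent of the others. `Function.update` reassembles all but this component into the masked
sequence. -/
theorem FreshSeeds.split (hQ : FreshSeeds B s₀ Q) [IsProbabilityMeasure B.lawζ]
    [IsProbabilityMeasure B.lawξ] {V : Type*} [MeasurableSpace V] {ν : Measure V}
    [IsProbabilityMeasure ν] {e : Seeds Z Ξ → Seeds Z Ξ} {f : Seeds Z Ξ → V}
    (h : IsSplit B.seedLaw ν e f) (k : ℕ) : IsSplit Q ν (mask s₀ k e) fun s => f (s k) := by
  have : IsProbabilityMeasure B.seedLaw := by unfold Bilevel.seedLaw; infer_instance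
  exact ((hQ k).trans h).map_left (g := fun r => Function.update r.1 k r.2) measurable_update'

variable [IsProbabilityMeasure B.lawζ] [IsProbabilityMeasure B.lawξ]

/-- For each of the six seeds there is a splitting which erases this seed alone. -/
theorem split_ζwy (s₀ : Seeds Z Ξ) :
    IsSplit B.seedLaw B.lawζ (fun s => (s₀.ζwy, s.2)) Seeds.ζwy :=
  isSplit_fst _ _ _

theorem split_ζx (s₀ : Seeds Z Ξ) :
    IsSplit B.seedLaw B.lawζ (fun s => (s.1, s₀.ζx, s.2.2)) Seeds.ζx :=
  (isSplit_fst _ _ _).prod_left _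

theorem split_ξwy (s₀ : Seeds Z Ξ) :
    IsSplit B.seedLaw B.lawξ (fun s => (s.1, s.2.1, s₀.ξwy, s.2.2.2)) Seeds.ξwy :=
  ((isSplit_fst _ _ _).prod_left _).prod_left _

theorem split_ξwz (s₀ : Seeds Z Ξ) :
    IsSplit B.seedLaw B.lawξ (fun s => (s.1, s.2.1, s.2.2.1, s₀.ξwz, s.2.2.2.2)) Seeds.ξwz :=
  (((isSplit_fst _ _ _).prod_left _).prod_left _).prod_left _

theorem split_ξxy (s₀ : Seeds Z Ξ) :
    IsSplit B.seedLaw B.lawξ (fun s => (s.1, s.2.1, s.2.2.1, s.2.2.2.1, s₀.ξxy, s.2.2.2.2.2))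
      Seeds.ξxy :=
  ((((isSplit_fst _ _ _).prod_left _).prod_left _).prod_left _).prod_left _

theorem split_ξxz (s₀ : Seeds Z Ξ) :
    IsSplit B.seedLaw B.lawξ (fun s => (s.1, s.2.1, s.2.2.1, s.2.2.2.1, s.2.2.2.2.1, s₀.ξxz))
      Seeds.ξxz :=
  ((((isSplit_snd _ _ _).prod_left _).prod_left _).prod_left _).prod_left _

end Alg

/-! ### Second moments of the momentum estimators -/

/-- `d = c p + N` where `N` is a square integrable noise with `E‖N‖² ≤ v` which is orthogonal to all
square integrable functions that are invariant under `T`, such as `p`. -/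
structure NoiseStep {Ω : Type*} [MeasurableSpace Ω] {n : ℕ} (Q : Measure Ω) (T : Ω → Ω) (c : ℝ)
    (p d : Ω → Vec n) (v : ℝ) : Prop where
  memLp : MemLp d 2 Q
  sq_le : ∫ s, ‖d s‖ ^ 2 ∂Q ≤ c ^ 2 * ∫ s, ‖p s‖ ^ 2 ∂Q + v
  inner_eq : ∀ q : Ω → Vec n, Measurable q → (∀ s, q (T s) = q s) → MemLp q 2 Q →
    ∫ s, inner ℝ (q s) (d s) ∂Q = c * ∫ s, inner ℝ (q s) (p s) ∂Q

/-- As d does not use the seed of d', the second factor may be replaced by c p'; as p' does not use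
the seed of d, the first one may be replaced by c p. Orthogonality is thus inherited from one
iteration to the next. -/
theorem NoiseStep.cross {Ω : Type*} [MeasurableSpace Ω] {n : ℕ} {Q : Measure Ω} {T T' : Ω → Ω}
    {c v v' : ℝ} {p d p' d' : Ω → Vec n} (h : NoiseStep Q T c p d v)
    (h' : NoiseStep Q T' c p' d' v') (hd : Measurable d) (hdT : ∀ s, d (T' s) = d s)
    (hp' : Measurable p') (hpT : ∀ s, p' (T s) = p' s) (hpL : MemLp p' 2 Q)
    (h0 : c * ∫ s, inner ℝ (p s) (p' s) ∂Q = 0) : ∫ s, inner ℝ (d s) (d' s) ∂Q = 0 := by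
  have e1 := h'.inner_eq d hd hdT h.memLp
  have e2 := h.inner_eq p' hp' hpT hpL
  simp only [real_inner_comm] at e1 e2 h0 ⊢
  rw [e1, e2, h0, mul_zero]

/-- In ‖(1 - η)p + N‖² the mixed term has mean zero, since p is invariant under T. So the factor (1
- η)² appears without a Young constant, which the weights of the potential rely on. -/
theorem Bilevel.UnbiasedOracle.noiseStep {dx dy : ℕ} {Z Ξ : Type*} [MeasurableSpace Z]
    [MeasurableSpace Ξ] {B : Bilevel dx dy Z Ξ} {S : Type*} [MeasurableSpace S] {law : Measure S}
    {φ : Joint dx dy → ℝ} {G : Joint dx dy → S → Joint dx dy} {σ l η : ℝ}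
    [IsProbabilityMeasure law] (h : B.UnbiasedOracle law φ G σ) (hms : B.MeanSquaredSmooth law G l)
    (hφ : B.SmoothOn φ l) (hX : Convex ℝ B.X) (hY : Convex ℝ B.Y)
    (hXc : IsClosed B.X) (hYc : IsClosed B.Y) (hη : 0 ≤ η) (hη1 : η ≤ 1)
    {Ω : Type*} [MeasurableSpace Ω] {Q : Measure Ω} [IsProbabilityMeasure Q]
    {T : Ω → Ω} {V : Ω → S} (hsplit : IsSplit Q law T V) {d : ℕ} (π : Joint dx dy →L[ℝ] Vec d)
    (hπ : ∀ u, ‖π u‖ ≤ ‖u‖) {a a' : Ω → Joint dx dy} (ha : Measurable a) (ha' : Measurable a')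
    (haT : ∀ s, a (T s) = a s) (ha'T : ∀ s, a' (T s) = a' s)
    (haX : ∀ s, a s ∈ jointSet B.X B.Y) (ha'X : ∀ s, a' s ∈ jointSet B.X B.Y)
    {m : Ω → ℝ} (hm : Integrable m Q) (hD : ∀ s, ‖a s - a' s‖ ^ 2 ≤ m s)
    {p : Ω → Vec d} (hp : Measurable p) (hpT : ∀ s, p (T s) = p s) (hpL : MemLp p 2 Q)
    {e : Ω → Vec d} (he : ∀ s, e s = (1 - η) • p s + π (oracleNoise G φ η (a s) (a' s) (V s))) :
    NoiseStep Q T (1 - η) p e (2 * η ^ 2 * σ ^ 2 + 8 * l ^ 2 * ∫ s, m s ∂Q) := by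
  have hdiff : Integrable (fun s => ‖a s - a' s‖ ^ 2) Q :=
    hm.mono' ((ha.sub ha').norm.pow_const 2).aestronglyMeasurable
      (Filter.Eventually.of_forall fun s => by
        rw [Real.norm_of_nonneg (by positivity)]; exact hD s)
  obtain ⟨hL, hv, ho⟩ := h.noise_estimate hms hφ hX hY hXc hYc hη hη1 hsplit π hπ ha ha'
    (fun s => haX (T s)) (fun s => ha'X (T s)) (by simpa only [haT, ha'T] using hdiff)
  simp only [haT, ha'T] at hL hv ho
  set N : Ω → Vec d := fun s => π (oracleNoise G φ η (a s) (a' s) (V s)) with hN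
  have ho' : ∀ q : Ω → Vec d, Measurable q → (∀ s, q (T s) = q s) → MemLp q 2 Q →
      ∫ s, inner ℝ (q s) (N s) ∂Q = 0 := fun q hq hqT hqL => by
    simpa only [hqT] using ho q hq (by simpa only [hqT] using hqL)
  have hee : e = fun s => (1 - η) • p s + N s := funext he
  have hcp : MemLp (fun s => (1 - η) • p s) 2 Q := hpL.const_smul (1 - η)
  have hin : ∀ q : Ω → Vec d, Measurable q → (∀ s, q (T s) = q s) → MemLp q 2 Q →
      ∫ s, inner ℝ (q s) (e s) ∂Q = (1 - η) * ∫ s, inner ℝ (q s) (p s) ∂Q := by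
    intro q hq hqT hqL
    have e1 : ∀ s, inner ℝ (q s) (e s) = (1 - η) * inner ℝ (q s) (p s) + inner ℝ (q s) (N s) :=
      fun s => by rw [he, inner_add_right, real_inner_smul_right]
    have e2 := integral_add ((integrable_inner_of_memLp hqL hpL).const_mul (1 - η))
      (integrable_inner_of_memLp hqL hL)
    simp only [e1]
    rw [e2, ho' q hq hqT hqL, integral_const_mul, add_zero]
  have heL : MemLp e 2 Q := by rw [hee]; exact hcp.add hL
  refine ⟨heL, ?_, hin⟩
  have e3 : ∀ s, ‖e s‖ ^ 2 = (1 - η) ^ 2 * ‖p s‖ ^ 2 + (2 * (1 - η) * inner ℝ (p s) (N s)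
      + ‖N s‖ ^ 2) := fun s => by
    rw [he, norm_add_sq_real, norm_smul, mul_pow, Real.norm_eq_abs, sq_abs, real_inner_smul_left]
    ring
  have i1 := (memLp_two_iff_integrable_sq_norm hpL.1).1 hpL
  have i2 := (memLp_two_iff_integrable_sq_norm hL.1).1 hL
  have i3 := integrable_inner_of_memLp hpL hL
  have e4 := integral_add (i1.const_mul ((1 - η) ^ 2)) ((i3.const_mul (2 * (1 - η))).add i2)
  have e5 := integral_add (i3.const_mul (2 * (1 - η))) i2
  simp only [Pi.add_apply] at e4
  simp only [e3]
  rw [e4, e5, integral_const_mul, integral_const_mul, ho' p hp hpT hpL]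
  have h3 : ∫ s, ‖a s - a' s‖ ^ 2 ∂Q ≤ ∫ s, m s ∂Q := integral_mono hdiff hm hD
  have h4 : 8 * l ^ 2 * ∫ s, ‖a s - a' s‖ ^ 2 ∂Q ≤ 8 * l ^ 2 * ∫ s, m s ∂Q := by gcongr
  linarith

namespace Alg

variable {dx dy : ℕ} {Z Ξ : Type*} [MeasurableSpace Z] [MeasurableSpace Ξ]
  {B : Bilevel dx dy Z Ξ} {p : ProblemConsts} {I : AlgInput dx dy}

/-- The error of the estimator `f̃_wy` stored in the state. -/
noncomputable def devFwy (B : Bilevel dx dy Z Ξ) (st : AlgState dx dy) : Vec dy := st.fwyp - B.fy st.xp st.wyp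

/-- The error of the estimator `g̃_wy` stored in the state. -/
noncomputable def devGwy (B : Bilevel dx dy Z Ξ) (st : AlgState dx dy) : Vec dy := st.gwyp - B.gy st.xp st.wyp

/-- The error of the estimator `g̃_wz` stored in the state. -/
noncomputable def devGwz (B : Bilevel dx dy Z Ξ) (st : AlgState dx dy) : Vec dy := st.gwzp - B.gy st.xp st.wzp

/-- The error of the estimator `f̃_x` stored in the state. -/
noncomputable def devFx (B : Bilevel dx dy Z Ξ) (st : AlgState dx dy) : Vec dx := st.fxp - B.fx st.xp st.wy

/-- The error of the estimator `g̃_xy` stored in the state. -/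
noncomputable def devGxy (B : Bilevel dx dy Z Ξ) (st : AlgState dx dy) : Vec dx := st.gxyp - B.gx st.xp st.wy

/-- The error of the estimator `g̃_xz` stored in the state. -/
noncomputable def devGxz (B : Bilevel dx dy Z Ξ) (st : AlgState dx dy) : Vec dx := st.gxzp - B.gx st.xp st.wz

/-- The squared displacement of `x` in the last iteration. -/
noncomputable def dispX (st : AlgState dx dy) : ℝ := ‖st.x - st.xp‖ ^ 2

/-- The squared displacement of `(w_y, w_z)` in the last iteration. -/
noncomputable def dispW (st : AlgState dx dy) : ℝ := ‖st.wy - st.wyp‖ ^ 2 + ‖st.wz - st.wzp‖ ^ 2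

theorem measurable_grad_comp (φ : Joint dx dy → ℝ) {α : Type*} [MeasurableSpace α] {u : α → Vec dx} {v : α → Vec dy}
    (hu : Measurable u) (hv : Measurable v) : Measurable fun a => gradient φ (pt (u a) (v a)) :=
  (measurable_gradient φ).comp (measurable_pt hu hv)

section dev

variable {α : Type*} [MeasurableSpace α] {f : α → AlgState dx dy}

theorem MeasurableState.devFwy (hf : MeasurableState f) : Measurable fun a => devFwy B (f a) :=
  hf.fwyp.sub (measurable_joint_snd.comp (measurable_grad_comp B.f hf.xp hf.wyp))

theorem MeasurableState.devGwy (hf : MeasurableState f) : Measurable fun a => devGwy B (f a) :=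
  hf.gwyp.sub (measurable_joint_snd.comp (measurable_grad_comp B.g hf.xp hf.wyp))

theorem MeasurableState.devGwz (hf : MeasurableState f) : Measurable fun a => devGwz B (f a) :=
  hf.gwzp.sub (measurable_joint_snd.comp (measurable_grad_comp B.g hf.xp hf.wzp))

theorem MeasurableState.devFx (hf : MeasurableState f) : Measurable fun a => devFx B (f a) :=
  hf.fxp.sub (measurable_joint_fst.comp (measurable_grad_comp B.f hf.xp hf.wy))

theorem MeasurableState.devGxy (hf : MeasurableState f) : Measurable fun a => devGxy B (f a) :=
  hf.gxyp.sub (measurable_joint_fst.comp (measurable_grad_comp B.g hf.xp hf.wy))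

theorem MeasurableState.devGxz (hf : MeasurableState f) : Measurable fun a => devGxz B (f a) :=
  hf.gxzp.sub (measurable_joint_fst.comp (measurable_grad_comp B.g hf.xp hf.wz))

end dev

/-- The state after `k` iterations is square integrable. -/
structure StateL2 (B : Bilevel dx dy Z Ξ) (I : AlgInput dx dy) (Q : Measure (ℕ → Seeds Z Ξ))
    (k : ℕ) : Prop where
  x : MemLp (fun s => (state B I s k).x) 2 Q
  xp : MemLp (fun s => (state B I s k).xp) 2 Q
  devFwy : MemLp (fun s => devFwy B (state B I s k)) 2 Q
  devGwy : MemLp (fun s => devGwy B (state B I s k)) 2 Q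
  devGwz : MemLp (fun s => devGwz B (state B I s k)) 2 Q
  devFx : MemLp (fun s => devFx B (state B I s k)) 2 Q
  devGxy : MemLp (fun s => devGxy B (state B I s k)) 2 Q
  devGxz : MemLp (fun s => devGxz B (state B I s k)) 2 Q

variable {s₀ : Seeds Z Ξ} {Q : Measure (ℕ → Seeds Z Ξ)} {k : ℕ}

/-- A measurable function with values in `Y` is square integrable. -/
theorem memLp_of_mem_Y (hB : B.Assumptions p I.ρ) {α : Type*} [MeasurableSpace α] {Q : Measure α}
    [IsFiniteMeasure Q] {w : α → Vec dy} (hw : Measurable w)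
    (hY : ∀ a, w a ∈ B.Y) : MemLp w 2 Q :=
  MemLp.of_bound hw.aestronglyMeasurable p.DY (Filter.Eventually.of_forall fun a => hB.bounded_Y _ (hY a))

theorem memLp_pt {α : Type*} [MeasurableSpace α] {Q : Measure α} {u : α → Vec dx} {v : α → Vec dy}
    (hu : Measurable u) (hv : Measurable v) (hu2 : MemLp u 2 Q) (hv2 : MemLp v 2 Q) :
    MemLp (fun a => pt (u a) (v a)) 2 Q :=
  (hu2.norm.add hv2.norm).mono' (measurable_pt hu hv).aestronglyMeasurable
    (Filter.Eventually.of_forall fun _ => norm_joint_le _)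

theorem integrable_dispX (h : StateL2 B I Q k) : Integrable (fun s => dispX (state B I s k)) Q :=
  have := h.x.sub h.xp
  (memLp_two_iff_integrable_sq_norm this.1).1 this

variable [IsProbabilityMeasure Q]

theorem integrable_dispW (hB : B.Assumptions p I.ρ) (hI : Admissible B p I) (k : ℕ) :
    Integrable (fun s => dispW (state B I s k)) Q := by
  have hm := measurableState_state hB hI k
  have hF := fun s => feasible_state hB hI s k
  have h1 := (memLp_of_mem_Y (Q := Q) hB hm.wy fun s => (hF s).wy).sub
    (memLp_of_mem_Y (Q := Q) hB hm.wyp fun s => (hF s).wyp)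
  have h2 := (memLp_of_mem_Y (Q := Q) hB hm.wz fun s => (hF s).wz).sub
    (memLp_of_mem_Y (Q := Q) hB hm.wzp fun s => (hF s).wzp)
  exact ((memLp_two_iff_integrable_sq_norm h1.1).1 h1).add
    ((memLp_two_iff_integrable_sq_norm h2.1).1 h2)

/-- The second-moment bound for the noise of the estimators for `w`. -/
noncomputable def boundW (B : Bilevel dx dy Z Ξ) (I : AlgInput dx dy) (Q : Measure (ℕ → Seeds Z Ξ)) (k : ℕ)
    (l v : ℝ) : ℝ :=
  2 * I.η k ^ 2 * v ^ 2 + 8 * l ^ 2 * ∫ s, (dispX (state B I s k) + dispW (state B I s k)) ∂Q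

/-- The second-moment bound for the noise of the estimators for `x`. -/
noncomputable def boundX (B : Bilevel dx dy Z Ξ) (I : AlgInput dx dy) (Q : Measure (ℕ → Seeds Z Ξ)) (k : ℕ)
    (l v : ℝ) : ℝ :=
  2 * I.η k ^ 2 * v ^ 2 + 8 * l ^ 2 * ∫ s, (dispX (state B I s k) + dispW (state B I s (k + 1))) ∂Q

theorem norm_pt_sub_sq (x x' : Vec dx) (y y' : Vec dy) :
    ‖pt x y - pt x' y'‖ ^ 2 = ‖x - x'‖ ^ 2 + ‖y - y'‖ ^ 2 := joint_norm_sq _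

/-- The error of a momentum estimator in terms of the previous error and the noise of the oracle. -/
theorem dev_eq {S : Type*} {G : Joint dx dy → S → Joint dx dy} {φ : Joint dx dy → ℝ} (η : ℝ) {d : ℕ}
    (π : Joint dx dy →L[ℝ] Vec d) (a a' : Joint dx dy) (v : S) (est : Vec d) :
    momentum η (π (G a v)) est (π (G a' v)) - π (gradient φ a)
      = (1 - η) • (est - π (gradient φ a')) + π (oracleNoise G φ η a a' v) := by
  simp only [oracleNoise, map_sub, map_smul, momentum]
  module

/-- Both query points and the old error are fixed before iteration k, so masking does not change
them. The other estimators differ in oracle, erased seed, component and query points. -/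
theorem noiseStep_Fwy (hB : B.Assumptions p I.ρ) (hI : Admissible B p I) (hQ : FreshSeeds B s₀ Q)
    (h : StateL2 B I Q k) :
    NoiseStep Q (mask s₀ k fun s => (s₀.ζwy, s.2)) (1 - I.η k)
      (fun s => devFwy B (state B I s k)) (fun s => devFwy B (state B I s (k + 1)))
      (boundW B I Q k p.lf1 p.σf) := by
  have := hB.prob_ζ
  have := hB.prob_ξ
  have hm := measurableState_state hB hI k
  have hF := fun s => feasible_state hB hI s k
  refine hB.oracle_f.noiseStep hB.mss_f hB.smooth_f hB.convex_X hB.convex_Y hB.closed_X hB.closed_Y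
    (hI.η_pos k).le (hI.η_le k) (hQ.split (split_ζwy s₀) k) (WithLp.sndL 2 ℝ (Vec dx) (Vec dy))
    norm_snd_le_joint (measurable_pt hm.x hm.wy) (measurable_pt hm.xp hm.wyp)
    (fun s => by rw [state_mask]) (fun s => by rw [state_mask]) (fun s => ⟨(hF s).x, (hF s).wy⟩)
    (fun s => ⟨(hF s).xp, (hF s).wyp⟩) ((integrable_dispX h).add (integrable_dispW hB hI k))
    (fun s => ?_) hm.devFwy (fun s => by rw [state_mask]) h.devFwy (fun s => ?_)
  · rw [norm_pt_sub_sq]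
    simp only [dispX, dispW, Pi.add_apply]
    linarith [sq_nonneg ‖(state B I s k).wz - (state B I s k).wzp‖]
  · exact dev_eq (I.η k) (WithLp.sndL 2 ℝ (Vec dx) (Vec dy)) _ _ _ _

theorem noiseStep_Gwy (hB : B.Assumptions p I.ρ) (hI : Admissible B p I) (hQ : FreshSeeds B s₀ Q)
    (h : StateL2 B I Q k) :
    NoiseStep Q (mask s₀ k fun s => (s.1, s.2.1, s₀.ξwy, s.2.2.2)) (1 - I.η k)
      (fun s => devGwy B (state B I s k)) (fun s => devGwy B (state B I s (k + 1)))
      (boundW B I Q k p.lg1 p.σg) := by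
  have := hB.prob_ζ
  have := hB.prob_ξ
  have hm := measurableState_state hB hI k
  have hF := fun s => feasible_state hB hI s k
  refine hB.oracle_g.noiseStep hB.mss_g hB.smooth_g hB.convex_X hB.convex_Y hB.closed_X hB.closed_Y
    (hI.η_pos k).le (hI.η_le k) (hQ.split (split_ξwy s₀) k) (WithLp.sndL 2 ℝ (Vec dx) (Vec dy))
    norm_snd_le_joint (measurable_pt hm.x hm.wy) (measurable_pt hm.xp hm.wyp)
    (fun s => by rw [state_mask]) (fun s => by rw [state_mask]) (fun s => ⟨(hF s).x, (hF s).wy⟩)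
    (fun s => ⟨(hF s).xp, (hF s).wyp⟩) ((integrable_dispX h).add (integrable_dispW hB hI k))
    (fun s => ?_) hm.devGwy (fun s => by rw [state_mask]) h.devGwy (fun s => ?_)
  · rw [norm_pt_sub_sq]
    simp only [dispX, dispW, Pi.add_apply]
    linarith [sq_nonneg ‖(state B I s k).wz - (state B I s k).wzp‖]
  · exact dev_eq (I.η k) (WithLp.sndL 2 ℝ (Vec dx) (Vec dy)) _ _ _ _

theorem noiseStep_Gwz (hB : B.Assumptions p I.ρ) (hI : Admissible B p I) (hQ : FreshSeeds B s₀ Q)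
    (h : StateL2 B I Q k) :
    NoiseStep Q (mask s₀ k fun s => (s.1, s.2.1, s.2.2.1, s₀.ξwz, s.2.2.2.2)) (1 - I.η k)
      (fun s => devGwz B (state B I s k)) (fun s => devGwz B (state B I s (k + 1)))
      (boundW B I Q k p.lg1 p.σg) := by
  have := hB.prob_ζ
  have := hB.prob_ξ
  have hm := measurableState_state hB hI k
  have hF := fun s => feasible_state hB hI s k
  refine hB.oracle_g.noiseStep hB.mss_g hB.smooth_g hB.convex_X hB.convex_Y hB.closed_X hB.closed_Y
    (hI.η_pos k).le (hI.η_le k) (hQ.split (split_ξwz s₀) k) (WithLp.sndL 2 ℝ (Vec dx) (Vec dy))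
    norm_snd_le_joint (measurable_pt hm.x hm.wz) (measurable_pt hm.xp hm.wzp)
    (fun s => by rw [state_mask]) (fun s => by rw [state_mask]) (fun s => ⟨(hF s).x, (hF s).wz⟩)
    (fun s => ⟨(hF s).xp, (hF s).wzp⟩) ((integrable_dispX h).add (integrable_dispW hB hI k))
    (fun s => ?_) hm.devGwz (fun s => by rw [state_mask]) h.devGwz (fun s => ?_)
  · rw [norm_pt_sub_sq]
    simp only [dispX, dispW, Pi.add_apply]
    linarith [sq_nonneg ‖(state B I s k).wy - (state B I s k).wyp‖]
  · exact dev_eq (I.η k) (WithLp.sndL 2 ℝ (Vec dx) (Vec dy)) _ _ _ _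

/-- The query point contains w_{y,k+1}, which depends on seeds of iteration k but not on ζ_x, so
erasing ζ_x leaves it unchanged. The relevant displacements are x_k - x_{k-1} and w_{k+1} - w_k. -/
theorem noiseStep_Fx (hB : B.Assumptions p I.ρ) (hI : Admissible B p I) (hQ : FreshSeeds B s₀ Q)
    (h : StateL2 B I Q k) :
    NoiseStep Q (mask s₀ k fun s => (s.1, s₀.ζx, s.2.2)) (1 - I.η k)
      (fun s => devFx B (state B I s k)) (fun s => devFx B (state B I s (k + 1)))
      (boundX B I Q k p.lf1 p.σf) := by
  have := hB.prob_ζ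
  have := hB.prob_ξ
  have hm := measurableState_state hB hI k
  have hm' := measurableState_state hB hI (k + 1)
  have hF := fun s => feasible_state hB hI s k
  have hF' := fun s => feasible_state hB hI s (k + 1)
  refine hB.oracle_f.noiseStep hB.mss_f hB.smooth_f hB.convex_X hB.convex_Y hB.closed_X hB.closed_Y
    (hI.η_pos k).le (hI.η_le k) (hQ.split (split_ζx s₀) k) (WithLp.fstL 2 ℝ (Vec dx) (Vec dy))
    norm_fst_le_joint (measurable_pt hm.x hm'.wy) (measurable_pt hm.xp hm.wy)
    (fun s => by rw [state_mask, state_succ_mask]; rfl) (fun s => by rw [state_mask])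
    (fun s => ⟨(hF s).x, (hF' s).wy⟩) (fun s => ⟨(hF s).xp, (hF s).wy⟩)
    ((integrable_dispX h).add (integrable_dispW hB hI (k + 1)))
    (fun s => ?_) hm.devFx (fun s => by rw [state_mask]) h.devFx (fun s => ?_)
  · rw [norm_pt_sub_sq]
    simp only [dispX, dispW, Pi.add_apply]
    have h1 : (state B I s (k + 1)).wyp = (state B I s k).wy := rfl
    rw [h1]
    linarith [sq_nonneg ‖(state B I s (k + 1)).wz - (state B I s (k + 1)).wzp‖]
  · exact dev_eq (I.η k) (WithLp.fstL 2 ℝ (Vec dx) (Vec dy)) _ _ _ _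

theorem noiseStep_Gxy (hB : B.Assumptions p I.ρ) (hI : Admissible B p I) (hQ : FreshSeeds B s₀ Q)
    (h : StateL2 B I Q k) :
    NoiseStep Q (mask s₀ k fun s => (s.1, s.2.1, s.2.2.1, s.2.2.2.1, s₀.ξxy, s.2.2.2.2.2)) (1 - I.η k)
      (fun s => devGxy B (state B I s k)) (fun s => devGxy B (state B I s (k + 1)))
      (boundX B I Q k p.lg1 p.σg) := by
  have := hB.prob_ζ
  have := hB.prob_ξ
  have hm := measurableState_state hB hI k
  have hm' := measurableState_state hB hI (k + 1)
  have hF := fun s => feasible_state hB hI s k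
  have hF' := fun s => feasible_state hB hI s (k + 1)
  refine hB.oracle_g.noiseStep hB.mss_g hB.smooth_g hB.convex_X hB.convex_Y hB.closed_X hB.closed_Y
    (hI.η_pos k).le (hI.η_le k) (hQ.split (split_ξxy s₀) k) (WithLp.fstL 2 ℝ (Vec dx) (Vec dy))
    norm_fst_le_joint (measurable_pt hm.x hm'.wy) (measurable_pt hm.xp hm.wy)
    (fun s => by rw [state_mask, state_succ_mask]; rfl) (fun s => by rw [state_mask])
    (fun s => ⟨(hF s).x, (hF' s).wy⟩) (fun s => ⟨(hF s).xp, (hF s).wy⟩)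
    ((integrable_dispX h).add (integrable_dispW hB hI (k + 1)))
    (fun s => ?_) hm.devGxy (fun s => by rw [state_mask]) h.devGxy (fun s => ?_)
  · rw [norm_pt_sub_sq]
    simp only [dispX, dispW, Pi.add_apply]
    have h1 : (state B I s (k + 1)).wyp = (state B I s k).wy := rfl
    rw [h1]
    linarith [sq_nonneg ‖(state B I s (k + 1)).wz - (state B I s (k + 1)).wzp‖]
  · exact dev_eq (I.η k) (WithLp.fstL 2 ℝ (Vec dx) (Vec dy)) _ _ _ _

theorem noiseStep_Gxz (hB : B.Assumptions p I.ρ) (hI : Admissible B p I) (hQ : FreshSeeds B s₀ Q)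
    (h : StateL2 B I Q k) :
    NoiseStep Q (mask s₀ k fun s => (s.1, s.2.1, s.2.2.1, s.2.2.2.1, s.2.2.2.2.1, s₀.ξxz)) (1 - I.η k)
      (fun s => devGxz B (state B I s k)) (fun s => devGxz B (state B I s (k + 1)))
      (boundX B I Q k p.lg1 p.σg) := by
  have := hB.prob_ζ
  have := hB.prob_ξ
  have hm := measurableState_state hB hI k
  have hm' := measurableState_state hB hI (k + 1)
  have hF := fun s => feasible_state hB hI s k
  have hF' := fun s => feasible_state hB hI s (k + 1)
  refine hB.oracle_g.noiseStep hB.mss_g hB.smooth_g hB.convex_X hB.convex_Y hB.closed_X hB.closed_Y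
    (hI.η_pos k).le (hI.η_le k) (hQ.split (split_ξxz s₀) k) (WithLp.fstL 2 ℝ (Vec dx) (Vec dy))
    norm_fst_le_joint (measurable_pt hm.x hm'.wz) (measurable_pt hm.xp hm.wz)
    (fun s => by rw [state_mask, state_succ_mask]; rfl) (fun s => by rw [state_mask])
    (fun s => ⟨(hF s).x, (hF' s).wz⟩) (fun s => ⟨(hF s).xp, (hF s).wz⟩)
    ((integrable_dispX h).add (integrable_dispW hB hI (k + 1)))
    (fun s => ?_) hm.devGxz (fun s => by rw [state_mask]) h.devGxz (fun s => ?_)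
  · rw [norm_pt_sub_sq]
    simp only [dispX, dispW, Pi.add_apply]
    have h1 : (state B I s (k + 1)).wzp = (state B I s k).wz := rfl
    rw [h1]
    linarith [sq_nonneg ‖(state B I s (k + 1)).wy - (state B I s (k + 1)).wyp‖]
  · exact dev_eq (I.η k) (WithLp.fstL 2 ℝ (Vec dx) (Vec dy)) _ _ _ _

end Alg

/-! ### Square integrability of the iterates, orthogonality and moment recursions. -/

namespace Alg

variable {dx dy : ℕ} {Z Ξ : Type*} [MeasurableSpace Z] [MeasurableSpace Ξ]
  {B : Bilevel dx dy Z Ξ} {p : ProblemConsts} {I : AlgInput dx dy}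
  {s₀ : Seeds Z Ξ} {Q : Measure (ℕ → Seeds Z Ξ)}

/-- X may be unbounded, so gradients need not be bounded; being Lipschitz they grow at most linearly
in x. -/
theorem memLp_gradient (hB : B.Assumptions p I.ρ) {φ : Joint dx dy → ℝ} {l : ℝ}
    (hφ : B.SmoothOn φ l) {α : Type*} [MeasurableSpace α] {Q : Measure α} [IsFiniteMeasure Q]
    {u : α → Vec dx} {v : α → Vec dy} (hu : Measurable u) (hv : Measurable v)
    (hu2 : MemLp u 2 Q) (huX : ∀ a, u a ∈ B.X) (hvY : ∀ a, v a ∈ B.Y) {q : Joint dx dy}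
    (hq : q ∈ jointSet B.X B.Y) : MemLp (fun a => gradient φ (pt (u a) (v a))) 2 Q := by
  have h1 := memLp_pt hu hv hu2 (memLp_of_mem_Y (I := I) hB hv hvY)
  have h2 := (memLp_const (μ := Q) (p := 2) ‖gradient φ q‖).add
    ((h1.sub (memLp_const q)).norm.const_mul l)
  refine h2.mono' (measurable_grad_comp φ hu hv).aestronglyMeasurable
    (Filter.Eventually.of_forall fun a => ?_)
  have h3 := hφ.norm_gradient_sub_le hB.convex_X hB.convex_Y hq
    (show pt (u a) (v a) ∈ jointSet B.X B.Y from ⟨huX a, hvY a⟩)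
  have h4 := norm_le_insert' (gradient φ (pt (u a) (v a))) (gradient φ q)
  simp only [Pi.add_apply, Pi.sub_apply]
  linarith

theorem memLp_gradient_fst (hB : B.Assumptions p I.ρ) {φ : Joint dx dy → ℝ} {l : ℝ}
    (hφ : B.SmoothOn φ l) {α : Type*} [MeasurableSpace α] {Q : Measure α} [IsFiniteMeasure Q]
    {u : α → Vec dx} {v : α → Vec dy} (hu : Measurable u) (hv : Measurable v)
    (hu2 : MemLp u 2 Q) (huX : ∀ a, u a ∈ B.X) (hvY : ∀ a, v a ∈ B.Y) {q : Joint dx dy}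
    (hq : q ∈ jointSet B.X B.Y) : MemLp (fun a => (gradient φ (pt (u a) (v a))).fst) 2 Q :=
  (memLp_gradient (I := I) hB hφ hu hv hu2 huX hvY hq).norm.mono'
    (measurable_joint_fst.comp (measurable_grad_comp φ hu hv)).aestronglyMeasurable
    (Filter.Eventually.of_forall fun _ => norm_fst_le_joint _)

/-- Integrability of x must be propagated. Nonexpansiveness of the projection bounds ‖x_{k+1} - x_k‖
by α_k times the norm of the direction, and each estimator is its error plus a gradient, both square
integrable. -/
theorem stateL2 (hB : B.Assumptions p I.ρ) (hI : Admissible B p I) (hQ : FreshSeeds B s₀ Q)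
    [IsProbabilityMeasure Q] (k : ℕ) : StateL2 B I Q k := by
  induction k with
  | zero =>
    exact ⟨memLp_const I.x₀, memLp_const I.x₀, memLp_const (devFwy B (init I)),
      memLp_const (devGwy B (init I)), memLp_const (devGwz B (init I)),
      memLp_const (devFx B (init I)), memLp_const (devGxy B (init I)), memLp_const (devGxz B (init I))⟩
  | succ k ih =>
    have hm := measurableState_state hB hI k
    have hm' := measurableState_state hB hI (k + 1)
    have hF := fun s => feasible_state hB hI s k
    have hF' := fun s => feasible_state hB hI s (k + 1)
    have hq : pt I.x₀ I.y₀ ∈ jointSet B.X B.Y := ⟨hI.x₀_mem, hI.y₀_mem⟩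
    have hFx := (noiseStep_Fx hB hI hQ ih).memLp
    have hGxy := (noiseStep_Gxy hB hI hQ ih).memLp
    have hGxz := (noiseStep_Gxz hB hI hQ ih).memLp
    refine ⟨?_, ih.x, (noiseStep_Fwy hB hI hQ ih).memLp, (noiseStep_Gwy hB hI hQ ih).memLp,
      (noiseStep_Gwz hB hI hQ ih).memLp, hFx, hGxy, hGxz⟩
    have h1 := hFx.add (memLp_gradient_fst (I := I) hB hB.smooth_f hm.x hm'.wy ih.x
      (fun s => (hF s).x) (fun s => (hF' s).wy) hq)
    have h2 := hGxy.add (memLp_gradient_fst (I := I) hB hB.smooth_g hm.x hm'.wy ih.x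
      (fun s => (hF s).x) (fun s => (hF' s).wy) hq)
    have h3 := hGxz.add (memLp_gradient_fst (I := I) hB hB.smooth_g hm.x hm'.wz ih.x
      (fun s => (hF s).x) (fun s => (hF' s).wz) hq)
    have h4 := (((h1.const_smul (I.σ k)).add h2).sub h3).const_smul (I.α k)
    refine (ih.x.norm.add h4.norm).mono' hm'.x.aestronglyMeasurable
      (Filter.Eventually.of_forall fun s => ?_)
    have h5 := (proj_spec hB.convex_X hB.closed_X ⟨_, (hF s).x⟩ (state B I s k).x)
    have h6 := norm_proj_sub_le_of_vi hB.convex_X hB.closed_X (hF s).x (a := (state B I s k).x)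
      (fun z _ => by simp) ((state B I s k).x - I.α k • (I.σ k • estFx B I k (state B I s k) (s k)
        + estGxy B I k (state B I s k) (s k) - estGxz B I k (state B I s k) (s k)))
    have h7 := norm_le_insert' (state B I s (k + 1)).x (state B I s k).x
    have e : ((I.α k • ((I.σ k • ((fun s => devFx B (state B I s (k + 1))) + fun s =>
          (gradient B.f (pt (state B I s k).x (state B I s (k + 1)).wy)).fst)
        + ((fun s => devGxy B (state B I s (k + 1))) + fun s =>
          (gradient B.g (pt (state B I s k).x (state B I s (k + 1)).wy)).fst))
        - ((fun s => devGxz B (state B I s (k + 1))) + fun s =>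
          (gradient B.g (pt (state B I s k).x (state B I s (k + 1)).wz)).fst))) s)
        = I.α k • (I.σ k • estFx B I k (state B I s k) (s k)
        + estGxy B I k (state B I s k) (s k) - estGxz B I k (state B I s k) (s k)) := by
      have e1 : devFx B (state B I s (k + 1)) + B.fx (state B I s k).x (state B I s (k + 1)).wy
          = estFx B I k (state B I s k) (s k) := sub_add_cancel _ _
      have e2 : devGxy B (state B I s (k + 1)) + B.gx (state B I s k).x (state B I s (k + 1)).wy
          = estGxy B I k (state B I s k) (s k) := sub_add_cancel _ _
      have e3 : devGxz B (state B I s (k + 1)) + B.gx (state B I s k).x (state B I s (k + 1)).wz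
          = estGxz B I k (state B I s k) (s k) := sub_add_cancel _ _
      rw [← e1, ← e2, ← e3]
      rfl
    rw [Pi.add_apply, e]
    rw [sub_sub_cancel_left, norm_neg] at h6
    exact h7.trans (add_le_add_right h6 _)

/-- Records which seeds an error uses, for the invariance required by `NoiseStep.cross`. -/
theorem devFwy_step_congr {st : AlgState dx dy} {s s' : Seeds Z Ξ} {k : ℕ} (h : s.ζwy = s'.ζwy) :
    devFwy B (step B I k st s) = devFwy B (step B I k st s') := by
  simp only [devFwy, step, estFwy, h]

theorem nextWy_congr {st : AlgState dx dy} {s s' : Seeds Z Ξ} {k : ℕ} (h : s.ζwy = s'.ζwy)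
    (h' : s.ξwy = s'.ξwy) : nextWy B I k st s = nextWy B I k st s' := by
  simp only [nextWy, estFwy, estGwy, h, h']

theorem devFx_step_congr {st : AlgState dx dy} {s s' : Seeds Z Ξ} {k : ℕ} (h : s.ζwy = s'.ζwy)
    (h' : s.ξwy = s'.ξwy) (hx : s.ζx = s'.ζx) :
    devFx B (step B I k st s) = devFx B (step B I k st s') := by
  simp only [devFx, step, estFx, nextWy_congr h h', hx]

theorem devGxy_step_congr {st : AlgState dx dy} {s s' : Seeds Z Ξ} {k : ℕ} (h : s.ζwy = s'.ζwy)
    (h' : s.ξwy = s'.ξwy) (hx : s.ξxy = s'.ξxy) :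
    devGxy B (step B I k st s) = devGxy B (step B I k st s') := by
  simp only [devGxy, step, estGxy, nextWy_congr h h', hx]

section Moments

variable [IsProbabilityMeasure Q]

/-- Induction on k by `NoiseStep.cross`. It starts because η₀ = 1 annihilates the placeholder errors
of the initial state. Orthogonality is needed for those pairs of errors that are added in the same
e_k. -/
theorem cross_Fwy_Gwy (hB : B.Assumptions p I.ρ) (hI : Admissible B p I) (hQ : FreshSeeds B s₀ Q)
    (k : ℕ) : ∫ s, inner ℝ (devFwy B (state B I s (k + 1))) (devGwy B (state B I s (k + 1))) ∂Q = 0 := by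
  have key : ∀ k, (1 - I.η k) * ∫ s, inner ℝ (devFwy B (state B I s k)) (devGwy B (state B I s k)) ∂Q = 0
      → ∫ s, inner ℝ (devFwy B (state B I s (k + 1))) (devGwy B (state B I s (k + 1))) ∂Q = 0 :=
    fun k h0 => (noiseStep_Fwy hB hI hQ (stateL2 hB hI hQ k)).cross
      (noiseStep_Gwy hB hI hQ (stateL2 hB hI hQ k)) (measurableState_state hB hI (k + 1)).devFwy
      (fun s => by rw [state_succ_mask]; exact devFwy_step_congr rfl) (measurableState_state hB hI k).devGwy
      (fun s => by rw [state_mask]) (stateL2 hB hI hQ k).devGwy h0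
  induction k with
  | zero => exact key 0 (by rw [hI.η_zero, sub_self, zero_mul])
  | succ k ih => exact key (k + 1) (by rw [ih, mul_zero])

theorem cross_Fx_Gxy (hB : B.Assumptions p I.ρ) (hI : Admissible B p I) (hQ : FreshSeeds B s₀ Q)
    (k : ℕ) : ∫ s, inner ℝ (devFx B (state B I s (k + 1))) (devGxy B (state B I s (k + 1))) ∂Q = 0 := by
  have key : ∀ k, (1 - I.η k) * ∫ s, inner ℝ (devFx B (state B I s k)) (devGxy B (state B I s k)) ∂Q = 0
      → ∫ s, inner ℝ (devFx B (state B I s (k + 1))) (devGxy B (state B I s (k + 1))) ∂Q = 0 :=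
    fun k h0 => (noiseStep_Fx hB hI hQ (stateL2 hB hI hQ k)).cross
      (noiseStep_Gxy hB hI hQ (stateL2 hB hI hQ k)) (measurableState_state hB hI (k + 1)).devFx
      (fun s => by rw [state_succ_mask]; exact devFx_step_congr rfl rfl rfl) (measurableState_state hB hI k).devGxy
      (fun s => by rw [state_mask]) (stateL2 hB hI hQ k).devGxy h0
  induction k with
  | zero => exact key 0 (by rw [hI.η_zero, sub_self, zero_mul])
  | succ k ih => exact key (k + 1) (by rw [ih, mul_zero])

theorem cross_Fx_Gxz (hB : B.Assumptions p I.ρ) (hI : Admissible B p I) (hQ : FreshSeeds B s₀ Q)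
    (k : ℕ) : ∫ s, inner ℝ (devFx B (state B I s (k + 1))) (devGxz B (state B I s (k + 1))) ∂Q = 0 := by
  have key : ∀ k, (1 - I.η k) * ∫ s, inner ℝ (devFx B (state B I s k)) (devGxz B (state B I s k)) ∂Q = 0
      → ∫ s, inner ℝ (devFx B (state B I s (k + 1))) (devGxz B (state B I s (k + 1))) ∂Q = 0 :=
    fun k h0 => (noiseStep_Fx hB hI hQ (stateL2 hB hI hQ k)).cross
      (noiseStep_Gxz hB hI hQ (stateL2 hB hI hQ k)) (measurableState_state hB hI (k + 1)).devFx
      (fun s => by rw [state_succ_mask]; exact devFx_step_congr rfl rfl rfl) (measurableState_state hB hI k).devGxz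
      (fun s => by rw [state_mask]) (stateL2 hB hI hQ k).devGxz h0
  induction k with
  | zero => exact key 0 (by rw [hI.η_zero, sub_self, zero_mul])
  | succ k ih => exact key (k + 1) (by rw [ih, mul_zero])

theorem cross_Gxy_Gxz (hB : B.Assumptions p I.ρ) (hI : Admissible B p I) (hQ : FreshSeeds B s₀ Q)
    (k : ℕ) : ∫ s, inner ℝ (devGxy B (state B I s (k + 1))) (devGxz B (state B I s (k + 1))) ∂Q = 0 := by
  have key : ∀ k, (1 - I.η k) * ∫ s, inner ℝ (devGxy B (state B I s k)) (devGxz B (state B I s k)) ∂Q = 0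
      → ∫ s, inner ℝ (devGxy B (state B I s (k + 1))) (devGxz B (state B I s (k + 1))) ∂Q = 0 :=
    fun k h0 => (noiseStep_Gxy hB hI hQ (stateL2 hB hI hQ k)).cross
      (noiseStep_Gxz hB hI hQ (stateL2 hB hI hQ k)) (measurableState_state hB hI (k + 1)).devGxy
      (fun s => by rw [state_succ_mask]; exact devGxy_step_congr rfl rfl rfl) (measurableState_state hB hI k).devGxz
      (fun s => by rw [state_mask]) (stateL2 hB hI hQ k).devGxz h0
  induction k with
  | zero => exact key 0 (by rw [hI.η_zero, sub_self, zero_mul])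
  | succ k ih => exact key (k + 1) (by rw [ih, mul_zero])

end Moments

/-- The weighted second moments of the errors of the estimators for `w`. -/
noncomputable def momentW (B : Bilevel dx dy Z Ξ) (I : AlgInput dx dy) (Q : Measure (ℕ → Seeds Z Ξ)) (σ : ℝ)
    (k : ℕ) : ℝ :=
  σ ^ 2 * ∫ s, ‖devFwy B (state B I s k)‖ ^ 2 ∂Q + ∫ s, ‖devGwy B (state B I s k)‖ ^ 2 ∂Q
    + ∫ s, ‖devGwz B (state B I s k)‖ ^ 2 ∂Q

/-- The weighted second moments of the errors of the estimators for `x`. -/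
noncomputable def momentX (B : Bilevel dx dy Z Ξ) (I : AlgInput dx dy) (Q : Measure (ℕ → Seeds Z Ξ)) (σ : ℝ)
    (k : ℕ) : ℝ :=
  σ ^ 2 * ∫ s, ‖devFx B (state B I s k)‖ ^ 2 ∂Q + ∫ s, ‖devGxy B (state B I s k)‖ ^ 2 ∂Q
    + ∫ s, ‖devGxz B (state B I s k)‖ ^ 2 ∂Q

/-- The combined variance of the oracles at iteration `k`. -/
noncomputable def noiseLevel (p : ProblemConsts) (I : AlgInput dx dy) (k : ℕ) : ℝ :=
  I.σ k ^ 2 * p.σf ^ 2 + p.σg ^ 2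

theorem errWy_eq (s : ℕ → Seeds Z Ξ) (k : ℕ) : errWy B I s k
    = I.σ k • devFwy B (state B I s (k + 1)) + devGwy B (state B I s (k + 1)) := by
  have e1 : devFwy B (state B I s (k + 1)) = estFwy B I k (state B I s k) (s k)
      - B.fy (state B I s k).x (state B I s k).wy := rfl
  have e2 : devGwy B (state B I s (k + 1)) = estGwy B I k (state B I s k) (s k)
      - B.gy (state B I s k).x (state B I s k).wy := rfl
  rw [e1, e2, errWy]
  module

theorem errWz_eq (s : ℕ → Seeds Z Ξ) (k : ℕ) : errWz B I s k = devGwz B (state B I s (k + 1)) := rfl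

theorem errX_eq (s : ℕ → Seeds Z Ξ) (k : ℕ) : errX B I s k
    = I.σ k • devFx B (state B I s (k + 1)) + devGxy B (state B I s (k + 1))
      - devGxz B (state B I s (k + 1)) := by
  have e1 : devFx B (state B I s (k + 1)) = estFx B I k (state B I s k) (s k)
      - B.fx (state B I s k).x (state B I s (k + 1)).wy := rfl
  have e2 : devGxy B (state B I s (k + 1)) = estGxy B I k (state B I s k) (s k)
      - B.gx (state B I s k).x (state B I s (k + 1)).wy := rfl
  have e3 : devGxz B (state B I s (k + 1)) = estGxz B I k (state B I s k) (s k)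
      - B.gx (state B I s k).x (state B I s (k + 1)).wz := rfl
  rw [e1, e2, e3, errX]
  module

/-- Following the components separately makes the decrease of σ harmless: it only lowers the weight
of the f-error. -/
theorem momentW_mono {σ σ' : ℝ} (h0 : 0 ≤ σ) (h : σ ≤ σ') (k : ℕ) :
    momentW B I Q σ k ≤ momentW B I Q σ' k := by
  have h1 : 0 ≤ ∫ s, ‖devFwy B (state B I s k)‖ ^ 2 ∂Q := integral_nonneg fun _ => by positivity
  unfold momentW
  gcongr

theorem momentX_mono {σ σ' : ℝ} (h0 : 0 ≤ σ) (h : σ ≤ σ') (k : ℕ) :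
    momentX B I Q σ k ≤ momentX B I Q σ' k := by
  have h1 : 0 ≤ ∫ s, ‖devFx B (state B I s k)‖ ^ 2 ∂Q := integral_nonneg fun _ => by positivity
  unfold momentX
  gcongr

section Moments

variable [IsProbabilityMeasure Q]

theorem integrable_errWy_sq (hB : B.Assumptions p I.ρ) (hI : Admissible B p I)
    (hQ : FreshSeeds B s₀ Q) (k : ℕ) : Integrable (fun s => ‖errWy B I s k‖ ^ 2) Q := by
  have h := stateL2 hB hI hQ (k + 1)
  have h1 := (h.devFwy.const_smul (I.σ k)).add h.devGwy
  simp only [errWy_eq]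
  exact (memLp_two_iff_integrable_sq_norm h1.1).1 h1

theorem integrable_errWz_sq (hB : B.Assumptions p I.ρ) (hI : Admissible B p I)
    (hQ : FreshSeeds B s₀ Q) (k : ℕ) : Integrable (fun s => ‖errWz B I s k‖ ^ 2) Q := by
  have h := (stateL2 hB hI hQ (k + 1)).devGwz
  exact (memLp_two_iff_integrable_sq_norm h.1).1 h

theorem integrable_errX_sq (hB : B.Assumptions p I.ρ) (hI : Admissible B p I)
    (hQ : FreshSeeds B s₀ Q) (k : ℕ) : Integrable (fun s => ‖errX B I s k‖ ^ 2) Q := by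
  have h := stateL2 hB hI hQ (k + 1)
  have h1 := ((h.devFx.const_smul (I.σ k)).add h.devGxy).sub h.devGxz
  simp only [errX_eq]
  exact (memLp_two_iff_integrable_sq_norm h1.1).1 h1

theorem integral_sq_smul_add {Ω : Type*} [MeasurableSpace Ω] {Q : Measure Ω} {n : ℕ} (σ : ℝ)
    {u v : Ω → Vec n} (hu : MemLp u 2 Q) (hv : MemLp v 2 Q)
    (h0 : ∫ s, inner ℝ (u s) (v s) ∂Q = 0) :
    ∫ s, ‖σ • u s + v s‖ ^ 2 ∂Q = σ ^ 2 * ∫ s, ‖u s‖ ^ 2 ∂Q + ∫ s, ‖v s‖ ^ 2 ∂Q := by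
  have i1 := (memLp_two_iff_integrable_sq_norm hu.1).1 hu
  have i2 := (memLp_two_iff_integrable_sq_norm hv.1).1 hv
  have i3 := integrable_inner_of_memLp hu hv
  have e : ∀ s, ‖σ • u s + v s‖ ^ 2 = σ ^ 2 * ‖u s‖ ^ 2 + (2 * σ * inner ℝ (u s) (v s)
      + ‖v s‖ ^ 2) := fun s => by
    rw [norm_add_sq_real, norm_smul, mul_pow, Real.norm_eq_abs, sq_abs, real_inner_smul_left]
    ring
  have e4 := integral_add (i1.const_mul (σ ^ 2)) ((i3.const_mul (2 * σ)).add i2)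
  have e5 := integral_add (i3.const_mul (2 * σ)) i2
  simp only [Pi.add_apply] at e4
  simp only [e]
  rw [e4, e5, integral_const_mul, integral_const_mul, h0]
  ring

/-- An equality thanks to orthogonality, so the noise part of the potential translates into moments
without loss at both ends of the telescoping sum. -/
theorem integral_errW_sq (hB : B.Assumptions p I.ρ) (hI : Admissible B p I)
    (hQ : FreshSeeds B s₀ Q) (k : ℕ) :
    ∫ s, ‖errWy B I s k‖ ^ 2 ∂Q + ∫ s, ‖errWz B I s k‖ ^ 2 ∂Q = momentW B I Q (I.σ k) (k + 1) := by
  have h := stateL2 hB hI hQ (k + 1)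
  have h1 := integral_sq_smul_add (I.σ k) h.devFwy h.devGwy (cross_Fwy_Gwy hB hI hQ k)
  simp only [errWy_eq, errWz_eq]
  rw [h1, momentW]

theorem integral_errX_sq (hB : B.Assumptions p I.ρ) (hI : Admissible B p I)
    (hQ : FreshSeeds B s₀ Q) (k : ℕ) :
    ∫ s, ‖errX B I s k‖ ^ 2 ∂Q = momentX B I Q (I.σ k) (k + 1) := by
  have h := stateL2 hB hI hQ (k + 1)
  have c1 := cross_Fx_Gxy hB hI hQ k
  have c2 := cross_Fx_Gxz hB hI hQ k
  have c3 := cross_Gxy_Gxz hB hI hQ k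
  have h0 : ∫ s, inner ℝ (devFx B (state B I s (k + 1)))
      (devGxy B (state B I s (k + 1)) - devGxz B (state B I s (k + 1))) ∂Q = 0 := by
    have e := integral_sub (integrable_inner_of_memLp h.devFx h.devGxy)
      (integrable_inner_of_memLp h.devFx h.devGxz)
    simp only [inner_sub_right]
    rw [e, c1, c2, sub_zero]
  have c3' : ∫ s, inner ℝ (devGxz B (state B I s (k + 1))) (devGxy B (state B I s (k + 1))) ∂Q = 0 := by
    simpa only [real_inner_comm] using c3
  have h1 := integral_sq_smul_add (I.σ k) h.devFx (h.devGxy.sub h.devGxz) h0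
  have h2 := integral_sq_smul_add (-1) h.devGxz h.devGxy c3'
  have e1 : ∀ s, ‖(-1 : ℝ) • devGxz B (state B I s (k + 1)) + devGxy B (state B I s (k + 1))‖
      = ‖devGxy B (state B I s (k + 1)) - devGxz B (state B I s (k + 1))‖ := fun s => by
    congr 1; module
  simp only [e1] at h2
  simp only [errX_eq, add_sub_assoc]
  simp only [Pi.sub_apply] at h1
  rw [h1, h2, momentX]
  ring

/-- Three recursions with displacement constant 8 add up to 24, since (σ l_{f,1})² ≤ l_{g,1}²; the
two g-estimators account for the factor 4 on the noise level. -/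
theorem momentW_succ_le (hB : B.Assumptions p I.ρ) (hI : Admissible B p I) (hc : Conditions p I)
    (hQ : FreshSeeds B s₀ Q) (k : ℕ) :
    momentW B I Q (I.σ k) (k + 1) ≤ (1 - I.η k) ^ 2 * momentW B I Q (I.σ k) k
      + 4 * I.η k ^ 2 * noiseLevel p I k
      + 24 * p.lg1 ^ 2 * ∫ s, (dispX (state B I s k) + dispW (state B I s k)) ∂Q := by
  have h := stateL2 hB hI hQ k
  have h1 := (noiseStep_Fwy hB hI hQ h).sq_le
  have h2 := (noiseStep_Gwy hB hI hQ h).sq_le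
  have h3 := (noiseStep_Gwz hB hI hQ h).sq_le
  have hD : 0 ≤ ∫ s, (dispX (state B I s k) + dispW (state B I s k)) ∂Q :=
    integral_nonneg fun s => by simp only [dispX, dispW]; positivity
  have hl : (I.σ k * p.lf1) ^ 2 ≤ p.lg1 ^ 2 :=
    pow_le_pow_left₀ (mul_nonneg (hI.σ_pos k).le hB.lf1_pos.le) (sigma_lf1_le hB hc k) 2
  have h4 := mul_le_mul_of_nonneg_right hl hD
  have h5 := mul_le_mul_of_nonneg_left h1 (sq_nonneg (I.σ k))
  have h6 : 0 ≤ I.σ k ^ 2 * p.σf ^ 2 * I.η k ^ 2 := by positivity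
  unfold boundW at h2 h3 h5
  unfold momentW noiseLevel
  linarith only [h2, h3, h4, h5, h6]

theorem momentX_succ_le (hB : B.Assumptions p I.ρ) (hI : Admissible B p I) (hc : Conditions p I)
    (hQ : FreshSeeds B s₀ Q) (k : ℕ) :
    momentX B I Q (I.σ k) (k + 1) ≤ (1 - I.η k) ^ 2 * momentX B I Q (I.σ k) k
      + 4 * I.η k ^ 2 * noiseLevel p I k
      + 24 * p.lg1 ^ 2 * ∫ s, (dispX (state B I s k) + dispW (state B I s (k + 1))) ∂Q := by
  have h := stateL2 hB hI hQ k
  have h1 := (noiseStep_Fx hB hI hQ h).sq_le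
  have h2 := (noiseStep_Gxy hB hI hQ h).sq_le
  have h3 := (noiseStep_Gxz hB hI hQ h).sq_le
  have hD : 0 ≤ ∫ s, (dispX (state B I s k) + dispW (state B I s (k + 1))) ∂Q :=
    integral_nonneg fun s => by simp only [dispX, dispW]; positivity
  have hl : (I.σ k * p.lf1) ^ 2 ≤ p.lg1 ^ 2 :=
    pow_le_pow_left₀ (mul_nonneg (hI.σ_pos k).le hB.lf1_pos.le) (sigma_lf1_le hB hc k) 2
  have h4 := mul_le_mul_of_nonneg_right hl hD
  have h5 := mul_le_mul_of_nonneg_left h1 (sq_nonneg (I.σ k))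
  have h6 : 0 ≤ I.σ k ^ 2 * p.σf ^ 2 * I.η k ^ 2 := by positivity
  unfold boundX at h2 h3 h5
  unfold momentX noiseLevel
  linarith only [h2, h3, h4, h5, h6]

end Moments

end Alg

/-! ### Integrability along the algorithm -/

/-- Proximal points, envelopes and values are controlled on the feasible set only, so measurability
goes through the subtype in which the iterates live. -/
theorem measurable_comp_of_continuousOn {α E F : Type*} [MeasurableSpace α] [TopologicalSpace E]
    [MeasurableSpace E] [OpensMeasurableSpace E] [TopologicalSpace F] [MeasurableSpace F]
    [BorelSpace F] {C : Set E} {f : E → F} (hf : ContinuousOn f C) {u : α → E} (hu : Measurable u)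
    (hC : ∀ a, u a ∈ C) : Measurable fun a => f (u a) :=
  (continuousOn_iff_continuous_domRestrict.1 hf).measurable.comp (hu.subtype_mk (h := hC))

namespace Bilevel

variable {dx dy : ℕ} {Z Ξ : Type*} [MeasurableSpace Z] [MeasurableSpace Ξ] {B : Bilevel dx dy Z Ξ}
  {p : ProblemConsts} {ρ : ℝ} {φ : Joint dx dy → ℝ} {l : ℝ}

theorem SmoothOn.continuousOn (h : B.SmoothOn φ l) : ContinuousOn φ (jointSet B.X B.Y) :=
  fun _ hq => (h.contDiffAt hq).continuousAt.continuousWithinAt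

/-- Quadratic growth in x, from the Taylor bound and boundedness of Y; square integrable iterates
then have integrable function values. -/
theorem SmoothOn.exists_abs_le (hB : B.Assumptions p ρ) (h : B.SmoothOn φ l) (hl : 0 ≤ l)
    {q₀ : Joint dx dy} (hq₀ : q₀ ∈ jointSet B.X B.Y) :
    ∃ a b : ℝ, ∀ x ∈ B.X, ∀ y ∈ B.Y, |φ (pt x y)| ≤ a + b * ‖x‖ ^ 2 := by
  refine ⟨|φ q₀| + ‖gradient φ q₀‖ ^ 2 + (1 + l) * (2 * ‖q₀.fst‖ ^ 2 + 4 * p.DY ^ 2), 2 * (1 + l),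
    fun x hx y hy => ?_⟩
  have h1 := h.taylor hl hB.convex_X hB.convex_Y hq₀ (show pt x y ∈ jointSet B.X B.Y from ⟨hx, hy⟩)
  have h2 := abs_real_inner_le_norm (gradient φ q₀) (pt x y - q₀)
  have h3 : ‖pt x y - q₀‖ ^ 2 ≤ 2 * ‖x‖ ^ 2 + 2 * ‖q₀.fst‖ ^ 2 + 4 * p.DY ^ 2 := by
    have e := joint_norm_sq (pt x y - q₀)
    have e1 : ‖(pt x y - q₀).fst‖ ≤ ‖x‖ + ‖q₀.fst‖ := norm_sub_le _ _
    have e2 : ‖(pt x y - q₀).snd‖ ≤ p.DY + p.DY :=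
      (norm_sub_le _ _).trans (add_le_add (hB.bounded_Y _ hy) (hB.bounded_Y _ hq₀.2))
    have e3 := pow_le_pow_left₀ (norm_nonneg _) e1 2
    have e4 := pow_le_pow_left₀ (norm_nonneg _) e2 2
    linarith only [e, e3, e4, sq_nonneg (‖x‖ - ‖q₀.fst‖)]
  have h4 : |φ (pt x y)| ≤ |φ q₀| + ‖gradient φ q₀‖ * ‖pt x y - q₀‖ + l * ‖pt x y - q₀‖ ^ 2 := by
    have e1 : φ (pt x y) = φ q₀ + inner ℝ (gradient φ q₀) (pt x y - q₀)
        + (φ (pt x y) - φ q₀ - inner ℝ (gradient φ q₀) (pt x y - q₀)) := by ring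
    rw [e1]
    exact (abs_add_three _ _ _).trans (by gcongr)
  have h5 := mul_le_mul_of_nonneg_left h3 (show 0 ≤ 1 + l by linarith)
  have h6 := two_mul_le_add_sq ‖gradient φ q₀‖ ‖pt x y - q₀‖
  linarith only [h4, h5, h6, sq_nonneg ‖gradient φ q₀‖, sq_nonneg ‖pt x y - q₀‖]

namespace Assumptions

/-- Although `prox` is an epsilon choice, `prox_lipschitz` holds for any choice and gives the
constant 2 + 1 on the feasible set. -/
theorem continuousOn_proxH (hB : B.Assumptions p ρ) (hne : B.Y.Nonempty) {σ : ℝ} (hρ : 0 < ρ) (hσ : 0 ≤ σ)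
    (hΛ : ρ * (σ * p.lf1 + p.lg1) ≤ 1 / 2) :
    ContinuousOn (fun q : Vec dx × Vec dy => B.proxH ρ σ q.1 q.2) (B.X ×ˢ B.Y) := by
  refine LipschitzOnWith.continuousOn (K := 3) (LipschitzOnWith.of_dist_le_mul fun q hq r hr => ?_)
  have h := (hB.smoothPair_f.smul_add hB.smoothPair_g hσ).prox_lipschitz hB.convex_Y hρ hΛ
    hr.1 hq.1 (hB.isProx_proxH hne hr.1 ρ σ r.2) (hB.isProx_proxH hne hq.1 ρ σ q.2)
  rw [dist_eq_norm, dist_eq_norm]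
  have h1 : ‖q.1 - r.1‖ ≤ ‖q - r‖ := norm_fst_le (q - r)
  have h2 : ‖q.2 - r.2‖ ≤ ‖q - r‖ := norm_snd_le (q - r)
  have h3 : 2 * (ρ * (σ * p.lf1 + p.lg1)) * ‖q.1 - r.1‖ ≤ 1 * ‖q.1 - r.1‖ := by
    gcongr; linarith
  refine h.trans ?_
  push_cast
  linarith

theorem continuousOn_proxG (hB : B.Assumptions p ρ) (hne : B.Y.Nonempty) (hρ : 0 < ρ)
    (hΛ : ρ * p.lg1 ≤ 1 / 2) :
    ContinuousOn (fun q : Vec dx × Vec dy => B.proxG ρ q.1 q.2) (B.X ×ˢ B.Y) := by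
  refine LipschitzOnWith.continuousOn (K := 3) (LipschitzOnWith.of_dist_le_mul fun q hq r hr => ?_)
  have h := hB.smoothPair_g.prox_lipschitz hB.convex_Y hρ hΛ
    hr.1 hq.1 (hB.isProx_proxG hne hr.1 ρ r.2) (hB.isProx_proxG hne hq.1 ρ q.2)
  rw [dist_eq_norm, dist_eq_norm]
  have h1 : ‖q.1 - r.1‖ ≤ ‖q - r‖ := norm_fst_le (q - r)
  have h2 : ‖q.2 - r.2‖ ≤ ‖q - r‖ := norm_snd_le (q - r)
  have h3 : 2 * (ρ * p.lg1) * ‖q.1 - r.1‖ ≤ 1 * ‖q.1 - r.1‖ := by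
    gcongr; linarith
  refine h.trans ?_
  push_cast
  linarith

theorem continuousOn_gMin (hB : B.Assumptions p ρ) : ContinuousOn B.gMin B.X := by
  rw [continuousOn_iff_continuous_domRestrict]
  have : CompactSpace B.Y := isCompact_iff_compactSpace.1 hB.isCompact_Y
  have hcont : Continuous ↿fun (x : B.X) (y : B.Y) => B.g (pt x.1 y.1) := by
    have h1 : Continuous fun q : B.X × B.Y => pt (q.1 : Vec dx) (q.2 : Vec dy) :=
      (WithLp.prod_continuous_toLp 2 (Vec dx) (Vec dy)).comp
        ((continuous_subtype_val.comp continuous_fst).prodMk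
          (continuous_subtype_val.comp continuous_snd))
    exact hB.smooth_g.continuousOn.comp_continuous h1 fun q => ⟨q.1.2, q.2.2⟩
  have h2 := isCompact_univ.continuous_sInf (K := (Set.univ : Set B.Y)) hcont
  convert h2 using 2 with x
  rw [Set.image_univ]
  exact congrArg sInf (Set.range_domRestrict (fun y => B.g (pt x.1 y)) B.Y).symm

theorem exists_gMin_eq (hB : B.Assumptions p ρ) (hne : B.Y.Nonempty) {x : Vec dx} (hx : x ∈ B.X) :
    ∃ t ∈ B.Y, B.gMin x = B.gc x t := by
  obtain ⟨t, ht, hmin⟩ := hB.isCompact_Y.exists_isMinOn hne (hB.continuousOn_gc hx)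
  exact ⟨t, ht, gMin_eq ht fun w hw => hmin hw⟩

end Assumptions

end Bilevel

namespace Alg

variable {dx dy : ℕ} {Z Ξ : Type*} [MeasurableSpace Z] [MeasurableSpace Ξ]
  {B : Bilevel dx dy Z Ξ} {p : ProblemConsts} {I : AlgInput dx dy}
  {s₀ : Seeds Z Ξ} {Q : Measure (ℕ → Seeds Z Ξ)}

theorem measurable_wyStar (hB : B.Assumptions p I.ρ) (hI : Admissible B p I) (hc : Conditions p I)
    (k : ℕ) : Measurable fun s : ℕ → Seeds Z Ξ => wyStar B I s k := by
  have hm := measurableState_state hB hI k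
  have h1 := rho_lg1_le hB hc
  have h2 := mul_le_mul_of_nonneg_left (sigma_lf1_le hB hc k) hI.ρ_pos.le
  exact measurable_comp_of_continuousOn
    (hB.continuousOn_proxH ⟨_, hI.y₀_mem⟩ hI.ρ_pos (hI.σ_pos k).le (by linarith)) (hm.x.prodMk hm.y)
    fun s => ⟨(feasible_state hB hI s k).x, (feasible_state hB hI s k).y⟩

theorem measurable_wzStar (hB : B.Assumptions p I.ρ) (hI : Admissible B p I) (hc : Conditions p I)
    (k : ℕ) : Measurable fun s : ℕ → Seeds Z Ξ => wzStar B I s k := by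
  have hm := measurableState_state hB hI k
  have h1 := rho_lg1_le hB hc
  exact measurable_comp_of_continuousOn
    (hB.continuousOn_proxG ⟨_, hI.y₀_mem⟩ hI.ρ_pos (by linarith)) (hm.x.prodMk hm.z)
    fun s => ⟨(feasible_state hB hI s k).x, (feasible_state hB hI s k).z⟩

theorem integrable_sq_sub (hB : B.Assumptions p I.ρ) {α : Type*} [MeasurableSpace α] {Q : Measure α}
    [IsFiniteMeasure Q] {v w : α → Vec dy} (hv : Measurable v) (hw : Measurable w)
    (hvY : ∀ a, v a ∈ B.Y) (hwY : ∀ a, w a ∈ B.Y) : Integrable (fun a => ‖v a - w a‖ ^ 2) Q := by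
  have h := (memLp_of_mem_Y (Q := Q) hB hv hvY).sub (memLp_of_mem_Y hB hw hwY)
  exact (memLp_two_iff_integrable_sq_norm h.1).1 h

theorem integrable_value (hB : B.Assumptions p I.ρ) {φ : Joint dx dy → ℝ} {l : ℝ}
    (hφ : B.SmoothOn φ l) (hl : 0 ≤ l) {α : Type*} [MeasurableSpace α] {Q : Measure α}
    [IsFiniteMeasure Q] {u : α → Vec dx} {v : α → Vec dy} (hu : Measurable u) (hv : Measurable v)
    (hu2 : MemLp u 2 Q) (huX : ∀ a, u a ∈ B.X) (hvY : ∀ a, v a ∈ B.Y) {q : Joint dx dy}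
    (hq : q ∈ jointSet B.X B.Y) : Integrable (fun a => φ (pt (u a) (v a))) Q := by
  obtain ⟨a, b, hab⟩ := hφ.exists_abs_le hB hl hq
  have h1 := (memLp_two_iff_integrable_sq_norm hu2.1).1 hu2
  refine ((integrable_const a).add (h1.const_mul b)).mono'
    (measurable_comp_of_continuousOn hφ.continuousOn (measurable_pt hu hv)
      fun a => ⟨huX a, hvY a⟩).aestronglyMeasurable (Filter.Eventually.of_forall fun s => ?_)
  exact hab _ (huX s) _ (hvY s)

theorem integrable_gMin (hB : B.Assumptions p I.ρ) {α : Type*} [MeasurableSpace α] {Q : Measure α}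
    [IsFiniteMeasure Q] {u : α → Vec dx} (hu : Measurable u)
    (hu2 : MemLp u 2 Q) (huX : ∀ a, u a ∈ B.X) {q : Joint dx dy}
    (hq : q ∈ jointSet B.X B.Y) : Integrable (fun a => B.gMin (u a)) Q := by
  obtain ⟨a, b, hab⟩ := hB.smooth_g.exists_abs_le hB hB.lg1_pos.le hq
  have h1 := (memLp_two_iff_integrable_sq_norm hu2.1).1 hu2
  refine ((integrable_const a).add (h1.const_mul b)).mono'
    (measurable_comp_of_continuousOn hB.continuousOn_gMin hu huX).aestronglyMeasurable
    (Filter.Eventually.of_forall fun s => ?_)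
  obtain ⟨t, ht, e⟩ := hB.exists_gMin_eq ⟨_, hq.2⟩ (huX s)
  rw [e]
  exact hab _ (huX s) _ ht

variable [IsProbabilityMeasure Q]

theorem integrable_hEnv (hB : B.Assumptions p I.ρ) (hI : Admissible B p I) (hc : Conditions p I)
    (hQ : FreshSeeds B s₀ Q) (k : ℕ) :
    Integrable (fun s => B.hEnv I.ρ (I.σ k) (state B I s k).x (state B I s k).y) Q := by
  have hm := measurableState_state hB hI k
  have hF := fun s => feasible_state hB hI s k
  have hq : pt I.x₀ I.y₀ ∈ jointSet B.X B.Y := ⟨hI.x₀_mem, hI.y₀_mem⟩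
  have hx := (stateL2 hB hI hQ k).x
  have hw := measurable_wyStar hB hI hc k
  have hwY := fun s => (wyStar_spec hB hI s k).1
  have h1 := integrable_value hB hB.smooth_f hB.lf1_pos.le hm.x hw hx (fun s => (hF s).x) hwY hq
  have h2 := integrable_value hB hB.smooth_g hB.lg1_pos.le hm.x hw hx (fun s => (hF s).x) hwY hq
  have h3 := integrable_sq_sub (Q := Q) hB hw hm.y hwY (fun s => (hF s).y)
  refine (((h1.const_mul (I.σ k)).add h2).add (h3.const_mul (1 / (2 * I.ρ)))).congr
    (Filter.Eventually.of_forall fun s => ?_)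
  simp only [Bilevel.hEnv_eq hI.ρ_pos (wyStar_spec hB hI s k)]
  rfl

theorem integrable_gEnv (hB : B.Assumptions p I.ρ) (hI : Admissible B p I) (hc : Conditions p I)
    (hQ : FreshSeeds B s₀ Q) (k : ℕ) :
    Integrable (fun s => B.gEnv I.ρ (state B I s k).x (state B I s k).z) Q := by
  have hm := measurableState_state hB hI k
  have hF := fun s => feasible_state hB hI s k
  have hq : pt I.x₀ I.y₀ ∈ jointSet B.X B.Y := ⟨hI.x₀_mem, hI.y₀_mem⟩
  have hx := (stateL2 hB hI hQ k).x
  have hw := measurable_wzStar hB hI hc k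
  have hwY := fun s => (wzStar_spec hB hI s k).1
  have h2 := integrable_value hB hB.smooth_g hB.lg1_pos.le hm.x hw hx (fun s => (hF s).x) hwY hq
  have h3 := integrable_sq_sub (Q := Q) hB hw hm.z hwY (fun s => (hF s).z)
  refine (h2.add (h3.const_mul (1 / (2 * I.ρ)))).congr (Filter.Eventually.of_forall fun s => ?_)
  simp only [Bilevel.gEnv_eq hI.ρ_pos (wzStar_spec hB hI s k)]
  rfl

theorem integrable_basePotential (hB : B.Assumptions p I.ρ) (hI : Admissible B p I)
    (hc : Conditions p I) (hQ : FreshSeeds B s₀ Q) (k : ℕ) :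
    Integrable (fun s => basePotential B I s k) Q := by
  have hm := measurableState_state hB hI k
  have hF := fun s => feasible_state hB hI s k
  have hq : pt I.x₀ I.y₀ ∈ jointSet B.X B.Y := ⟨hI.x₀_mem, hI.y₀_mem⟩
  have h1 := integrable_hEnv hB hI hc hQ k
  have h2 := integrable_gEnv hB hI hc hQ k
  have h3 := integrable_gMin hB hm.x (stateL2 hB hI hQ k).x (fun s => (hF s).x) hq
  have h4 := integrable_sq_sub (Q := Q) hB hm.wy (measurable_wyStar hB hI hc k) (fun s => (hF s).wy)
    fun s => (wyStar_spec hB hI s k).1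
  have h5 := integrable_sq_sub (Q := Q) hB hm.wz (measurable_wzStar hB hI hc k) (fun s => (hF s).wz)
    fun s => (wzStar_spec hB hI s k).1
  exact (((h1.sub h2).div_const _).add ((h2.sub h3).const_mul _)).add ((h4.add h5).const_mul _)

theorem integrable_gapPotential (hB : B.Assumptions p I.ρ) (hI : Admissible B p I)
    (hc : Conditions p I) (hQ : FreshSeeds B s₀ Q) (k : ℕ) :
    Integrable (fun s => gapPotential B I s k) Q := by
  have hm := measurableState_state hB hI k
  have hF := fun s => feasible_state hB hI s k
  have hq : pt I.x₀ I.y₀ ∈ jointSet B.X B.Y := ⟨hI.x₀_mem, hI.y₀_mem⟩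
  have hx := (stateL2 hB hI hQ k).x
  have h1 := integrable_hEnv hB hI hc hQ k
  have h2 := integrable_gEnv hB hI hc hQ k
  have a1 := integrable_value hB hB.smooth_f hB.lf1_pos.le hm.x hm.wy hx (fun s => (hF s).x)
    (fun s => (hF s).wy) hq
  have a2 := integrable_value hB hB.smooth_g hB.lg1_pos.le hm.x hm.wy hx (fun s => (hF s).x)
    (fun s => (hF s).wy) hq
  have a3 := integrable_value hB hB.smooth_g hB.lg1_pos.le hm.x hm.wz hx (fun s => (hF s).x)
    (fun s => (hF s).wz) hq
  have a4 := integrable_sq_sub (Q := Q) hB hm.wy hm.y (fun s => (hF s).wy) (fun s => (hF s).y)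
  have a5 := integrable_sq_sub (Q := Q) hB hm.wz hm.z (fun s => (hF s).wz) (fun s => (hF s).z)
  exact ((((((a1.const_mul (I.σ k)).add a2).add (a4.const_mul (1 / (2 * I.ρ)))).sub h1).add
    ((a3.add (a5.const_mul (1 / (2 * I.ρ)))).sub h2)).div_const _)

theorem integrable_residualTerm (hB : B.Assumptions p I.ρ) (hI : Admissible B p I)
    (hc : Conditions p I) (hQ : FreshSeeds B s₀ Q) (k : ℕ) :
    Integrable (fun s => residualTerm B I s k) Q := by
  have hm := measurableState_state hB hI k
  have hF := fun s => feasible_state hB hI s k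
  have hq : pt I.x₀ I.y₀ ∈ jointSet B.X B.Y := ⟨hI.x₀_mem, hI.y₀_mem⟩
  have hx := (stateL2 hB hI hQ k).x
  have hwy := measurable_wyStar hB hI hc k
  have hwz := measurable_wzStar hB hI hc k
  have hwyY := fun s => (wyStar_spec hB hI s k).1
  have hwzY := fun s => (wzStar_spec hB hI s k).1
  have h4 := integrable_sq_sub (Q := Q) hB hm.y hwy (fun s => (hF s).y) hwyY
  have h5 := integrable_sq_sub (Q := Q) hB hm.z hwz (fun s => (hF s).z) hwzY
  have b1 := memLp_gradient_fst (I := I) hB hB.smooth_f hm.x hwy hx (fun s => (hF s).x) hwyY hq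
  have b2 := memLp_gradient_fst (I := I) hB hB.smooth_g hm.x hwy hx (fun s => (hF s).x) hwyY hq
  have b3 := memLp_gradient_fst (I := I) hB hB.smooth_g hm.x hwz hx (fun s => (hF s).x) hwzY hq
  have b4 : MemLp (fun s => I.α k • (I.σ k • B.fx (state B I s k).x (wyStar B I s k)
      + B.gx (state B I s k).x (wyStar B I s k) - B.gx (state B I s k).x (wzStar B I s k))) 2 Q :=
    (((b1.const_smul (I.σ k)).add b2).sub b3).const_smul (I.α k)
  have pX := (continuous_proj hB.convex_X hB.closed_X ⟨_, hI.x₀_mem⟩)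
  have h6 : MemLp (fun s => (state B I s k).x - xHat B I s k) 2 Q := by
    refine b4.norm.mono' (hx.1.sub (pX.comp_aestronglyMeasurable (hx.1.sub b4.1)))
      (Filter.Eventually.of_forall fun s => ?_)
    have h7 := norm_proj_sub_le_of_vi hB.convex_X hB.closed_X (hF s).x (a := (state B I s k).x)
      (fun z _ => by simp) ((state B I s k).x - I.α k • (I.σ k • B.fx (state B I s k).x (wyStar B I s k)
      + B.gx (state B I s k).x (wyStar B I s k) - B.gx (state B I s k).x (wzStar B I s k)))
    rw [sub_sub_cancel_left, norm_neg] at h7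
    rw [norm_sub_rev]
    exact h7
  have h8 : MemLp (fun s => deltaX B I s k) 2 Q := h6.const_smul (I.α k)⁻¹
  have h9 := (memLp_two_iff_integrable_sq_norm h8.1).1 h8
  exact (h9.const_mul _).add ((h4.add h5).const_mul _)

end Alg

/-! ### Summation over the iterations -/

namespace Alg

variable {dx dy : ℕ} {Z Ξ : Type*} [MeasurableSpace Z] [MeasurableSpace Ξ]
  {B : Bilevel dx dy Z Ξ} {p : ProblemConsts} {I : AlgInput dx dy}
  {s₀ : Seeds Z Ξ} {Q : Measure (ℕ → Seeds Z Ξ)}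

/-- The weight of the squared estimator errors in the potential. -/
noncomputable def noiseWeight (I : AlgInput dx dy) (k : ℕ) : ℝ := I.ρ ^ 2 / (I.σ k * gammaPrev I k)

/-- The total weight of `‖e_x^k‖²`. -/
noncomputable def errXWeight (I : AlgInput dx dy) (k : ℕ) : ℝ := noiseWeight I (k + 1) + 4 * I.α k / I.σ k

theorem gammaPrev_pos (hI : Admissible B p I) (k : ℕ) : 0 < gammaPrev I k := by
  cases k with
  | zero => exact hI.γinit_pos
  | succ k => exact hI.γ_pos k

theorem noiseWeight_pos (hI : Admissible B p I) (k : ℕ) : 0 < noiseWeight I k :=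
  div_pos (pow_pos hI.ρ_pos 2) (mul_pos (hI.σ_pos k) (gammaPrev_pos hI k))

theorem decay_le (hc : Conditions p I) (k : ℕ) :
    I.σ k * gammaPrev I k / (I.σ (k + 1) * I.γ k) ≤ 1 + min (I.η k) (I.η (k + 1)) / 4 := by
  have := hc.cond_decay k
  linarith

theorem sigma_ratio_le (hB : B.Assumptions p I.ρ) (hI : Admissible B p I) (hc : Conditions p I)
    (k : ℕ) : I.σ k / I.σ (k + 1) ≤ 1001 / 1000 := by
  have h1 := sigma_drop_le hB hI hc k
  have h2 := hc.cond_β k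
  rw [sub_div, div_self (hI.σ_pos (k + 1)).ne'] at h1
  linarith

/-- The decay condition together with σ_{k+1} ≤ σ_k and η ≤ 1 forbids γ to drop by more than the
factor 5/4 in one step. -/
theorem gammaPrev_le (hI : Admissible B p I) (hc : Conditions p I) (k : ℕ) :
    gammaPrev I k ≤ 5 / 4 * I.γ k := by
  have h1 := decay_le hc k
  have h2 := hI.η_le k
  have h3 := min_le_left (I.η k) (I.η (k + 1))
  have h4 := hI.σ_pos (k + 1)
  have h5 := hI.γ_pos k
  have h6 := gammaPrev_pos hI k
  have h7 : I.σ (k + 1) ≤ I.σ k := hI.σ_anti (Nat.le_succ k)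
  rw [div_le_iff₀ (mul_pos h4 h5)] at h1
  have h8 : I.σ (k + 1) * gammaPrev I k ≤ I.σ k * gammaPrev I k := by gcongr
  have h9 : (1 + min (I.η k) (I.η (k + 1)) / 4) * (I.σ (k + 1) * I.γ k)
      ≤ 5 / 4 * (I.σ (k + 1) * I.γ k) := by
    gcongr; linarith
  refine le_of_mul_le_mul_left ?_ h4
  linarith

theorem noiseWeight_succ (hI : Admissible B p I) (k : ℕ) :
    noiseWeight I (k + 1) = noiseWeight I k * (I.σ k * gammaPrev I k / (I.σ (k + 1) * I.γ k)) := by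
  have h1 := hI.σ_pos (k + 1)
  have h2 := hI.γ_pos k
  have h3 := gammaPrev_pos hI k
  have h4 := hI.σ_pos k
  change I.ρ ^ 2 / (I.σ (k + 1) * I.γ k) = _
  rw [noiseWeight]
  field_simp

/-- `η_{k+1}` dominates the squared relative step size of the inner loops. -/
theorem gamma_sq_le (hc : Conditions p I) (k : ℕ) :
    100 * ((I.ρ ^ 2)⁻¹ * I.γ k ^ 2) ≤ I.η (k + 1) := by
  have h := hc.cond_η k
  refine le_trans ?_ h
  rw [← mul_assoc]
  exact mul_le_mul_of_nonneg_left (le_max_right _ _) (by positivity)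

theorem alpha_le (hI : Admissible B p I) (hc : Conditions p I) (k : ℕ) :
    I.α k ≤ I.γ k / 100000 := by
  have h1 := hc.cond_βαγ k
  have h2 := mul_pos hI.ρ_pos (hI.β_pos k)
  linarith

/-- The weight grows by at most 1 + η/4 while the error contracts by (1 - η)², a net factor of at
most 1 - η/2. Relative to the weight, the cost 4γ_k/σ_k is at most 5γ_k²/ρ², which η_{k+1} ≥
100γ_k²/ρ² covers. -/
theorem noiseWeight_decay (hI : Admissible B p I) (hc : Conditions p I) (k : ℕ) :
    noiseWeight I (k + 1) * (1 - I.η (k + 1)) ^ 2 + 4 * I.γ k / I.σ k ≤ noiseWeight I k := by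
  have hw := noiseWeight_pos hI k
  have h1 := decay_le hc k
  have h2 := min_le_right (I.η k) (I.η (k + 1))
  have h3 := gamma_sq_le hc k
  have h4 := gammaPrev_le hI hc k
  have h5 := gammaPrev_pos hI k
  have hρ := hI.ρ_pos
  have hσ := hI.σ_pos k
  have hγ := hI.γ_pos k
  have e : 4 * I.γ k / I.σ k = noiseWeight I k * (4 * ((I.ρ ^ 2)⁻¹ * (I.γ k * gammaPrev I k))) := by
    rw [noiseWeight]; field_simp
  have h6 : (I.ρ ^ 2)⁻¹ * (I.γ k * gammaPrev I k) ≤ (I.ρ ^ 2)⁻¹ * (I.γ k * (5 / 4 * I.γ k)) := by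
    gcongr
  rw [noiseWeight_succ hI, e]
  set t := I.σ k * gammaPrev I k / (I.σ (k + 1) * I.γ k)
  set u := (I.ρ ^ 2)⁻¹ * (I.γ k * gammaPrev I k)
  have hη0 := (hI.η_pos (k + 1)).le
  have hη1 := hI.η_le (k + 1)
  set η := I.η (k + 1)
  have h7 : t * (1 - η) ^ 2 ≤ (1 + η / 4) * (1 - η) ^ 2 := by gcongr; linarith
  have h8 : (1 + η / 4) * (1 - η) ^ 2 ≤ 1 - η / 2 := by
    nlinarith [mul_nonneg hη0 (sub_nonneg.2 hη1), mul_nonneg (mul_nonneg hη0 hη0) (sub_nonneg.2 hη1)]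
  have h9 : t * (1 - η) ^ 2 + 4 * u ≤ 1 := by linarith
  calc noiseWeight I k * t * (1 - η) ^ 2 + noiseWeight I k * (4 * u)
      = noiseWeight I k * (t * (1 - η) ^ 2 + 4 * u) := by ring
    _ ≤ noiseWeight I k * 1 := by gcongr
    _ = noiseWeight I k := mul_one _

theorem errXWeight_eq (hI : Admissible B p I) (k : ℕ) : errXWeight I k
    = I.ρ ^ 2 / (I.σ k * I.γ k) * (I.σ k / I.σ (k + 1) + 4 * ((I.ρ ^ 2)⁻¹ * (I.α k * I.γ k))) := by
  have h1 := hI.σ_pos (k + 1)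
  have h2 := hI.γ_pos k
  have h4 := hI.σ_pos k
  have h5 := hI.ρ_pos
  change I.ρ ^ 2 / (I.σ (k + 1) * I.γ k) + 4 * I.α k / I.σ k = _
  field_simp

theorem errXWeight_le (hB : B.Assumptions p I.ρ) (hI : Admissible B p I) (hc : Conditions p I)
    (k : ℕ) : errXWeight I k ≤ 101 / 100 * (I.ρ ^ 2 / (I.σ k * I.γ k)) := by
  have h1 := sigma_ratio_le hB hI hc k
  have h2 := alpha_le hI hc k
  have h3 := (hc.cond_γ k).le
  have hγ := hI.γ_pos k
  have hρ := hI.ρ_pos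
  have hσ := hI.σ_pos k
  have h4 : (I.ρ ^ 2)⁻¹ * (I.α k * I.γ k) ≤ 1 / 1000 := by
    rw [inv_mul_le_iff₀ (by positivity)]
    have h5 : I.α k * I.γ k ≤ I.ρ / 1000 * I.ρ := by gcongr <;> linarith
    linarith
  rw [errXWeight_eq hI, mul_comm]
  gcongr
  linarith

theorem errXWeight_decay (hB : B.Assumptions p I.ρ) (hI : Admissible B p I) (hc : Conditions p I)
    (k : ℕ) : errXWeight I k * (1 - I.η k) ^ 2 ≤ noiseWeight I k := by
  have hw := noiseWeight_pos hI k
  cases k with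
  | zero => rw [hI.η_zero]; simpa using hw.le
  | succ k =>
    have hρ := hI.ρ_pos
    have hσ := hI.σ_pos (k + 1)
    have hγ := hI.γ_pos (k + 1)
    have hγ' := hI.γ_pos k
    have hη0 := (hI.η_pos (k + 1)).le
    have hη1 := hI.η_le (k + 1)
    -- The weight at k + 1 involves α_{k+1}, but η_{k+1} is bounded below through γ_k. If γ at most
    -- doubles, α_{k+1} ≤ γ_k and this bound suffices.
    rcases le_total (I.γ (k + 1)) (2 * I.γ k) with hcase | hcase
    · have h1 := decay_le hc (k + 1)
      have h2 := min_le_left (I.η (k + 1)) (I.η (k + 1 + 1))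
      have h3 := gamma_sq_le hc k
      have h4 := alpha_le hI hc (k + 1)
      have e : 4 * I.α (k + 1) / I.σ (k + 1)
          = noiseWeight I (k + 1) * (4 * ((I.ρ ^ 2)⁻¹ * (I.α (k + 1) * I.γ k))) := by
        change _ = I.ρ ^ 2 / (I.σ (k + 1) * I.γ k) * _
        field_simp
      have h6 : (I.ρ ^ 2)⁻¹ * (I.α (k + 1) * I.γ k) ≤ (I.ρ ^ 2)⁻¹ * (I.γ k * I.γ k) := by
        gcongr; linarith
      rw [errXWeight, noiseWeight_succ hI, e]
      set t := I.σ (k + 1) * gammaPrev I (k + 1) / (I.σ (k + 1 + 1) * I.γ (k + 1))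
      set u := (I.ρ ^ 2)⁻¹ * (I.α (k + 1) * I.γ k)
      set η := I.η (k + 1)
      have h7 : (t + 4 * u) * (1 - η) ^ 2 ≤ (1 + η / 2) * (1 - η) ^ 2 :=
        mul_le_mul_of_nonneg_right (by linarith) (sq_nonneg _)
      have h8 : (1 + η / 2) * (1 - η) ^ 2 ≤ 1 := by
        nlinarith [mul_nonneg hη0 (sub_nonneg.2 hη1), mul_nonneg (mul_nonneg hη0 hη0) (sub_nonneg.2 hη1)]
      calc (noiseWeight I (k + 1) * t + noiseWeight I (k + 1) * (4 * u)) * (1 - η) ^ 2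
          = noiseWeight I (k + 1) * ((t + 4 * u) * (1 - η) ^ 2) := by ring
        _ ≤ noiseWeight I (k + 1) * 1 := mul_le_mul_of_nonneg_left (h7.trans h8) hw.le
        _ = noiseWeight I (k + 1) := mul_one _
    -- If γ more than doubles, ρ²/(σγ) is at least halved, and no contraction is needed.
    · have h1 := errXWeight_le hB hI hc (k + 1)
      have h2 : I.ρ ^ 2 / (I.σ (k + 1) * I.γ (k + 1)) ≤ I.ρ ^ 2 / (I.σ (k + 1) * (2 * I.γ k)) := by
        gcongr
      have e : I.ρ ^ 2 / (I.σ (k + 1) * (2 * I.γ k)) = noiseWeight I (k + 1) / 2 := by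
        change _ = I.ρ ^ 2 / (I.σ (k + 1) * I.γ k) / 2
        field_simp
      have h3 : errXWeight I (k + 1) ≤ noiseWeight I (k + 1) := by linarith
      have h4 : (1 - I.η (k + 1)) ^ 2 ≤ 1 := pow_le_one₀ (by linarith) (by linarith)
      calc errXWeight I (k + 1) * (1 - I.η (k + 1)) ^ 2 ≤ noiseWeight I (k + 1) * 1 := by gcongr
        _ = noiseWeight I (k + 1) := mul_one _

theorem errXWeight_succ_le (hB : B.Assumptions p I.ρ) (hI : Admissible B p I) (hc : Conditions p I)
    (k : ℕ) : errXWeight I (k + 1) ≤ 13 / 10 * (I.ρ ^ 2 / (I.σ k * I.γ k)) := by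
  have h1 := errXWeight_le hB hI hc (k + 1)
  have h2 : I.γ k ≤ 5 / 4 * I.γ (k + 1) := gammaPrev_le hI hc (k + 1)
  have h3 := sigma_ratio_le hB hI hc k
  have hρ := hI.ρ_pos
  have hσ := hI.σ_pos k
  have hσ' := hI.σ_pos (k + 1)
  have hγ := hI.γ_pos k
  have hγ' := hI.γ_pos (k + 1)
  have e : I.ρ ^ 2 / (I.σ (k + 1) * I.γ (k + 1))
      = I.ρ ^ 2 / (I.σ k * I.γ k) * (I.σ k / I.σ (k + 1) * (I.γ k / I.γ (k + 1))) := by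
    field_simp
  have h4 : I.γ k / I.γ (k + 1) ≤ 5 / 4 := by rw [div_le_iff₀ hγ']; exact h2
  have h5 : I.σ k / I.σ (k + 1) * (I.γ k / I.γ (k + 1)) ≤ 1001 / 1000 * (5 / 4) := by gcongr
  have h6 : I.ρ ^ 2 / (I.σ (k + 1) * I.γ (k + 1))
      ≤ I.ρ ^ 2 / (I.σ k * I.γ k) * (1001 / 1000 * (5 / 4)) := by rw [e]; gcongr
  have h7 : 0 ≤ I.ρ ^ 2 / (I.σ k * I.γ k) := by positivity
  linarith

/-- One step of the recursion for the weighted second moments of the estimator errors, with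
`D = ‖x_k - x_{k-1}‖²`, `D' = ‖x_{k+1} - x_k‖²`, `W = ‖w_{k+1} - w_k‖²` in expectation. -/
theorem moment_recursion_step {a a' b b' r g q' Lsq η η' D D' W N N' X X' Y Y' M M' : ℝ}
    (ha' : 0 ≤ a') (hbn : 0 ≤ b) (hL : 0 ≤ Lsq) (hD' : 0 ≤ D') (hW : 0 ≤ W)
    (hX : 0 ≤ X) (hY : 0 ≤ Y) (hN' : 0 ≤ N') (hN : N' ≤ N)
    (hY' : Y' ≤ (1 - η') ^ 2 * Y + 4 * η' ^ 2 * N' + 24 * Lsq * (D' + W))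
    (hX' : X' ≤ (1 - η) ^ 2 * X + 4 * η ^ 2 * N + 24 * Lsq * (D + W))
    (h1 : a' * (1 - η') ^ 2 + g ≤ a) (h2 : b * (1 - η) ^ 2 ≤ a) (hb : b = a' + q')
    (h3 : b ≤ 101 / 100 * r) (h4 : b' ≤ 13 / 10 * r) (hr : 0 ≤ r) (hq' : 0 ≤ q')
    (hM : 24 * Lsq * (3 * r) ≤ M) (hM' : 500 * Lsq * r ≤ M') :
    a' * (X' + Y') + b' * (4 * η' ^ 2 * N' + 24 * Lsq * D') + (g * Y + q' * X')
      ≤ a * (X + Y) + b * (4 * η ^ 2 * N + 24 * Lsq * D) + M * D' + M' * W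
        + 1000 * (r * η' ^ 2 * N) := by
  have ea : a' ≤ 101 / 100 * r := by linarith
  have e1 := mul_le_mul_of_nonneg_left hY' ha'
  have e2 := mul_le_mul_of_nonneg_left hX' hbn
  have e3 := mul_le_mul_of_nonneg_right h1 hY
  have e4 := mul_le_mul_of_nonneg_right h2 hX
  have e5 : (a' + b') * (η' ^ 2 * N') ≤ (3 * r) * (η' ^ 2 * N) := by gcongr; linarith
  have e6 : (a' + b') * (24 * Lsq * D') ≤ (3 * r) * (24 * Lsq * D') := by gcongr; linarith
  have e7 : (a' + b) * (24 * Lsq * W) ≤ (3 * r) * (24 * Lsq * W) := by gcongr; linarith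
  have e8 := mul_le_mul_of_nonneg_right hM hD'
  have e9 := mul_le_mul_of_nonneg_right hM' hW
  have e10 : 0 ≤ r * η' ^ 2 * N := mul_nonneg (by positivity) (hN'.trans hN)
  have e11 : 0 ≤ Lsq * r * W := by positivity
  rw [hb] at e2 e4 e7 ⊢
  linarith only [e1, e2, e3, e4, e5, e6, e7, e8, e9, e10, e11]

end Alg

/-- `f` is integrable, with integral `m`. -/
def HasMean {Ω : Type*} [MeasurableSpace Ω] (Q : Measure Ω) (f : Ω → ℝ) (m : ℝ) : Prop :=
  Integrable f Q ∧ ∫ s, f s ∂Q = m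

namespace HasMean

variable {Ω : Type*} [MeasurableSpace Ω] {Q : Measure Ω} {f g : Ω → ℝ} {a b : ℝ}

theorem of_integrable (h : Integrable f Q) : HasMean Q f (∫ s, f s ∂Q) := ⟨h, rfl⟩

theorem add (hf : HasMean Q f a) (hg : HasMean Q g b) : HasMean Q (fun s => f s + g s) (a + b) :=
  ⟨hf.1.add hg.1, by rw [integral_add hf.1 hg.1, hf.2, hg.2]⟩

theorem const_mul (c : ℝ) (hf : HasMean Q f a) : HasMean Q (fun s => c * f s) (c * a) :=
  ⟨hf.1.const_mul c, by rw [integral_const_mul, hf.2]⟩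

theorem const [IsProbabilityMeasure Q] (c : ℝ) : HasMean Q (fun _ => c) c :=
  ⟨integrable_const c, by simp⟩

theorem le (hf : HasMean Q f a) (hg : HasMean Q g b) (h : ∀ s, f s ≤ g s) : a ≤ b := by
  rw [← hf.2, ← hg.2]
  exact integral_mono hf.1 hg.1 h

theorem sum {F : ℕ → Ω → ℝ} {m : ℕ → ℝ} (h : ∀ k, HasMean Q (F k) (m k)) (K : ℕ) :
    HasMean Q (fun s => ∑ k ∈ Finset.range K, F k s) (∑ k ∈ Finset.range K, m k) :=
  ⟨integrable_finsetSum _ fun k _ => (h k).1, by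
    rw [integral_finsetSum _ fun k _ => (h k).1]
    exact Finset.sum_congr rfl fun k _ => (h k).2⟩

end HasMean

/-! ### Expected descent of potential, gap and noise, and the final bound. -/

namespace Alg

variable {dx dy : ℕ} {Z Ξ : Type*} [MeasurableSpace Z] [MeasurableSpace Ξ]
  {B : Bilevel dx dy Z Ξ} {p : ProblemConsts} {I : AlgInput dx dy}
  {s₀ : Seeds Z Ξ} {Q : Measure (ℕ → Seeds Z Ξ)}

/-- The expected squared error `E‖e_x^{k-1}‖²`. -/
noncomputable def prevMomentX (B : Bilevel dx dy Z Ξ) (I : AlgInput dx dy) (Q : Measure (ℕ → Seeds Z Ξ)) :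
    ℕ → ℝ
  | 0 => 0
  | k + 1 => momentX B I Q (I.σ k) (k + 1)

/-- The deterministic error terms of one iteration which stem from the decrease of `σ`. -/
noncomputable def driftTerm (p : ProblemConsts) (I : AlgInput dx dy) (k : ℕ) : ℝ :=
  8 * ((I.σ k - I.σ (k + 1)) / I.σ k * p.Cf)
    + 578 * (p.Mw ^ 2 * I.ρ ^ 2 / (I.σ k * I.γ k) * ((I.σ k - I.σ (k + 1)) / I.σ (k + 1)) ^ 2)

theorem momentW_nonneg (σ : ℝ) (k : ℕ) : 0 ≤ momentW B I Q σ k := by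
  have h1 : 0 ≤ ∫ s, ‖devFwy B (state B I s k)‖ ^ 2 ∂Q := integral_nonneg fun _ => by positivity
  have h2 : 0 ≤ ∫ s, ‖devGwy B (state B I s k)‖ ^ 2 ∂Q := integral_nonneg fun _ => by positivity
  have h3 : 0 ≤ ∫ s, ‖devGwz B (state B I s k)‖ ^ 2 ∂Q := integral_nonneg fun _ => by positivity
  unfold momentW
  positivity

theorem prevMomentX_nonneg (k : ℕ) : 0 ≤ prevMomentX B I Q k := by
  cases k with
  | zero => exact le_rfl
  | succ k =>
    have h1 : 0 ≤ ∫ s, ‖devFx B (state B I s (k + 1))‖ ^ 2 ∂Q := integral_nonneg fun _ => by positivity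
    have h2 : 0 ≤ ∫ s, ‖devGxy B (state B I s (k + 1))‖ ^ 2 ∂Q := integral_nonneg fun _ => by positivity
    have h3 : 0 ≤ ∫ s, ‖devGxz B (state B I s (k + 1))‖ ^ 2 ∂Q := integral_nonneg fun _ => by positivity
    unfold prevMomentX momentX
    positivity

theorem noiseLevel_nonneg (k : ℕ) : 0 ≤ noiseLevel p I k := by unfold noiseLevel; positivity

theorem noiseLevel_anti (hI : Admissible B p I) (k : ℕ) :
    noiseLevel p I (k + 1) ≤ noiseLevel p I k := by
  have h1 : I.σ (k + 1) ≤ I.σ k := hI.σ_anti (Nat.le_succ k)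
  have h2 := (hI.σ_pos (k + 1)).le
  unfold noiseLevel
  gcongr

theorem integral_dispX_nonneg (k : ℕ) : 0 ≤ ∫ s, dispX (state B I s k) ∂Q :=
  integral_nonneg fun _ => sq_nonneg _

theorem errXWeight_pos (hI : Admissible B p I) (k : ℕ) : 0 < errXWeight I k :=
  add_pos (noiseWeight_pos hI _) (div_pos (mul_pos (by norm_num) (hI.α_pos k)) (hI.σ_pos k))

section Expectation

variable [IsProbabilityMeasure Q]

theorem integrable_moveX (hB : B.Assumptions p I.ρ) (hI : Admissible B p I)
    (hQ : FreshSeeds B s₀ Q) (k : ℕ) : Integrable (fun s => moveX B I s k) Q :=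
  integrable_dispX (stateL2 hB hI hQ (k + 1))

theorem integrable_moveW (hB : B.Assumptions p I.ρ) (hI : Admissible B p I) (k : ℕ) :
    Integrable (fun s => moveW B I s k) Q :=
  integrable_dispW hB hI (k + 1)

theorem expected_potential_step (hB : B.Assumptions p I.ρ) (hI : Admissible B p I)
    (hc : Conditions p I) (hQ : FreshSeeds B s₀ Q) (k : ℕ) :
    ∫ s, basePotential B I s (k + 1) ∂Q + gapWeight p I * ∫ s, gapPotential B I s (k + 1) ∂Q
      + ∫ s, residualTerm B I s k ∂Q + 1 / (5 * (I.σ k * I.α k)) * ∫ s, moveX B I s k ∂Q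
      + gapWeight p I / (2 * (I.σ k * I.γ k)) * ∫ s, moveW B I s k ∂Q
    ≤ ∫ s, basePotential B I s k ∂Q + gapWeight p I * ∫ s, gapPotential B I s k ∂Q
      + 4 * I.γ k / I.σ k * momentW B I Q (I.σ k) (k + 1)
      + 4 * I.α k / I.σ k * momentX B I Q (I.σ k) (k + 1) + driftTerm p I k := by
  rw [← integral_errW_sq hB hI hQ, ← integral_errX_sq hB hI hQ]
  have hP := fun k => HasMean.of_integrable (integrable_basePotential hB hI hc hQ k)
  have hG := fun k => HasMean.of_integrable (integrable_gapPotential hB hI hc hQ k)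
  have hR := HasMean.of_integrable (integrable_residualTerm hB hI hc hQ k)
  have hX := HasMean.of_integrable (integrable_moveX hB hI hQ k)
  have hW := HasMean.of_integrable (integrable_moveW (Q := Q) hB hI k)
  have e1 := HasMean.of_integrable (integrable_errWy_sq hB hI hQ k)
  have e2 := HasMean.of_integrable (integrable_errWz_sq hB hI hQ k)
  have e3 := HasMean.of_integrable (integrable_errX_sq hB hI hQ k)
  refine HasMean.le (((((hP (k + 1)).add ((hG (k + 1)).const_mul (gapWeight p I))).add hR).add
      (hX.const_mul (1 / (5 * (I.σ k * I.α k))))).add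
      (hW.const_mul (gapWeight p I / (2 * (I.σ k * I.γ k)))))
    (((((hP k).add ((hG k).const_mul (gapWeight p I))).add
      ((e1.add e2).const_mul (4 * I.γ k / I.σ k))).add (e3.const_mul (4 * I.α k / I.σ k))).add
      (HasMean.const (driftTerm p I k))) fun s => ?_
  have h := potential_step hB hI hc s k
  rw [div_eq_inv_mul (moveX B I s k), ← one_div] at h
  rw [driftTerm]
  linarith only [h]

theorem momentX_prev_le (hB : B.Assumptions p I.ρ) (hI : Admissible B p I) (hc : Conditions p I)
    (hQ : FreshSeeds B s₀ Q) (k : ℕ) :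
    momentX B I Q (I.σ k) (k + 1) ≤ (1 - I.η k) ^ 2 * prevMomentX B I Q k
      + 4 * I.η k ^ 2 * noiseLevel p I k
      + 24 * p.lg1 ^ 2 * (∫ s, dispX (state B I s k) ∂Q + ∫ s, moveW B I s k ∂Q) := by
  have h := momentX_succ_le hB hI hc hQ k
  rw [integral_add (integrable_dispX (stateL2 hB hI hQ k)) (integrable_dispW hB hI (k + 1))] at h
  have h2 : (1 - I.η k) ^ 2 * momentX B I Q (I.σ k) k ≤ (1 - I.η k) ^ 2 * prevMomentX B I Q k := by
    cases k with
    | zero => rw [hI.η_zero]; simp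
    | succ k =>
      exact mul_le_mul_of_nonneg_left
        (momentX_mono (hI.σ_pos _).le (hI.σ_anti (Nat.le_succ k)) _) (sq_nonneg _)
  change _ ≤ _ + 24 * p.lg1 ^ 2 * (_ + ∫ s, dispW (state B I s (k + 1)) ∂Q)
  linarith only [h, h2]

theorem momentW_next_le (hB : B.Assumptions p I.ρ) (hI : Admissible B p I) (hc : Conditions p I)
    (hQ : FreshSeeds B s₀ Q) (k : ℕ) :
    momentW B I Q (I.σ (k + 1)) (k + 2) ≤ (1 - I.η (k + 1)) ^ 2 * momentW B I Q (I.σ k) (k + 1)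
      + 4 * I.η (k + 1) ^ 2 * noiseLevel p I (k + 1)
      + 24 * p.lg1 ^ 2 * (∫ s, moveX B I s k ∂Q + ∫ s, moveW B I s k ∂Q) := by
  have h := momentW_succ_le hB hI hc hQ (k + 1)
  rw [integral_add (integrable_dispX (stateL2 hB hI hQ (k + 1)))
    (integrable_dispW hB hI (k + 1))] at h
  have h2 := mul_le_mul_of_nonneg_left (momentW_mono (B := B) (I := I) (Q := Q)
    (hI.σ_pos (k + 1)).le (hI.σ_anti (Nat.le_succ k)) (k + 1)) (sq_nonneg (1 - I.η (k + 1)))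
  change _ ≤ _ + 24 * p.lg1 ^ 2 * (∫ s, dispX (state B I s (k + 1)) ∂Q
    + ∫ s, dispW (state B I s (k + 1)) ∂Q)
  linarith only [h, h2]

/-- The weighted moments of the estimator errors before iteration `k`, together with a bound for the
contribution of the noise of the next estimator for `x`. -/
noncomputable def noisePotential (B : Bilevel dx dy Z Ξ) (p : ProblemConsts) (I : AlgInput dx dy)
    (Q : Measure (ℕ → Seeds Z Ξ)) (k : ℕ) : ℝ :=
  noiseWeight I k * (prevMomentX B I Q k + momentW B I Q (I.σ k) (k + 1))
    + errXWeight I k * (4 * I.η k ^ 2 * noiseLevel p I k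
      + 24 * p.lg1 ^ 2 * ∫ s, dispX (state B I s k) ∂Q)

/-- The potential holds e_x only up to index k - 1, whereas step k uses e_x^k. Its noise depends on
x_k - x_{k-1}, a displacement available only in iteration k - 1, so its bound is stored one
iteration ahead. -/
theorem noisePotential_step (hB : B.Assumptions p I.ρ) (hI : Admissible B p I)
    (hc : Conditions p I) (hQ : FreshSeeds B s₀ Q) (k : ℕ) :
    noisePotential B p I Q (k + 1)
      + (4 * I.γ k / I.σ k * momentW B I Q (I.σ k) (k + 1)
        + 4 * I.α k / I.σ k * momentX B I Q (I.σ k) (k + 1))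
    ≤ noisePotential B p I Q k + 1 / (5 * (I.σ k * I.α k)) * ∫ s, moveX B I s k ∂Q
      + gapWeight p I / (2 * (I.σ k * I.γ k)) * ∫ s, moveW B I s k ∂Q
      + 1000 * (I.ρ ^ 2 / (I.σ k * I.γ k) * I.η (k + 1) ^ 2 * noiseLevel p I k) := by
  have hρ := hI.ρ_pos
  have hσ := hI.σ_pos k
  have hγ := hI.γ_pos k
  have hα := hI.α_pos k
  have hl := rho_lg1_le hB hc
  have hl0 : 0 ≤ I.ρ * p.lg1 := mul_nonneg hρ.le hB.lg1_pos.le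
  have hr : 0 ≤ I.ρ ^ 2 / (I.σ k * I.γ k) := by positivity
  refine moment_recursion_step (noiseWeight_pos hI (k + 1)).le (errXWeight_pos hI k).le
    (sq_nonneg p.lg1) (integral_dispX_nonneg (k + 1))
    (integral_nonneg fun s => by unfold moveW; positivity) (prevMomentX_nonneg k)
    (momentW_nonneg _ _) (noiseLevel_nonneg _) (noiseLevel_anti hI k)
    (momentW_next_le hB hI hc hQ k) (momentX_prev_le hB hI hc hQ k) (noiseWeight_decay hI hc k)
    (errXWeight_decay hB hI hc k) rfl (errXWeight_le hB hI hc k) (errXWeight_succ_le hB hI hc k)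
    hr (by positivity) ?_ ?_
  · have h1 : (I.ρ * p.lg1) ^ 2 ≤ (1 / 1000) ^ 2 := pow_le_pow_left₀ hl0 hl 2
    have h2 : 1 / (I.σ k * I.γ k) ≤ 1 / (I.σ k * I.α k) := by
      have := alpha_le hI hc k
      gcongr
      linarith
    have e1 : 24 * p.lg1 ^ 2 * (3 * (I.ρ ^ 2 / (I.σ k * I.γ k)))
        = 72 * (I.ρ * p.lg1) ^ 2 * (1 / (I.σ k * I.γ k)) := by ring
    have e2 : 1 / (5 * (I.σ k * I.α k)) = 1 / 5 * (1 / (I.σ k * I.α k)) := by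
      field_simp
    rw [e1, e2]
    gcongr
    linarith
  -- The gap weight is chosen for this equality: its gain in ‖w_{k+1} - w_k‖² is exactly what the
  -- noise consumes.
  · refine le_of_eq ?_
    rw [gapWeight]
    field_simp
    ring

/-- The displacement terms and the estimator errors cancel between the pathwise and the noise
inequality; the rest telescopes. -/
theorem expected_descent (hB : B.Assumptions p I.ρ) (hI : Admissible B p I)
    (hc : Conditions p I) (hQ : FreshSeeds B s₀ Q) (K : ℕ) :
    ∑ k ∈ Finset.range K, ∫ s, residualTerm B I s k ∂Q
      + (∫ s, basePotential B I s K ∂Q + gapWeight p I * ∫ s, gapPotential B I s K ∂Q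
        + noisePotential B p I Q K)
    ≤ ∫ s, basePotential B I s 0 ∂Q + gapWeight p I * ∫ s, gapPotential B I s 0 ∂Q
      + noisePotential B p I Q 0
      + ∑ k ∈ Finset.range K, (driftTerm p I k
        + 1000 * (I.ρ ^ 2 / (I.σ k * I.γ k) * I.η (k + 1) ^ 2 * noiseLevel p I k)) := by
  induction K with
  | zero => simp
  | succ k ih =>
    rw [Finset.sum_range_succ, Finset.sum_range_succ]
    have h1 := expected_potential_step hB hI hc hQ k
    have h2 := noisePotential_step hB hI hc hQ k
    linarith only [ih, h1, h2]

theorem hasMean_potential (hB : B.Assumptions p I.ρ) (hI : Admissible B p I)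
    (hc : Conditions p I) (hQ : FreshSeeds B s₀ Q) (k : ℕ) :
    HasMean Q (fun s => potential B I 4 1 1 s k) (∫ s, basePotential B I s k ∂Q
      + noiseWeight I k * (prevMomentX B I Q k + momentW B I Q (I.σ k) (k + 1))) := by
  have hP := HasMean.of_integrable (integrable_basePotential hB hI hc hQ k)
  have e1 := HasMean.of_integrable (integrable_errWy_sq hB hI hQ k)
  have e2 := HasMean.of_integrable (integrable_errWz_sq hB hI hQ k)
  have e3 : HasMean Q (fun s => errXPrevSq B I s k) (prevMomentX B I Q k) := by
    cases k with
    | zero => exact HasMean.const 0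
    | succ k => exact ⟨integrable_errX_sq hB hI hQ k, integral_errX_sq hB hI hQ k⟩
  have h := hP.add ((e3.add (e1.add e2)).const_mul (noiseWeight I k))
  rw [integral_errW_sq hB hI hQ] at h
  convert h using 2 with s
  simp only [potential, basePotential, noiseWeight, one_mul]
  ring

theorem hasMean_residual (hB : B.Assumptions p I.ρ) (hI : Admissible B p I)
    (hc : Conditions p I) (hQ : FreshSeeds B s₀ Q) (K : ℕ) :
    HasMean Q (fun s => residual B I K s)
      (∑ k ∈ Finset.range K, ∫ s, residualTerm B I s k ∂Q) :=
  HasMean.sum (fun k => HasMean.of_integrable (integrable_residualTerm hB hI hc hQ k)) K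

theorem integral_residual_le (hB : B.Assumptions p I.ρ) (hI : Admissible B p I)
    (hc : Conditions p I) (hQ : FreshSeeds B s₀ Q) (hCf : 0 ≤ p.Cf) (K : ℕ) :
    ∫ s, residual B I K s ∂Q ≤ ∫ s, potential B I 4 1 1 s 0 ∂Q - ∫ s, potential B I 4 1 1 s K ∂Q
      + ∑ k ∈ Finset.range K,
          ((I.σ k - I.σ (k + 1)) / I.σ k * (1000 * p.Cf)
            + 1000 * p.Mw ^ 2 * I.ρ ^ 2 / (1 * I.σ k * I.γ k)
                * ((I.σ k - I.σ (k + 1)) / I.σ (k + 1)) ^ 2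
            + 1 * I.ρ ^ 2 * (1000 * I.η (k + 1) ^ 2 / (I.σ k * I.γ k))
                * (I.σ k ^ 2 * p.σf ^ 2 + p.σg ^ 2))
      + 1 * I.ρ ^ 2 * (1000 * I.η 0 ^ 2 / (I.σ 0 * I.γ 0))
          * (I.σ 0 ^ 2 * p.σf ^ 2 + p.σg ^ 2)
      + 1 * (1000 * (I.ρ ^ 2 * p.lg1 ^ 2))
          * ((B.h3 I.ρ (I.σ 0) I.x₀ I.y₀ I.y₀ - B.hEnv I.ρ (I.σ 0) I.x₀ I.y₀) / I.σ 0
            + (B.g3 I.ρ I.x₀ I.z₀ I.z₀ - B.gEnv I.ρ I.x₀ I.z₀) / I.σ 0) := by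
  have h := expected_descent hB hI hc hQ K
  rw [(hasMean_residual hB hI hc hQ K).2, (hasMean_potential hB hI hc hQ 0).2,
    (hasMean_potential hB hI hc hQ K).2]
  -- The auxiliary gap is absent from the theorem's potential: it is dropped here, and at time 0 it
  -- is deterministic and gives the last term of the bound.
  have hgapK : 0 ≤ gapWeight p I * ∫ s, gapPotential B I s K ∂Q :=
    mul_nonneg gapWeight_nonneg (integral_nonneg fun s => gapPotential_nonneg hB hI s K)
  have hgap0 : gapWeight p I * ∫ s, gapPotential B I s 0 ∂Q = 1 * (1000 * (I.ρ ^ 2 * p.lg1 ^ 2))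
          * ((B.h3 I.ρ (I.σ 0) I.x₀ I.y₀ I.y₀ - B.hEnv I.ρ (I.σ 0) I.x₀ I.y₀) / I.σ 0
            + (B.g3 I.ρ I.x₀ I.z₀ I.z₀ - B.gEnv I.ρ I.x₀ I.z₀) / I.σ 0) := by
    have e := (HasMean.const (Q := Q) (gapPotential B I (fun _ => s₀) 0)).2
    have e' : ∫ s, gapPotential B I s 0 ∂Q = gapPotential B I (fun _ => s₀) 0 := e
    rw [e', one_mul, gapWeight, gapPotential, add_div]
    rfl
  have hnK : noiseWeight I K * (prevMomentX B I Q K + momentW B I Q (I.σ K) (K + 1))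
      ≤ noisePotential B p I Q K := by
    have h1 := (errXWeight_pos hI K).le
    have h2 := noiseLevel_nonneg (p := p) (I := I) K
    have h3 := integral_dispX_nonneg (B := B) (I := I) (Q := Q) K
    have h4 : 0 ≤ errXWeight I K * (4 * I.η K ^ 2 * noiseLevel p I K
      + 24 * p.lg1 ^ 2 * ∫ s, dispX (state B I s K) ∂Q) := by positivity
    unfold noisePotential
    linarith
  -- The initial state has x_{-1} = x_0, so the stored bound contains no displacement; only its
  -- variance part is added to the initial potential.
  have hn0 : noisePotential B p I Q 0
      ≤ noiseWeight I 0 * (prevMomentX B I Q 0 + momentW B I Q (I.σ 0) (0 + 1))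
        + 1 * I.ρ ^ 2 * (1000 * I.η 0 ^ 2 / (I.σ 0 * I.γ 0))
          * (I.σ 0 ^ 2 * p.σf ^ 2 + p.σg ^ 2) := by
    have e : ∫ s, dispX (state B I s 0) ∂Q = 0 := by
      have e1 : ∀ s, dispX (state B I s 0) = 0 := fun s => by
        change ‖I.x₀ - I.x₀‖ ^ 2 = 0
        simp
      simp only [e1, integral_zero]
    have h1 := errXWeight_le hB hI hc 0
    have h2 : 0 ≤ 4 * I.η 0 ^ 2 * noiseLevel p I 0 :=
      mul_nonneg (by positivity) (noiseLevel_nonneg 0)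
    have h3 := mul_le_mul_of_nonneg_right h1 h2
    have h4 : 0 ≤ I.ρ ^ 2 / (I.σ 0 * I.γ 0) * (I.η 0 ^ 2 * noiseLevel p I 0) := by
      have := hI.σ_pos 0
      have := hI.γ_pos 0
      have := noiseLevel_nonneg (p := p) (I := I) 0
      positivity
    have e2 : 1 * I.ρ ^ 2 * (1000 * I.η 0 ^ 2 / (I.σ 0 * I.γ 0))
          * (I.σ 0 ^ 2 * p.σf ^ 2 + p.σg ^ 2)
        = 1000 * (I.ρ ^ 2 / (I.σ 0 * I.γ 0) * (I.η 0 ^ 2 * noiseLevel p I 0)) := by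
      unfold noiseLevel; ring
    rw [noisePotential, e, e2]
    linarith
  have hsum : ∑ k ∈ Finset.range K, (driftTerm p I k
        + 1000 * (I.ρ ^ 2 / (I.σ k * I.γ k) * I.η (k + 1) ^ 2 * noiseLevel p I k))
      ≤ ∑ k ∈ Finset.range K,
          ((I.σ k - I.σ (k + 1)) / I.σ k * (1000 * p.Cf)
            + 1000 * p.Mw ^ 2 * I.ρ ^ 2 / (1 * I.σ k * I.γ k)
                * ((I.σ k - I.σ (k + 1)) / I.σ (k + 1)) ^ 2
            + 1 * I.ρ ^ 2 * (1000 * I.η (k + 1) ^ 2 / (I.σ k * I.γ k))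
                * (I.σ k ^ 2 * p.σf ^ 2 + p.σg ^ 2)) := by
    refine Finset.sum_le_sum fun k _ => ?_
    have hσ := hI.σ_pos k
    have hγ := hI.γ_pos k
    have hd : 0 ≤ I.σ k - I.σ (k + 1) := sub_nonneg.2 (hI.σ_anti (Nat.le_succ k))
    have h1 : 0 ≤ (I.σ k - I.σ (k + 1)) / I.σ k * p.Cf := by positivity
    have h2 : 0 ≤ p.Mw ^ 2 * I.ρ ^ 2 / (I.σ k * I.γ k)
        * ((I.σ k - I.σ (k + 1)) / I.σ (k + 1)) ^ 2 := by positivity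
    have e : (I.σ k - I.σ (k + 1)) / I.σ k * (1000 * p.Cf)
            + 1000 * p.Mw ^ 2 * I.ρ ^ 2 / (1 * I.σ k * I.γ k)
                * ((I.σ k - I.σ (k + 1)) / I.σ (k + 1)) ^ 2
            + 1 * I.ρ ^ 2 * (1000 * I.η (k + 1) ^ 2 / (I.σ k * I.γ k))
                * (I.σ k ^ 2 * p.σf ^ 2 + p.σg ^ 2)
        = 1000 * ((I.σ k - I.σ (k + 1)) / I.σ k * p.Cf)
          + 1000 * (p.Mw ^ 2 * I.ρ ^ 2 / (I.σ k * I.γ k)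
                * ((I.σ k - I.σ (k + 1)) / I.σ (k + 1)) ^ 2)
          + 1000 * (I.ρ ^ 2 / (I.σ k * I.γ k) * I.η (k + 1) ^ 2 * noiseLevel p I k) := by
      unfold noiseLevel; ring
    rw [e, driftTerm]
    linarith
  linarith only [h, hgapK, hgap0, hnK, hn0, hsum]

end Expectation

end Alg

theorem mainTheorem5 :
    ∃ c₁ c₂ c₃ c₄ c₅ c₆ c₇ c₈ c₉ c₁₀ C Cw Cη A : ℝ,
      (0 < c₁ ∧ 0 < c₂ ∧ 0 < c₃ ∧ 0 < c₄ ∧ 0 < c₅ ∧ 0 < c₆ ∧ 0 < c₇ ∧ 0 < c₈ ∧ 0 < c₉ ∧ 0 < c₁₀) ∧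
      4 ≤ C ∧ 0 < Cw ∧ 0 < Cη ∧ 0 < A ∧
      ∀ (dx dy : ℕ) (Z Ξ Ω : Type*) [MeasurableSpace Z] [MeasurableSpace Ξ] [MeasurableSpace Ω]
        (P : Measure Ω) [IsProbabilityMeasure P]
        (B : Bilevel dx dy Z Ξ) (p : ProblemConsts) (I : AlgInput dx dy)
        (S : ℕ → Ω → Seeds Z Ξ) (K : ℕ),
        B.Assumptions p I.ρ →
        Alg.Admissible B p I →
        Alg.StepConditions p I c₁ c₂ c₃ c₄ c₅ c₆ c₇ c₈ c₉ c₁₀ →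
        (∀ k, Measurable (S k)) →
        (∀ k, P.map (S k) = B.seedLaw) →
        iIndepFun S P →
        Integrable (fun ω => Alg.residual B I K (fun k => S k ω)) P ∧
        Integrable (fun ω => Alg.potential B I C Cw Cη (fun k => S k ω) 0) P ∧
        Integrable (fun ω => Alg.potential B I C Cw Cη (fun k => S k ω) K) P ∧
        ∫ ω, Alg.residual B I K (fun k => S k ω) ∂P
          ≤ ∫ ω, (Alg.potential B I C Cw Cη (fun k => S k ω) 0
                - Alg.potential B I C Cw Cη (fun k => S k ω) K) ∂P
            + ∑ k ∈ Finset.range K,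
                ((I.σ k - I.σ (k + 1)) / I.σ k * (A * p.Cf)
                  + A * p.Mw ^ 2 * I.ρ ^ 2 / (Cw * I.σ k * I.γ k)
                      * ((I.σ k - I.σ (k + 1)) / I.σ (k + 1)) ^ 2
                  + Cη * I.ρ ^ 2 * (A * I.η (k + 1) ^ 2 / (I.σ k * I.γ k))
                      * (I.σ k ^ 2 * p.σf ^ 2 + p.σg ^ 2))
            + Cη * I.ρ ^ 2 * (A * I.η 0 ^ 2 / (I.σ 0 * I.γ 0))
                * (I.σ 0 ^ 2 * p.σf ^ 2 + p.σg ^ 2)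
            + Cη * (A * (I.ρ ^ 2 * p.lg1 ^ 2))
                * ((B.h3 I.ρ (I.σ 0) I.x₀ I.y₀ I.y₀ - B.hEnv I.ρ (I.σ 0) I.x₀ I.y₀) / I.σ 0
                  + (B.g3 I.ρ I.x₀ I.z₀ I.z₀ - B.gEnv I.ρ I.x₀ I.z₀) / I.σ 0) := by
  -- C = 4 leaves three copies of the g-envelope after the subtraction. A = 1000 dominates the
  -- constants 8 and 578 of the drift and 4 · 101/100 of the initial variance, and equals those of
  -- the running variance and the gap weight.
  refine ⟨1, 1 / 1000, 1 / 16, 1 / 16, 1, 1 / 100, 1 / 1000, 1 / 100000, 100, 1 / 4, 4, 1, 1, 1000,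
    by norm_num, le_rfl, one_pos, one_pos, by norm_num, ?_⟩
  intro dx dy Z Ξ Ω _ _ _ P _ B p I S K hB hI hc hS hlaw hind
  have hSS : Measurable fun ω k => S k ω := measurable_pi_lambda _ hS
  have : IsProbabilityMeasure (P.map fun ω k => S k ω) :=
    Measure.isProbabilityMeasure_map hSS.aemeasurable
  -- Any seed can serve as the default value put in place of erased ones; a value of S 0 provides
  -- one.
  obtain ⟨ω₀⟩ : Nonempty Ω := nonempty_of_isProbabilityMeasure P
  have hQ : Alg.FreshSeeds B (S 0 ω₀) (P.map fun ω k => S k ω) :=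
    Alg.freshSeeds_map _ hS hlaw hind
  have hCf : 0 ≤ p.Cf := (abs_nonneg _).trans (hB.bounded_f _ hI.x₀_mem _ hI.y₀_mem)
  -- All quantities depend on ω through the seed sequence only, so the estimates are proved on
  -- sequence space under the image measure.
  have transfer : ∀ {F : (ℕ → Seeds Z Ξ) → ℝ}, Integrable F (P.map fun ω k => S k ω) →
      Integrable (fun ω => F fun k => S k ω) P ∧
        ∫ ω, F (fun k => S k ω) ∂P = ∫ s, F s ∂(P.map fun ω k => S k ω) := fun hF =>
    ⟨hF.comp_measurable hSS, (integral_map hSS.aemeasurable hF.1).symm⟩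
  obtain ⟨r1, r2⟩ := transfer (Alg.hasMean_residual hB hI hc hQ K).1
  obtain ⟨a1, a2⟩ := transfer (Alg.hasMean_potential hB hI hc hQ 0).1
  obtain ⟨b1, b2⟩ := transfer (Alg.hasMean_potential hB hI hc hQ K).1
  refine ⟨r1, a1, b1, ?_⟩
  rw [integral_sub a1 b1, r2, a2, b2]
  exact Alg.integral_residual_le hB hI hc hQ hCf K
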